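/- Let $\tilde M$ be a $(2m+1)$-dimensional cosymplectic manifold, i.e. a Riemannian manifold $(\tilde M,g)$ with a tensor field $\varphi$ of type $(1,1)$, a vector field $\xi$ and a $1$-form $\eta$ such that $\varphi^2=-\mathrm{Id}+\eta\otimes\xi$, $\eta(\xi)=1$, $g(\varphi X,\varphi Y)=g(X,Y)-\eta(X)\eta(Y)$, $d\eta=0$, $d\Phi=0$ for $\Phi(X,Y)=g(X,\varphi Y)$, and $[\varphi,\varphi]+2\,d\eta\otimes\xi=0$. Suppose that $\tilde M=\tilde M(c)$ is a cosymplectic space form: its $\varphi$-sectional curvature is constant, equal to $c$ (the plane spanned by $X$ and $\varphi X$ has sectional curvature $c$ for every unit vector $X\perp\xi$). Let $(M_T,g_T)$ and $(M_\perp,g_\perp)$ be Riemannian manifolds with $\dim M_T=2p+1$ and $\dim M_\perp=q$, let $f:M_T\to(0,\infty)$ be smooth, and let $M=M_T\times_f M_\perp$ be their warped product, i.e. $M_T\times M_\perp$ with the metric $g_T+f^2g_\perp$. Suppose that $M$ is isometrically immersed in $\tilde M(c)$ as a contact CR-warped product submanifold: every leaf $M_T\times\{b\}$ is an invariant submanifold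 (it is tangent to $\xi$ and $\varphi$ maps each of its tangent spaces into itself), and every leaf $\{a\}\times M_\perp$ is an anti-invariant submanifold ($\varphi$ maps each of its tangent spaces into the normal space). Let $\sigma$ be the second fundamental form of $M$ in $\tilde M(c)$, and let $\|\sigma\|^2=\sum_{i,j}g(\sigma(e_i,e_j),\sigma(e_i,e_j))$ for an orthonormal frame $(e_i)$ of $M$. Let $\nabla$ and $\Delta$ be the gradient and the Laplacian of $M_T$, the latter with the sign $\Delta\psi=\sum_i\{(\nabla_{e_i}e_i)\psi-e_ie_i\psi\}$ for orthonormal frames $(e_i)$ of $M_T$. Then: (i) at every point of $M$, $$\|\sigma\|^2\;\ge\;2q\Big(\|\nabla(\ln f)\|^2-\Delta(\ln f)+\frac{pc}{2}\Big);$$ (ii) if equality holds in (i) at every point of $M$, then $M_T$ is totally geodesic and $M_\perp$ is totally umbilical in $\tilde M(c)$, i.e. every leaf $M_T\times\{b\}$ is a totally geodesic and every leaf $\{a\}\times M_\perp$ a totally umbilical submanifold of $\tilde M(c)$. -/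

import Mathlib

open Bundle Manifold VectorField
open scoped ContDiff

noncomputable section

namespace WarpedCR

/-!
Conventions. Manifolds are smooth, finite-dimensional, real and without boundary. The metric of a
Riemannian manifold is the one given by `RiemannianBundle` on its tangent bundle, and `inner ℝ u v`
is `g(u, v)`. The Levi-Civita connection enters through its Christoffel symbols in the preferred
charts.
-/

section Riemannian

variable {E : Type*} [NormedAddCommGroup E] [NormedSpace ℝ E]
  {H : Type*} [TopologicalSpace H] (I : ModelWithCorners ℝ E H)
  {M : Type*} [TopologicalSpace M] [ChartedSpace H M]

instance tangentSpace_finiteDimensional [FiniteDimensional ℝ E] (x : M) :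
    FiniteDimensional ℝ (TangentSpace I x) :=
  inferInstanceAs (FiniteDimensional ℝ E)

/-- The differential at `x` of the preferred chart around `x`: it sends a tangent vector to its
components. -/
def toCoord (x : M) : TangentSpace I x →L[ℝ] E :=
  mvfderiv I (extChartAt I x) x

/-- The tangent vector at `x` with given components in the preferred chart around `x`. -/
def ofCoord (x : M) : E →L[ℝ] TangentSpace I x :=
  (toCoord I x).inverse

/-- The coordinate fields of the preferred chart around `x₀`: the differential at `y` of the
inverse chart. -/
def coordFrame (x₀ : M) (y : E) : E →L[ℝ] TangentSpace I ((extChartAt I x₀).symm y) :=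
  (mfderiv 𝓘(ℝ, E) I (extChartAt I x₀).symm y) ∘L
    (NormedSpace.fromTangentSpace y).symm.toContinuousLinearMap

variable [RiemannianBundle (fun x : M ↦ TangentSpace I x)]

/-- The metric coefficients `g_y(u, v)` in the preferred chart around `x₀`. -/
def coordMetric (x₀ : M) (y : E) : E →L[ℝ] E →L[ℝ] ℝ :=
  (innerSL ℝ (E := TangentSpace I ((extChartAt I x₀).symm y))).bilinearComp
    (coordFrame I x₀ y) (coordFrame I x₀ y)

/-- Christoffel symbols of the first kind,
`w ↦ (1/2) (∂_u g(v, w) + ∂_v g(u, w) - ∂_w g(u, v))`. -/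
def christoffelFirst (x₀ : M) (y u v : E) : E →L[ℝ] ℝ :=
  (1 / 2 : ℝ) • (fderiv ℝ (coordMetric I x₀) y u v + fderiv ℝ (coordMetric I x₀) y v u
    - ((fderiv ℝ (coordMetric I x₀) y).flip u).flip v)

/-- Christoffel symbols of the Levi-Civita connection in the preferred chart around `x₀`: the
covariant derivative of the coordinate field `v` in the direction `u`, in components. -/
def christoffel (x₀ : M) (y u v : E) : E :=
  (coordMetric I x₀ y).inverse (christoffelFirst I x₀ y u v)

/-- Components of `R(u, v) w = ∇_u ∇_v w - ∇_v ∇_u w` for coordinate fields `u`, `v`, `w` of the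
preferred chart around `x₀`. -/
def coordCurvature (x₀ : M) (y u v w : E) : E :=
  fderiv ℝ (fun z ↦ christoffel I x₀ z v w) y u - fderiv ℝ (fun z ↦ christoffel I x₀ z u w) y v
    + christoffel I x₀ y u (christoffel I x₀ y v w)
    - christoffel I x₀ y v (christoffel I x₀ y u w)

/-- The Riemannian curvature `R(u, v) w`, with `R(X, Y) = [∇_X, ∇_Y] - ∇_[X, Y]`. -/
def curvature (x : M) (u v w : TangentSpace I x) : TangentSpace I x :=
  ofCoord I x (coordCurvature I x (extChartAt I x x)
    (toCoord I x u) (toCoord I x v) (toCoord I x w))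

/-- The gradient of a function. -/
def grad [FiniteDimensional ℝ E] (ψ : M → ℝ) (x : M) : TangentSpace I x :=
  haveI : CompleteSpace (TangentSpace I x) := FiniteDimensional.complete ℝ _
  (InnerProductSpace.toDual ℝ (TangentSpace I x)).symm (mvfderiv I ψ x)

/-- The Hessian `u v ψ - (∇_u v) ψ` of a function. -/
def hessian (ψ : M → ℝ) (x : M) (u v : TangentSpace I x) : ℝ :=
  let ψ' : E → ℝ := ψ ∘ (extChartAt I x).symm
  let y : E := extChartAt I x x
  fderiv ℝ (fderiv ℝ ψ') y (toCoord I x u) (toCoord I x v)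
    - fderiv ℝ ψ' y (christoffel I x y (toCoord I x u) (toCoord I x v))

/-- The Laplacian with the sign `Δ ψ = ∑ i, ((∇_{e i} e i) ψ - e i (e i ψ))`, for an orthonormal
frame `e`. -/
def laplacian [FiniteDimensional ℝ E] (ψ : M → ℝ) (x : M) : ℝ :=
  ∑ i, -hessian I ψ x (stdOrthonormalBasis ℝ (TangentSpace I x) i)
    (stdOrthonormalBasis ℝ (TangentSpace I x) i)

end Riemannian

section Submanifold

variable {E : Type*} [NormedAddCommGroup E] [NormedSpace ℝ E]
  {H : Type*} [TopologicalSpace H] (I : ModelWithCorners ℝ E H)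
  {M : Type*} [TopologicalSpace M] [ChartedSpace H M]
  {E' : Type*} [NormedAddCommGroup E'] [NormedSpace ℝ E'] [FiniteDimensional ℝ E']
  {H' : Type*} [TopologicalSpace H'] (J : ModelWithCorners ℝ E' H')
  {N : Type*} [TopologicalSpace N] [ChartedSpace H' N]
  [RiemannianBundle (fun x : N ↦ TangentSpace J x)]

/-- The tangent space at `x` of the immersed submanifold `j : M → N`. -/
def tangentImage (j : M → N) (x : M) : Submodule ℝ (TangentSpace J (j x)) :=
  LinearMap.range (mfderiv I J j x).toLinearMap

/-- The metric induced on `M` by `j : M → N`. -/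
def inducedInner (j : M → N) (x : M) (u v : TangentSpace I x) : ℝ :=
  inner ℝ (mfderiv I J j x u) (mfderiv I J j x v)

/-- The second fundamental form `σ(u, v)` of an immersion `j : M → N`: the component normal to `M`
of the ambient covariant derivative, in the direction `u`, of the field `dj(v)` along `j`, where
`v` is extended with constant components in a chart. -/
def sff (j : M → N) (x : M) (u v : TangentSpace I x) : TangentSpace J (j x) :=
  let j' : E → E' := writtenInExtChartAt I J x j
  let y : E := extChartAt I x x
  (tangentImage I J j x)ᗮ.starProjection (ofCoord J (j x)
    (fderiv ℝ (fderiv ℝ j') y (toCoord I x u) (toCoord I x v)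
      + christoffel J (j x) (extChartAt J (j x) (j x))
          (fderiv ℝ j' y (toCoord I x u)) (fderiv ℝ j' y (toCoord I x v))))

/-- A frame of the tangent space of `M` at `x`, orthonormal for the metric induced by `j`. -/
def inducedFrame (j : M → N) (x : M) (i : Fin (Module.finrank ℝ (tangentImage I J j x))) :
    TangentSpace I x :=
  (stdOrthonormalBasis ℝ (tangentImage I J j x) i).2.choose

/-- The squared norm `‖σ‖²` of the second fundamental form. -/
def sffNormSq (j : M → N) (x : M) : ℝ :=
  ∑ i, ∑ k, ‖sff I J j x (inducedFrame I J j x i) (inducedFrame I J j x k)‖ ^ 2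

/-- The mean curvature vector. -/
def meanCurvature (j : M → N) (x : M) : TangentSpace J (j x) :=
  (Module.finrank ℝ (TangentSpace I x) : ℝ)⁻¹ •
    ∑ i, sff I J j x (inducedFrame I J j x i) (inducedFrame I J j x i)

def IsTotallyGeodesic (j : M → N) : Prop :=
  ∀ (x : M) (u v : TangentSpace I x), sff I J j x u v = 0

def IsTotallyUmbilical (j : M → N) : Prop :=
  ∀ (x : M) (u v : TangentSpace I x),
    sff I J j x u v = inducedInner I J j x u v • meanCurvature I J j x

end Submanifold

section WarpedProduct

variable {E₁ : Type*} [NormedAddCommGroup E₁] [NormedSpace ℝ E₁]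
  {H₁ : Type*} [TopologicalSpace H₁] (I₁ : ModelWithCorners ℝ E₁ H₁)
  {M₁ : Type*} [TopologicalSpace M₁] [ChartedSpace H₁ M₁]
  [RiemannianBundle (fun x : M₁ ↦ TangentSpace I₁ x)]
  {E₂ : Type*} [NormedAddCommGroup E₂] [NormedSpace ℝ E₂]
  {H₂ : Type*} [TopologicalSpace H₂] (I₂ : ModelWithCorners ℝ E₂ H₂)
  {M₂ : Type*} [TopologicalSpace M₂] [ChartedSpace H₂ M₂]
  [RiemannianBundle (fun x : M₂ ↦ TangentSpace I₂ x)]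

/-- The metric of the warped product `M₁ ×_f M₂`. -/
def warpedInner (f : M₁ → ℝ) (x : M₁ × M₂) (u v : TangentSpace (I₁.prod I₂) x) : ℝ :=
  inner ℝ (mfderiv (I₁.prod I₂) I₁ Prod.fst x u) (mfderiv (I₁.prod I₂) I₁ Prod.fst x v)
    + f x.1 ^ 2 *
      inner ℝ (mfderiv (I₁.prod I₂) I₂ Prod.snd x u) (mfderiv (I₁.prod I₂) I₂ Prod.snd x v)

end WarpedProduct

section AlmostContact

variable {E : Type*} [NormedAddCommGroup E] [NormedSpace ℝ E]
  {H : Type*} [TopologicalSpace H] (I : ModelWithCorners ℝ E H)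
  (M : Type*) [TopologicalSpace M] [ChartedSpace H M] [IsManifold I ∞ M]
  [RiemannianBundle (fun x : M ↦ TangentSpace I x)]

/-- An almost contact structure `(φ, ξ, η)` compatible with the metric of `M`. -/
structure AlmostContactMetric where
  φ : ∀ x : M, TangentSpace I x →L[ℝ] TangentSpace I x
  ξ : ∀ x : M, TangentSpace I x
  η : ∀ x : M, TangentSpace I x →L[ℝ] ℝ
  contMDiff_φ : ContMDiff I (I.prod 𝓘(ℝ, E →L[ℝ] E)) ∞
    (fun x ↦ TotalSpace.mk' (E →L[ℝ] E)
      (E := fun x : M ↦ TangentSpace I x →L[ℝ] TangentSpace I x) x (φ x))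
  contMDiff_ξ : ContMDiff I I.tangent ∞ (fun x ↦ (⟨x, ξ x⟩ : TangentBundle I M))
  contMDiff_η : ContMDiff I (I.prod 𝓘(ℝ, E →L[ℝ] ℝ)) ∞
    (fun x ↦ TotalSpace.mk' (E →L[ℝ] ℝ)
      (E := fun x : M ↦ TangentSpace I x →L[ℝ] Trivial M ℝ x) x (η x))
  φ_φ : ∀ (x : M) (u : TangentSpace I x), φ x (φ x u) = -u + η x u • ξ x
  η_ξ : ∀ x : M, η x (ξ x) = 1
  compatible : ∀ (x : M) (u v : TangentSpace I x),
    inner ℝ (φ x u) (φ x v) = inner ℝ u v - η x u * η x v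

variable {I M}

/-- `X` is a vector field that is smooth around `x`. -/
def SmoothFieldAt (X : ∀ x : M, TangentSpace I x) (x : M) : Prop :=
  ContMDiffAt I I.tangent ∞ (fun z ↦ (⟨z, X z⟩ : TangentBundle I M)) x

namespace AlmostContactMetric

variable (S : AlmostContactMetric I M)

/-- The fundamental 2-form `Φ(u, v) = g(u, φ v)`. -/
def fundamentalForm (x : M) (u v : TangentSpace I x) : ℝ := inner ℝ u (S.φ x v)

/-- `X η(Y) - Y η(X) - η([X, Y])`, the exterior derivative of `η` (twice it, if one uses the
convention with a factor `1/2`). -/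
def dEta (X Y : ∀ x : M, TangentSpace I x) (x : M) : ℝ :=
  mvfderiv I (fun z ↦ S.η z (Y z)) x (X x) - mvfderiv I (fun z ↦ S.η z (X z)) x (Y x)
    - S.η x (mlieBracket I X Y x)

/-- The exterior derivative of the fundamental 2-form (up to the factor `1/3` of some authors). -/
def dPhi (X Y Z : ∀ x : M, TangentSpace I x) (x : M) : ℝ :=
  mvfderiv I (fun z ↦ S.fundamentalForm z (Y z) (Z z)) x (X x)
    + mvfderiv I (fun z ↦ S.fundamentalForm z (Z z) (X z)) x (Y x)
    + mvfderiv I (fun z ↦ S.fundamentalForm z (X z) (Y z)) x (Z x)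
    - S.fundamentalForm x (mlieBracket I X Y x) (Z x)
    - S.fundamentalForm x (mlieBracket I Y Z x) (X x)
    - S.fundamentalForm x (mlieBracket I Z X x) (Y x)

/-- The Nijenhuis torsion
`[φ, φ](X, Y) = φ² [X, Y] + [φ X, φ Y] - φ [φ X, Y] - φ [X, φ Y]`. -/
def nijenhuis (X Y : ∀ x : M, TangentSpace I x) (x : M) : TangentSpace I x :=
  S.φ x (S.φ x (mlieBracket I X Y x))
    + mlieBracket I (fun z ↦ S.φ z (X z)) (fun z ↦ S.φ z (Y z)) x
    - S.φ x (mlieBracket I (fun z ↦ S.φ z (X z)) Y x)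
    - S.φ x (mlieBracket I X (fun z ↦ S.φ z (Y z)) x)

/-- `dη = 0` and `dΦ = 0`. -/
def IsAlmostCosymplectic : Prop :=
  (∀ (x : M) (X Y : ∀ x : M, TangentSpace I x), SmoothFieldAt X x → SmoothFieldAt Y x →
    S.dEta X Y x = 0) ∧
  (∀ (x : M) (X Y Z : ∀ x : M, TangentSpace I x), SmoothFieldAt X x → SmoothFieldAt Y x →
    SmoothFieldAt Z x → S.dPhi X Y Z x = 0)

/-- Normality, `[φ, φ] + 2 dη ⊗ ξ = 0` in the convention for `dη` with the factor `1/2`. -/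
def IsNormal : Prop :=
  ∀ (x : M) (X Y : ∀ x : M, TangentSpace I x), SmoothFieldAt X x → SmoothFieldAt Y x →
    S.nijenhuis X Y x + S.dEta X Y x • S.ξ x = 0

def IsCosymplectic : Prop := S.IsAlmostCosymplectic ∧ S.IsNormal

/-- A cosymplectic manifold all of whose `φ`-sectional curvatures are `c`: every plane spanned by
a unit vector `u` orthogonal to `ξ` and by `φ u` has sectional curvature `c`. -/
def IsCosymplecticSpaceForm (c : ℝ) : Prop :=
  S.IsCosymplectic ∧
    ∀ (x : M) (u : TangentSpace I x), inner ℝ u u = (1 : ℝ) → inner ℝ u (S.ξ x) = (0 : ℝ) →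
      inner ℝ (curvature I x u (S.φ x u) (S.φ x u)) u = c

variable {E' : Type*} [NormedAddCommGroup E'] [NormedSpace ℝ E']
  {H' : Type*} [TopologicalSpace H'] (I' : ModelWithCorners ℝ E' H')
  {L : Type*} [TopologicalSpace L] [ChartedSpace H' L]

/-- The submanifold `j : L → M` is tangent to `ξ` and its tangent spaces are preserved by `φ`. -/
def IsInvariant (j : L → M) : Prop :=
  ∀ x : L, (∃ w : TangentSpace I' x, mfderiv I' I j x w = S.ξ (j x)) ∧
    ∀ u : TangentSpace I' x, ∃ v : TangentSpace I' x,
      S.φ (j x) (mfderiv I' I j x u) = mfderiv I' I j x v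

/-- `φ` maps the tangent spaces of the submanifold `j : L → M` into its normal spaces. -/
def IsAntiInvariant (j : L → M) : Prop :=
  ∀ (x : L) (u v : TangentSpace I' x),
    inner ℝ (S.φ (j x) (mfderiv I' I j x u)) (mfderiv I' I j x v) = (0 : ℝ)

end AlmostContactMetric

end AlmostContact

section ContactCR

variable {E : Type*} [NormedAddCommGroup E] [NormedSpace ℝ E]
  {H : Type*} [TopologicalSpace H] {J : ModelWithCorners ℝ E H}
  {N : Type*} [TopologicalSpace N] [ChartedSpace H N] [IsManifold J ∞ N]
  [RiemannianBundle (fun x : N ↦ TangentSpace J x)]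
  {E₁ : Type*} [NormedAddCommGroup E₁] [NormedSpace ℝ E₁]
  {H₁ : Type*} [TopologicalSpace H₁] (I₁ : ModelWithCorners ℝ E₁ H₁)
  {M₁ : Type*} [TopologicalSpace M₁] [ChartedSpace H₁ M₁]
  [RiemannianBundle (fun x : M₁ ↦ TangentSpace I₁ x)]
  {E₂ : Type*} [NormedAddCommGroup E₂] [NormedSpace ℝ E₂]
  {H₂ : Type*} [TopologicalSpace H₂] (I₂ : ModelWithCorners ℝ E₂ H₂)
  {M₂ : Type*} [TopologicalSpace M₂] [ChartedSpace H₂ M₂]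
  [RiemannianBundle (fun x : M₂ ↦ TangentSpace I₂ x)]

/-- `ι` is an isometric immersion into `N` of the warped product `M₁ ×_f M₂`, with smooth positive
warping function `f`, whose leaves `M₁ × {b}` are invariant submanifolds of `N` and whose leaves
`{a} × M₂` are anti-invariant submanifolds of `N`. -/
structure IsContactCRWarpedProduct (S : AlmostContactMetric J N) (f : M₁ → ℝ)
    (ι : M₁ × M₂ → N) : Prop where
  smooth_f : ContMDiff I₁ 𝓘(ℝ, ℝ) ∞ f
  pos_f : ∀ a, 0 < f a
  smooth_ι : ContMDiff (I₁.prod I₂) J ∞ ι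
  isometric : ∀ (x : M₁ × M₂) (u v : TangentSpace (I₁.prod I₂) x),
    inducedInner (I₁.prod I₂) J ι x u v = warpedInner I₁ I₂ f x u v
  invariant : ∀ b : M₂, S.IsInvariant I₁ (fun a ↦ ι (a, b))
  antiInvariant : ∀ a : M₁, S.IsAntiInvariant I₂ (fun b ↦ ι (a, b))

end ContactCR

end WarpedCR

end

/-! In a frame adapted to the warped product, `‖σ‖²` is the sum of a block on `M_T`, a block on
`M_⊥` and twice a mixed block. The mixed block is not merely estimated: at every point it equals `q
(‖∇ ln f‖² - Δ ln f + pc/2)`. The other two blocks are nonnegative, which gives the inequality, and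
equality forces them to vanish.

The value of the mixed block comes from two expressions for the curvature of mixed planes. On the
ambient side, `dη = 0`, `dΦ = 0` and normality make `φ` and `ξ` parallel (`parallel_aux`). Hence the
curvature commutes with `φ` and annihilates `ξ`, and polarizing the constant `φ`-sectional curvature
gives `R(u,v,v,u) + R(φu,v,v,φu) = (c/2)(|u|² - η(u)²)|v|²` for `v` orthogonal to `ξ`, `u` and `φu`
(`sectional_add_sectional_φ`). On the side of `M`, with `ψ = ln f`, the Gauss equation of a mixed
plane (`gauss_warped`) reads `R(u,v,v,u) = -(Hess ψ(u,u) + (uψ)²)|v|² - g(σ(v,v), σ(u,u)) +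
|σ(u,v)|²`. Since `φ` is parallel and preserves the tangent spaces of `M_T`, `σ` is complex linear
there, so `σ(φu,φu) = -σ(u,u)` (`normalPart_φ_φ`). Adding the Gauss equations for `u` and `φu`
therefore cancels the unknown product, and `|σ(u,v)|² + |σ(φu,v)|²` is expressed by `ψ` and `c`
alone (`mixed_normalPart_add`).

Now sum over a frame `e i` of `M_T`. The trace over `φ(e i)` is the trace over `e i` minus the term
at `ξ` (`IsFrame.sum_diag_sub`), and the `ξ` terms vanish because `ξ` is parallel: `σ(ξ,v) = 0`, `ξψ
= 0` and `Hess ψ(ξ,ξ) = 0` (`mixed_normalPart_ξ`). So both halves of the sum agree, and halving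
gives the mixed block (`sum_mixed_normalPart`).

In the equality case, the ambient derivative of fields tangent to an `M_T` leaf stays tangent to the
leaf. For an `M_⊥` leaf its normal part is `-g(u,v) ∇ ln f`, a multiple of the metric, so the leaf
is umbilical.

Everything is computed in charts, with Christoffel symbols as bilinear maps on a normed space; the
tangent spaces of the manifolds are then identified with the model spaces. -/

noncomputable section

namespace WarpedCR

/-- A shortcut for the norm of bilinear maps, which instance resolution finds only slowly. -/
instance normedAddCommGroupBilin {E F G : Type*} [NormedAddCommGroup E]
    [NormedSpace ℝ E] [NormedAddCommGroup F] [NormedSpace ℝ F] [NormedAddCommGroup G]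
    [NormedSpace ℝ G] : NormedAddCommGroup (E →L[ℝ] F →L[ℝ] G) :=
  ContinuousLinearMap.toNormedAddCommGroup

/-! ### Covariant derivatives along a map, in coordinates -/

section CovariantDerivative

variable {E : Type*} [NormedAddCommGroup E] [NormedSpace ℝ E]
  {F : Type*} [NormedAddCommGroup F] [NormedSpace ℝ F]

/-- The covariant derivative at `z`, in the direction `u`, of the field `V` along the map `j`,
for the connection with Christoffel symbols `Γ`. -/
def covDeriv (Γ : F → F →L[ℝ] F →L[ℝ] F) (j V : E → F) (z u : E) : F :=
  fderiv ℝ V z u + Γ (j z) (fderiv ℝ j z u) (V z)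

/-- The curvature of the connection with Christoffel symbols `Γ`. -/
def curvatureOf (Γ : F → F →L[ℝ] F →L[ℝ] F) (y u v w : F) : F :=
  fderiv ℝ Γ y u v w - fderiv ℝ Γ y v u w + Γ y u (Γ y v w) - Γ y v (Γ y u w)

variable {g : F → F →L[ℝ] F →L[ℝ] ℝ} {Γ : F → F →L[ℝ] F →L[ℝ] F} {j V W : E → F} {z : E}

theorem fderiv_metric_along (hg : DifferentiableAt ℝ g (j z)) (hj : DifferentiableAt ℝ j z)
    (hV : DifferentiableAt ℝ V z) (hW : DifferentiableAt ℝ W z)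
    (compat : ∀ u v w, fderiv ℝ g (j z) u v w
      = g (j z) (Γ (j z) u v) w + g (j z) v (Γ (j z) u w)) (u : E) :
    fderiv ℝ (fun z ↦ g (j z) (V z) (W z)) z u
      = g (j z) (covDeriv Γ j V z u) (W z) + g (j z) (V z) (covDeriv Γ j W z u) := by
  have h0 := HasFDerivAt.comp (G := F →L[ℝ] F →L[ℝ] ℝ) z hg.hasFDerivAt hj.hasFDerivAt
  have h1 := HasFDerivAt.clm_apply (G := F) (H := F →L[ℝ] ℝ) h0 hV.hasFDerivAt
  have h' := congrArg (fun L ↦ L u) (h1.clm_apply hW.hasFDerivAt).fderiv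
  simp only [Function.comp_apply] at h'
  rw [h']
  simp [covDeriv, compat]
  ring

theorem covDeriv_parallel_endomorphism {φ : F → F →L[ℝ] F} (hφ : DifferentiableAt ℝ φ (j z))
    (hj : DifferentiableAt ℝ j z) (hV : DifferentiableAt ℝ V z)
    (par : ∀ u v, fderiv ℝ φ (j z) u v + Γ (j z) u (φ (j z) v) = φ (j z) (Γ (j z) u v)) (u : E) :
    covDeriv Γ j (fun z ↦ φ (j z) (V z)) z u = φ (j z) (covDeriv Γ j V z u) := by
  have h := ((hφ.hasFDerivAt.comp z hj.hasFDerivAt).clm_apply hV.hasFDerivAt).fderiv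
  have h' := congrArg (fun L ↦ L u) h
  simp only [Function.comp_apply] at h'
  rw [covDeriv, h', covDeriv, map_add, ← par]
  simp
  abel

theorem covDeriv_parallel_field {ξ : F → F} (hξ : DifferentiableAt ℝ ξ (j z))
    (hj : DifferentiableAt ℝ j z)
    (par : ∀ u, fderiv ℝ ξ (j z) u + Γ (j z) u (ξ (j z)) = 0) (u : E) :
    covDeriv Γ j (fun z ↦ ξ (j z)) z u = 0 := by
  have h := (hξ.hasFDerivAt.comp z hj.hasFDerivAt).fderiv
  have h' := congrArg (fun L ↦ L u) h
  simp only [Function.comp_def] at h'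
  rw [covDeriv, h']
  exact par _

theorem fderiv_fderiv_apply (hj : ContDiffAt ℝ 2 j z) (u v : E) :
    fderiv ℝ (fun z ↦ fderiv ℝ j z v) z u = fderiv ℝ (fderiv ℝ j) z u v := by
  have h : DifferentiableAt ℝ (fderiv ℝ j) z :=
    (hj.fderiv_right (m := 1) (by norm_num)).differentiableAt (by norm_num)
  rw [fderiv_clm_apply h (differentiableAt_const v)]
  simp

theorem fderiv_fderiv_symm (hj : ContDiffAt ℝ 2 j z) (u v : E) :
    fderiv ℝ (fderiv ℝ j) z u v = fderiv ℝ (fderiv ℝ j) z v u :=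
  (hj.isSymmSndFDerivAt (by simp)).eq u v

theorem differentiableAt_covDeriv (hΓ : DifferentiableAt ℝ Γ (j z)) (hj : ContDiffAt ℝ 2 j z)
    (hV : ContDiffAt ℝ 2 V z) (u : E) : DifferentiableAt ℝ (fun z ↦ covDeriv Γ j V z u) z := by
  have h1 : DifferentiableAt ℝ (fderiv ℝ j) z :=
    (hj.fderiv_right (m := 1) (by norm_num)).differentiableAt (by norm_num)
  have h2 : DifferentiableAt ℝ (fderiv ℝ V) z :=
    (hV.fderiv_right (m := 1) (by norm_num)).differentiableAt (by norm_num)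
  have h3 : DifferentiableAt ℝ (fun z ↦ Γ (j z)) z :=
    DifferentiableAt.comp (G := F →L[ℝ] F →L[ℝ] F) z hΓ (hj.differentiableAt (by norm_num))
  have h4 := hV.differentiableAt (by norm_num)
  unfold covDeriv
  exact (h2.clm_apply (differentiableAt_const u)).add
    ((DifferentiableAt.clm_apply (G := F) (H := F →L[ℝ] F) h3
      (h1.clm_apply (differentiableAt_const u))).clm_apply h4)

/-- After antisymmetrizing in `u` and `v`, the second derivatives of `V` and `j` cancel by symmetry,
and so do the products of `Γ` with a first derivative of `V`. Only the derivative and the square of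
`Γ` survive. Symmetry of `Γ` plays no role. -/
theorem covDeriv_commutator (hΓ : DifferentiableAt ℝ Γ (j z)) (hj : ContDiffAt ℝ 2 j z)
    (hV : ContDiffAt ℝ 2 V z) (u v : E) :
    covDeriv Γ j (fun z ↦ covDeriv Γ j V z v) z u - covDeriv Γ j (fun z ↦ covDeriv Γ j V z u) z v
      = curvatureOf Γ (j z) (fderiv ℝ j z u) (fderiv ℝ j z v) (V z) := by
  have key : ∀ u v : E, fderiv ℝ (fun z ↦ covDeriv Γ j V z v) z u
      = fderiv ℝ (fderiv ℝ V) z u v + fderiv ℝ Γ (j z) (fderiv ℝ j z u) (fderiv ℝ j z v) (V z)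
        + Γ (j z) (fderiv ℝ (fderiv ℝ j) z u v) (V z)
        + Γ (j z) (fderiv ℝ j z v) (fderiv ℝ V z u) := by
    intro u v
    have h1 : DifferentiableAt ℝ (fderiv ℝ j) z :=
      (hj.fderiv_right (m := 1) (by norm_num)).differentiableAt (by norm_num)
    have h2 : DifferentiableAt ℝ (fderiv ℝ V) z :=
      (hV.fderiv_right (m := 1) (by norm_num)).differentiableAt (by norm_num)
    have h3 := HasFDerivAt.comp (G := F →L[ℝ] F →L[ℝ] F) z hΓ.hasFDerivAt
        (hj.differentiableAt (by norm_num)).hasFDerivAt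
    have h4 := (hV.differentiableAt (by norm_num)).hasFDerivAt
    have h7 := HasFDerivAt.clm_apply (G := F) (H := F →L[ℝ] F) h3
      (h1.hasFDerivAt.clm_apply (hasFDerivAt_const v z))
    have h5 := ((h2.hasFDerivAt.clm_apply (hasFDerivAt_const v z)).add (h7.clm_apply h4)).fderiv
    have h6 := congrArg (fun L ↦ L u) h5
    have e : (fun z ↦ covDeriv Γ j V z v) = (fun z ↦ fderiv ℝ V z v)
      + (fun z ↦ Γ (j z) (fderiv ℝ j z v) (V z)) := rfl
    simp only [Function.comp_apply] at h6
    rw [e, h6]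
    simp
    abel
  unfold covDeriv at key ⊢
  rw [key, key, fderiv_fderiv_symm hj u v, fderiv_fderiv_symm hV u v, curvatureOf]
  simp only [map_add]
  abel

/-- The covariant derivative along `j`, in the direction `u`, of the image under `dj` of the
constant field `v`. -/
def secondDeriv (Γ : F → F →L[ℝ] F →L[ℝ] F) (j : E → F) (z u v : E) : F :=
  fderiv ℝ (fderiv ℝ j) z u v + Γ (j z) (fderiv ℝ j z u) (fderiv ℝ j z v)

theorem covDeriv_fderiv (hj : ContDiffAt ℝ 2 j z) (u v : E) :
    covDeriv Γ j (fun z ↦ fderiv ℝ j z v) z u = secondDeriv Γ j z u v := by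
  rw [covDeriv, fderiv_fderiv_apply hj, secondDeriv]

theorem secondDeriv_symm (hj : ContDiffAt ℝ 2 j z) (hΓ : ∀ u v, Γ (j z) u v = Γ (j z) v u)
    (u v : E) : secondDeriv Γ j z u v = secondDeriv Γ j z v u := by
  rw [secondDeriv, secondDeriv, fderiv_fderiv_symm hj, hΓ]

theorem covDeriv_fderiv_field (hj : ContDiffAt ℝ 2 j z) {X : E → E}
    (hX : DifferentiableAt ℝ X z) (u : E) :
    covDeriv Γ j (fun z ↦ fderiv ℝ j z (X z)) z u
      = secondDeriv Γ j z u (X z) + fderiv ℝ j z (fderiv ℝ X z u) := by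
  have h : DifferentiableAt ℝ (fderiv ℝ j) z :=
    (hj.fderiv_right (m := 1) (by norm_num)).differentiableAt (by norm_num)
  rw [covDeriv, fderiv_clm_apply h hX, secondDeriv]
  simp
  abel

theorem covDeriv_congr {V' : E → F} (h : V =ᶠ[nhds z] V') (u : E) :
    covDeriv Γ j V z u = covDeriv Γ j V' z u := by
  rw [covDeriv, covDeriv, h.fderiv_eq, h.self_of_nhds]

end CovariantDerivative

/-! ### Levi-Civita connections and the symmetries of the curvature -/

section LeviCivita

variable {E : Type*} [NormedAddCommGroup E] [NormedSpace ℝ E]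
  {F : Type*} [NormedAddCommGroup F] [NormedSpace ℝ F]

theorem fderiv_clm_apply₂_const {G H : Type*} [NormedAddCommGroup G] [NormedSpace ℝ G]
    [NormedAddCommGroup H] [NormedSpace ℝ H] {A : E → F →L[ℝ] G →L[ℝ] H} {y : E}
    (hA : DifferentiableAt ℝ A y) (c : E) (a : F) (b : G) :
    fderiv ℝ (fun y ↦ A y a b) y c = fderiv ℝ A y c a b := by
  have k := HasFDerivAt.clm_apply (G := F) (H := G →L[ℝ] H) hA.hasFDerivAt (hasFDerivAt_const a y)
  have k' := congrArg (fun L ↦ L c) (k.clm_apply (hasFDerivAt_const b y)).fderiv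
  simpa only [ContinuousLinearMap.comp_zero, zero_add, ContinuousLinearMap.flip_apply] using k'

/-- On the open set `U`, the functions `Γ` are the Christoffel symbols of the Levi-Civita connection
of the smooth Riemannian metric `g`. -/
structure IsLeviCivitaOn (g : F → F →L[ℝ] F →L[ℝ] ℝ) (Γ : F → F →L[ℝ] F →L[ℝ] F) (U : Set F) :
    Prop where
  isOpen : IsOpen U
  smooth_metric : ∀ y ∈ U, ContDiffAt ℝ ∞ g y
  smooth_christoffel : ∀ y ∈ U, ContDiffAt ℝ ∞ Γ y
  metric_symm : ∀ y ∈ U, ∀ u v, g y u v = g y v u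
  metric_pos : ∀ y ∈ U, ∀ u, u ≠ 0 → 0 < g y u u
  christoffel_symm : ∀ y ∈ U, ∀ u v, Γ y u v = Γ y v u
  compat : ∀ y ∈ U, ∀ u v w, fderiv ℝ g y u v w = g y (Γ y u v) w + g y v (Γ y u w)

theorem curvatureOf_skew (Γ : F → F →L[ℝ] F →L[ℝ] F) (y u v w : F) :
    curvatureOf Γ y u v w = -curvatureOf Γ y v u w := by
  simp only [curvatureOf]; abel

namespace IsLeviCivitaOn

variable {g : F → F →L[ℝ] F →L[ℝ] ℝ} {Γ : F → F →L[ℝ] F →L[ℝ] F} {U : Set F} {y : F}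

theorem differentiableAt_metric (h : IsLeviCivitaOn g Γ U) (hy : y ∈ U) : DifferentiableAt ℝ g y :=
  (h.smooth_metric y hy).differentiableAt (by simp)

theorem differentiableAt_christoffel (h : IsLeviCivitaOn g Γ U) (hy : y ∈ U) :
    DifferentiableAt ℝ Γ y :=
  (h.smooth_christoffel y hy).differentiableAt (by simp)

theorem eventually_mem (h : IsLeviCivitaOn g Γ U) (hy : y ∈ U) : ∀ᶠ y in nhds y, y ∈ U :=
  h.isOpen.mem_nhds hy

/-- Nondegeneracy of the metric. It reduces vector identities to scalar ones, which can be combined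
linearly. -/
theorem eq_of_metric_eq (h : IsLeviCivitaOn g Γ U) (hy : y ∈ U) {a b : F}
    (hab : ∀ w, g y a w = g y b w) : a = b := by
  by_contra hne
  have h1 := h.metric_pos y hy (a - b) (sub_ne_zero.2 hne)
  have h2 := hab (a - b)
  have h3 : g y (a - b) = g y a - g y b := map_sub _ _ _
  rw [h3, sub_apply] at h1
  linarith

/-- Torsion-freeness holds on a neighbourhood, so the derivative of `Γ` is symmetric in its last two
slots too; the cyclic sum then cancels in pairs. -/
theorem curvature_bianchi (h : IsLeviCivitaOn g Γ U) (hy : y ∈ U) (u v w : F) :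
    curvatureOf Γ y u v w + curvatureOf Γ y v w u + curvatureOf Γ y w u v = 0 := by
  have hd := h.differentiableAt_christoffel hy
  have e1 : ∀ a b, fderiv ℝ (fun y ↦ Γ y a b) y = fderiv ℝ (fun y ↦ Γ y b a) y := by
    intro a b
    apply Filter.EventuallyEq.fderiv_eq
    filter_upwards [h.eventually_mem hy] with z hz using h.christoffel_symm z hz a b
  have e2 : ∀ a b c, fderiv ℝ (fun y ↦ Γ y a b) y c = fderiv ℝ Γ y c a b := by
    intro a b c
    exact fderiv_clm_apply₂_const hd c a b
  have sym : ∀ c a b, fderiv ℝ Γ y c a b = fderiv ℝ Γ y c b a := by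
    intro c a b
    rw [← e2, e1, e2]
  simp only [curvatureOf]
  rw [sym u v w, sym v w u, sym w u v, h.christoffel_symm y hy v w, h.christoffel_symm y hy w u,
    h.christoffel_symm y hy u v]
  abel

/-- Metric compatibility used twice, for constant fields `w` and `x`. The two middle terms are
exchanged by swapping `u` and `v`, so only the outer ones matter for the commutator. -/
theorem fderiv_fderiv_metric (h : IsLeviCivitaOn g Γ U) (hy : y ∈ U) (u v w x : F) :
    fderiv ℝ (fun y ↦ fderiv ℝ (fun y ↦ g y w x) y v) y u
      = g y (covDeriv Γ id (fun y ↦ covDeriv Γ id (fun _ ↦ w) y v) y u) x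
        + g y (covDeriv Γ id (fun _ ↦ w) y v) (covDeriv Γ id (fun _ ↦ x) y u)
        + g y (covDeriv Γ id (fun _ ↦ w) y u) (covDeriv Γ id (fun _ ↦ x) y v)
        + g y w (covDeriv Γ id (fun y ↦ covDeriv Γ id (fun _ ↦ x) y v) y u) := by
  have e : (fun y ↦ fderiv ℝ (fun y ↦ g y w x) y v) =ᶠ[nhds y]
      fun y ↦ g (id y) (covDeriv Γ id (fun _ ↦ w) y v) ((fun _ ↦ x) y)
        + g (id y) ((fun _ ↦ w) y) (covDeriv Γ id (fun _ ↦ x) y v) := by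
    filter_upwards [h.eventually_mem hy] with z hz
    exact fderiv_metric_along (j := id) (h.differentiableAt_metric hz) differentiableAt_id
      (differentiableAt_const w) (differentiableAt_const x) (h.compat z hz) v
  have d1 : ∀ w, DifferentiableAt ℝ (fun y ↦ covDeriv Γ id (fun _ ↦ w) y v) y := fun w ↦
    differentiableAt_covDeriv (h.differentiableAt_christoffel hy) contDiffAt_id contDiffAt_const v
  have d2 : DifferentiableAt ℝ g (id y) := h.differentiableAt_metric hy
  have d3 : ∀ V W : F → F, DifferentiableAt ℝ V y → DifferentiableAt ℝ W y →
      DifferentiableAt ℝ (fun y ↦ g (id y) (V y) (W y)) y := by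
    intro V W hV hW
    exact (DifferentiableAt.clm_apply (G := F) (H := F →L[ℝ] ℝ) d2 hV).clm_apply hW
  rw [e.fderiv_eq, fderiv_fun_add (d3 _ _ (d1 w) (differentiableAt_const x))
    (d3 _ _ (differentiableAt_const w) (d1 x)), add_apply,
    fderiv_metric_along d2 differentiableAt_id (d1 w) (differentiableAt_const x) (h.compat y hy),
    fderiv_metric_along d2 differentiableAt_id (differentiableAt_const w) (d1 x) (h.compat y hy)]
  simp only [id]
  ring

/-- The second derivative of the function `g(w, x)` is symmetric, so its commutator `g(R(u,v)w, x) +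
g(w, R(u,v)x)` vanishes. -/
theorem curvature_metric_skew (h : IsLeviCivitaOn g Γ U) (hy : y ∈ U) (u v w x : F) :
    g y (curvatureOf Γ y u v w) x = -g y w (curvatureOf Γ y u v x) := by
  have hc : ∀ w, covDeriv Γ id (fun y ↦ covDeriv Γ id (fun _ ↦ w) y v) y u
      - covDeriv Γ id (fun y ↦ covDeriv Γ id (fun _ ↦ w) y u) y v = curvatureOf Γ y u v w := by
    intro w
    have := covDeriv_commutator (j := id) (V := fun _ ↦ w) (h.differentiableAt_christoffel hy)
      contDiffAt_id contDiffAt_const u v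
    simpa using this
  have hg : ContDiffAt ℝ 2 (fun y ↦ g y w x) y := by
    have := (h.smooth_metric y hy).of_le (m := 2) ENat.LEInfty.out
    exact (ContDiffAt.clm_apply (F := F) (G := F →L[ℝ] ℝ) this contDiffAt_const).clm_apply
      contDiffAt_const
  have s1 := h.fderiv_fderiv_metric hy u v w x
  have s2 := h.fderiv_fderiv_metric hy v u w x
  rw [fderiv_fderiv_apply hg] at s1 s2
  have s3 := fderiv_fderiv_symm hg u v
  rw [← hc w, ← hc x, map_sub, map_sub, sub_apply]
  linarith

/-- The classical octahedron argument: the four cyclic identities, one for each choice of last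
argument, are combined using skewness in the first and in the last pair. -/
theorem curvature_pair_symm (h : IsLeviCivitaOn g Γ U) (hy : y ∈ U) (u v w x : F) :
    g y (curvatureOf Γ y u v w) x = g y (curvatureOf Γ y w x u) v := by
  have B : ∀ a b c d, g y (curvatureOf Γ y a b c) d + g y (curvatureOf Γ y b c a) d
      + g y (curvatureOf Γ y c a b) d = 0 := by
    intro a b c d
    have := congrArg (fun t ↦ g y t d) (h.curvature_bianchi hy a b c)
    simpa using this
  have S : ∀ a b c d, g y (curvatureOf Γ y a b c) d = -g y (curvatureOf Γ y b a c) d := by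
    intro a b c d
    rw [curvatureOf_skew]; simp
  have T : ∀ a b c d, g y (curvatureOf Γ y a b c) d = -g y (curvatureOf Γ y a b d) c := by
    intro a b c d
    rw [h.curvature_metric_skew hy, h.metric_symm y hy]
  have b1 := B u v w x
  have b2 := B v w x u
  have b3 := B w x u v
  have b4 := B x u v w
  have t1 := T v w x u
  have t2 := T w u v x
  have t3 := T u v x w
  have t4 := T w x v u
  have t5 := T x v w u
  have t6 := T x u w v
  have t7 := T u w x v
  have s2 := S u w v x
  have s3 := S x v w u
  have s4 := S x u w v
  have s5 := S v x u w
  have t8 := T v x w u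
  have t9 := T x u v w
  linarith

end IsLeviCivitaOn

end LeviCivita

/-! ### Second derivatives of an immersion and the Gauss equation -/

section Immersion

variable {E : Type*} [NormedAddCommGroup E] [NormedSpace ℝ E]
  {F : Type*} [NormedAddCommGroup F] [NormedSpace ℝ F]
  {g : F → F →L[ℝ] F →L[ℝ] ℝ} {Γ : F → F →L[ℝ] F →L[ℝ] F} {U : Set F} {j : E → F} {z : E}

namespace IsLeviCivitaOn

theorem fderiv_inducedMetric (h : IsLeviCivitaOn g Γ U) (hj : ContDiffAt ℝ ∞ j z)
    (hz : j z ∈ U) (u v w : E) :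
    fderiv ℝ (fun z ↦ g (j z) (fderiv ℝ j z v) (fderiv ℝ j z w)) z u
      = g (j z) (secondDeriv Γ j z u v) (fderiv ℝ j z w)
        + g (j z) (fderiv ℝ j z v) (secondDeriv Γ j z u w) := by
  have hj2 : ContDiffAt ℝ 2 j z := hj.of_le ENat.LEInfty.out
  have d : DifferentiableAt ℝ (fderiv ℝ j) z :=
    (hj2.fderiv_right (m := 1) (by norm_num)).differentiableAt (by norm_num)
  rw [fderiv_metric_along (h.differentiableAt_metric hz) (hj2.differentiableAt (by norm_num))
    (d.clm_apply (differentiableAt_const v)) (d.clm_apply (differentiableAt_const w))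
    (h.compat _ hz), covDeriv_fderiv hj2, covDeriv_fderiv hj2]

/-- The tangential part of the second derivative is given by the Christoffel symbols of the first
kind of the induced metric. -/
theorem two_mul_metric_secondDeriv (h : IsLeviCivitaOn g Γ U) (hj : ContDiffAt ℝ ∞ j z)
    (hz : j z ∈ U) (u v w : E) :
    2 * g (j z) (secondDeriv Γ j z u v) (fderiv ℝ j z w)
      = fderiv ℝ (fun z ↦ g (j z) (fderiv ℝ j z v) (fderiv ℝ j z w)) z u
        + fderiv ℝ (fun z ↦ g (j z) (fderiv ℝ j z u) (fderiv ℝ j z w)) z v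
        - fderiv ℝ (fun z ↦ g (j z) (fderiv ℝ j z u) (fderiv ℝ j z v)) z w := by
  have hj2 : ContDiffAt ℝ 2 j z := hj.of_le ENat.LEInfty.out
  have sym := secondDeriv_symm hj2 (h.christoffel_symm _ hz)
  rw [h.fderiv_inducedMetric hj hz, h.fderiv_inducedMetric hj hz, h.fderiv_inducedMetric hj hz,
    sym v u, sym w u, sym w v, h.metric_symm _ hz (secondDeriv Γ j z u w) (fderiv ℝ j z v)]
  ring

/-- The Gauss equation, in terms of the full second derivative. -/
theorem gauss_secondDeriv (h : IsLeviCivitaOn g Γ U) (hj : ContDiffAt ℝ ∞ j z)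
    (hz : j z ∈ U) (u v : E) :
    g (j z) (curvatureOf Γ (j z) (fderiv ℝ j z u) (fderiv ℝ j z v) (fderiv ℝ j z v))
        (fderiv ℝ j z u)
      = fderiv ℝ (fun z ↦ g (j z) (secondDeriv Γ j z v v) (fderiv ℝ j z u)) z u
        - fderiv ℝ (fun z ↦ g (j z) (secondDeriv Γ j z u v) (fderiv ℝ j z u)) z v
        - g (j z) (secondDeriv Γ j z v v) (secondDeriv Γ j z u u)
        + g (j z) (secondDeriv Γ j z u v) (secondDeriv Γ j z u v) := by
  have hj2 : ContDiffAt ℝ 2 j z := hj.of_le ENat.LEInfty.out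
  have hd : ∀ v, ContDiffAt ℝ 2 (fun z ↦ fderiv ℝ j z v) z := fun v ↦
    ((hj.of_le (m := 3) ENat.LEInfty.out).fderiv_right (m := 2) (by norm_num)).clm_apply
      contDiffAt_const
  have hev : ∀ᶠ z in nhds z, ContDiffAt ℝ 2 j z :=
    hj2.eventually (by simp)
  have e : ∀ u v, (fun z ↦ secondDeriv Γ j z u v)
      =ᶠ[nhds z] fun z ↦ covDeriv Γ j (fun z ↦ fderiv ℝ j z v) z u := by
    intro u v
    filter_upwards [hev] with x hx
    rw [covDeriv_fderiv hx]
  have hW : ∀ u v, DifferentiableAt ℝ (fun z ↦ secondDeriv Γ j z u v) z := fun u v ↦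
    (differentiableAt_covDeriv (h.differentiableAt_christoffel hz) hj2 (hd v)
      u).congr_of_eventuallyEq
      (e u v)
  have comm := covDeriv_commutator (h.differentiableAt_christoffel hz) hj2 (hd v) u v
  rw [← covDeriv_congr (e v v), ← covDeriv_congr (e u v)] at comm
  -- Differentiating the tangential product keeps the whole second derivative of `j`. Those products
  -- depend only on the induced metric, so their derivatives are computable later without
  -- differentiating the normal part.
  have f1 : ∀ a b c d, fderiv ℝ (fun z ↦ g (j z) (secondDeriv Γ j z a b) (fderiv ℝ j z c)) z d
      = g (j z) (covDeriv Γ j (fun z ↦ secondDeriv Γ j z a b) z d) (fderiv ℝ j z c)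
        + g (j z) (secondDeriv Γ j z a b) (secondDeriv Γ j z d c) := by
    intro a b c d
    rw [fderiv_metric_along (h.differentiableAt_metric hz) (hj2.differentiableAt (by norm_num))
      (hW a b) ((hd c).differentiableAt (by norm_num)) (h.compat _ hz), covDeriv_fderiv hj2]
  rw [← comm, f1, f1, map_sub, sub_apply,
    secondDeriv_symm hj2 (h.christoffel_symm _ hz) v u]
  ring

end IsLeviCivitaOn

end Immersion

/-! ### Cosymplectic structures are parallel -/

section Cosymplectic

variable {F : Type*} [NormedAddCommGroup F] [NormedSpace ℝ F]

/-- On the open set `U`, the functions `(φ, ξ, η)` are the components of a cosymplectic structure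
for the metric `g` with Christoffel symbols `Γ`. -/
structure IsCosymplecticOn (g : F → F →L[ℝ] F →L[ℝ] ℝ) (Γ : F → F →L[ℝ] F →L[ℝ] F)
    (φ : F → F →L[ℝ] F) (ξ : F → F) (η : F → F →L[ℝ] ℝ) (U : Set F) : Prop
    extends IsLeviCivitaOn g Γ U where
  smooth_φ : ∀ y ∈ U, ContDiffAt ℝ ∞ φ y
  smooth_ξ : ∀ y ∈ U, ContDiffAt ℝ ∞ ξ y
  smooth_η : ∀ y ∈ U, ContDiffAt ℝ ∞ η y
  φ_φ : ∀ y ∈ U, ∀ u, φ y (φ y u) = -u + η y u • ξ y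
  η_ξ : ∀ y ∈ U, η y (ξ y) = 1
  metric_φ_φ : ∀ y ∈ U, ∀ u v, g y (φ y u) (φ y v) = g y u v - η y u * η y v
  closed_η : ∀ y ∈ U, ∀ u v, fderiv ℝ η y u v = fderiv ℝ η y v u
  closed_form : ∀ y ∈ U, ∀ u v w, fderiv ℝ (fun y ↦ g y v (φ y w)) y u
    + fderiv ℝ (fun y ↦ g y w (φ y u)) y v + fderiv ℝ (fun y ↦ g y u (φ y v)) y w = 0
  normal : ∀ y ∈ U, ∀ u v, fderiv ℝ φ y (φ y u) v - fderiv ℝ φ y (φ y v) u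
    + φ y (fderiv ℝ φ y v u) - φ y (fderiv ℝ φ y u v) = 0

namespace IsCosymplecticOn

variable {g : F → F →L[ℝ] F →L[ℝ] ℝ} {Γ : F → F →L[ℝ] F →L[ℝ] F} {φ : F → F →L[ℝ] F}
  {ξ : F → F} {η : F → F →L[ℝ] ℝ} {U : Set F} {y : F}

/-- The formula for `φ²` gives `φ²ξ = 0`. Applied to `φξ`, it then makes `φξ` a multiple of `ξ`, and
one more application of `φ` makes the factor square to zero. -/
theorem φ_ξ (h : IsCosymplecticOn g Γ φ ξ η U) (hy : y ∈ U) : φ y (ξ y) = 0 := by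
  have h1 : φ y (φ y (ξ y)) = 0 := by rw [h.φ_φ y hy, h.η_ξ y hy]; simp
  have h2 := h.φ_φ y hy (φ y (ξ y))
  rw [h1, map_zero] at h2
  have h3 : φ y (ξ y) = η y (φ y (ξ y)) • ξ y := by
    rw [eq_comm, neg_add_eq_zero] at h2; exact h2
  have h4 : η y (φ y (ξ y)) = 0 := by
    have h5 := h1
    rw [h3, map_smul, h3, smul_smul] at h5
    have h6 := congrArg (η y) h5
    simpa [h.η_ξ y hy] using h6
  rw [h3, h4, zero_smul]

theorem η_φ (h : IsCosymplecticOn g Γ φ ξ η U) (hy : y ∈ U) (u : F) : η y (φ y u) = 0 := by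
  have h2 := h.φ_φ y hy (φ y u)
  rw [h.φ_φ y hy u, map_add, map_smul, h.φ_ξ hy, smul_zero, add_zero, map_neg] at h2
  have h3 : η y (φ y u) • ξ y = 0 := by simpa using h2
  simpa [h.η_ξ y hy] using congrArg (η y) h3

theorem metric_ξ (h : IsCosymplecticOn g Γ φ ξ η U) (hy : y ∈ U) (u : F) :
    g y (ξ y) u = η y u := by
  have h1 := h.metric_φ_φ y hy (ξ y) u
  rw [h.φ_ξ hy, h.η_ξ y hy, map_zero, zero_apply] at h1
  linarith

/-- Compatibility applied to `φu` and `v`, with `φ²u = -u + η(u)ξ`; the `ξ` terms drop because `η ∘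
φ = 0`. -/
theorem metric_φ (h : IsCosymplecticOn g Γ φ ξ η U) (hy : y ∈ U) (u v : F) :
    g y (φ y u) v = -g y u (φ y v) := by
  have h1 := h.metric_φ_φ y hy (φ y u) v
  rw [h.φ_φ y hy u, h.η_φ hy, map_add, map_neg, map_smul, add_apply, neg_apply, smul_apply,
    h.metric_ξ hy, h.η_φ hy] at h1
  simp only [smul_eq_mul, mul_zero, add_zero, zero_mul, sub_zero] at h1
  exact h1.symm

theorem differentiableAt_φ (h : IsCosymplecticOn g Γ φ ξ η U) (hy : y ∈ U) :
    DifferentiableAt ℝ φ y := (h.smooth_φ y hy).differentiableAt (by simp)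

theorem differentiableAt_ξ (h : IsCosymplecticOn g Γ φ ξ η U) (hy : y ∈ U) :
    DifferentiableAt ℝ ξ y := (h.smooth_ξ y hy).differentiableAt (by simp)

theorem differentiableAt_η (h : IsCosymplecticOn g Γ φ ξ η U) (hy : y ∈ U) :
    DifferentiableAt ℝ η y := (h.smooth_η y hy).differentiableAt (by simp)

theorem fderiv_metric_φ (h : IsCosymplecticOn g Γ φ ξ η U) (hy : y ∈ U) (u v w : F) :
    fderiv ℝ (fun y ↦ g y v (φ y w)) y u
      = g y (Γ y u v) (φ y w) + g y v (fderiv ℝ φ y u w + Γ y u (φ y w)) := by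
  have d := (h.differentiableAt_φ hy).clm_apply (differentiableAt_const w)
  have e := fderiv_metric_along (j := id) (V := fun _ ↦ v) (W := fun y ↦ φ y w)
    (h.differentiableAt_metric hy) differentiableAt_id (differentiableAt_const v) d
    (h.compat y hy) u
  simp only [id, covDeriv, fderiv_fun_const, fderiv_id, zero_apply, Pi.zero_apply, zero_add,
    ContinuousLinearMap.id_apply] at e
  rw [e, fderiv_clm_apply (h.differentiableAt_φ hy) (differentiableAt_const w)]
  simp

/-- The covariant derivative of a skew endomorphism is skew, the metric being parallel. -/
theorem fderiv_φ_skew (h : IsCosymplecticOn g Γ φ ξ η U) (hy : y ∈ U) (u v w : F) :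
    g y (fderiv ℝ φ y u v + Γ y u (φ y v) - φ y (Γ y u v)) w
      = -g y (fderiv ℝ φ y u w + Γ y u (φ y w) - φ y (Γ y u w)) v := by
  have e : (fun y ↦ g y v (φ y w)) =ᶠ[nhds y] fun y ↦ -g y w (φ y v) := by
    filter_upwards [h.eventually_mem hy] with z hz
    rw [h.metric_symm z hz w, h.metric_φ hz, neg_neg]
  have e1 := congrArg (fun L ↦ L u) (e.fderiv_eq (𝕜 := ℝ))
  beta_reduce at e1
  rw [fderiv_fun_neg, neg_apply, h.fderiv_metric_φ hy, h.fderiv_metric_φ hy] at e1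
  have s1 := h.metric_φ hy (Γ y u v) w
  have s2 := h.metric_φ hy (Γ y u w) v
  have s3 := h.metric_symm y hy v (fderiv ℝ φ y u w + Γ y u (φ y w))
  have s4 := h.metric_symm y hy w (fderiv ℝ φ y u v + Γ y u (φ y v))
  simp only [map_sub, sub_apply]
  linarith

/-- Put `P u v = (∇_u φ)v` and `X u = ∇_u ξ`. Each structure equation becomes linear in `P` and `X`:
closedness of `η` makes `g(X u, v)` symmetric, closedness of `Φ` gives a cyclic identity for `P`,
normality another, and differentiating `φ² = -1 + η ⊗ ξ` a third. Together they give `g(P w v, φu) =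
-g(X v, w) η(u)`. At `u = ξ` the left side vanishes, so `X = 0`; then `P` has no component in the
image of `φ`, and none along `ξ` since `(∇φ)ξ = 0`. -/
theorem parallel_aux (h : IsCosymplecticOn g Γ φ ξ η U) (hy : y ∈ U) :
    (∀ u, fderiv ℝ ξ y u + Γ y u (ξ y) = 0) ∧
    (∀ u v, fderiv ℝ φ y u v + Γ y u (φ y v) = φ y (Γ y u v)) := by
  set P : F → F → F := fun u v ↦ fderiv ℝ φ y u v + Γ y u (φ y v) - φ y (Γ y u v) with hP
  set X : F → F := fun u ↦ fderiv ℝ ξ y u + Γ y u (ξ y) with hX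
  have skew : ∀ u v w, g y (P u v) w = -g y (P u w) v := h.fderiv_φ_skew hy
  have dη : ∀ u v, fderiv ℝ η y u v = g y (X u) v + η y (Γ y u v) := by
    intro u v
    have e : (fun y ↦ η y v) =ᶠ[nhds y] fun y ↦ g y (ξ y) v := by
      filter_upwards [h.eventually_mem hy] with z hz using (h.metric_ξ hz v).symm
    have e1 := congrArg (fun L ↦ L u) (e.fderiv_eq (𝕜 := ℝ))
    beta_reduce at e1
    rw [fderiv_clm_apply (h.differentiableAt_η hy) (differentiableAt_const v)] at e1
    have e2 := fderiv_metric_along (j := id) (V := ξ) (W := fun _ ↦ v)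
      (h.differentiableAt_metric hy) differentiableAt_id (h.differentiableAt_ξ hy)
      (differentiableAt_const v) (h.compat y hy) u
    simp only [id, covDeriv, fderiv_fun_const, fderiv_id, zero_apply, Pi.zero_apply, zero_add,
      ContinuousLinearMap.id_apply] at e2
    rw [e2, h.metric_ξ hy] at e1
    simpa [hX] using e1
  have bsymm : ∀ u v, g y (X u) v = g y (X v) u := by
    intro u v
    have := h.closed_η y hy u v
    rw [dη, dη, h.christoffel_symm y hy v u] at this
    linarith
  -- The covariant derivative of `φ² = -1 + η ⊗ ξ`.
  have sq : ∀ u v, P u (φ y v) + φ y (P u v) = g y (X u) v • ξ y + η y v • X u := by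
    intro u v
    have e : (fun y ↦ φ y (φ y v)) =ᶠ[nhds y] fun y ↦ -v + η y v • ξ y := by
      filter_upwards [h.eventually_mem hy] with z hz using h.φ_φ z hz v
    have d1 := h.differentiableAt_φ hy
    have d2 := h.differentiableAt_η hy
    have d3 := h.differentiableAt_ξ hy
    have e1 := congrArg (fun L ↦ L u) (e.fderiv_eq (𝕜 := ℝ))
    beta_reduce at e1
    rw [fderiv_clm_apply d1 (d1.clm_apply (differentiableAt_const v)), fderiv_const_add,
      fderiv_fun_smul (d2.clm_apply (differentiableAt_const v)) d3,
      fderiv_clm_apply d1 (differentiableAt_const v),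
      fderiv_clm_apply d2 (differentiableAt_const v)] at e1
    simp at e1
    rw [dη] at e1
    simp only [hP, hX, map_add, map_sub, h.φ_φ y hy, add_apply]
    have e2 : fderiv ℝ φ y u (φ y v) = η y v • fderiv ℝ ξ y u
        + (g y (X u) v + η y (Γ y u v)) • ξ y - φ y (fderiv ℝ φ y u v) := by
      rw [← e1]; abel
    rw [e2]
    simp only [hX, map_neg, map_smul, add_apply, map_add, smul_add, add_smul]
    abel
  have star : ∀ u v w, g y (P u (φ y v)) w - g y (P u v) (φ y w)
      = g y (X u) v * η y w + η y v * g y (X u) w := by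
    intro u v w
    have := congrArg (fun t ↦ g y t w) (sq u v)
    simp only [map_add, map_smul, add_apply, smul_apply, smul_eq_mul, h.metric_ξ hy,
      h.metric_φ hy] at this
    linarith
  have cyc : ∀ u v w, g y (P u v) w + g y (P v w) u + g y (P w u) v = 0 := by
    intro u v w
    have e := h.closed_form y hy u w v
    rw [h.fderiv_metric_φ hy, h.fderiv_metric_φ hy, h.fderiv_metric_φ hy] at e
    have a1 := h.metric_symm y hy w (fderiv ℝ φ y u v + Γ y u (φ y v))
    have a2 := h.metric_symm y hy v (fderiv ℝ φ y w u + Γ y w (φ y u))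
    have a3 := h.metric_symm y hy u (fderiv ℝ φ y v w + Γ y v (φ y w))
    have b1 := h.metric_φ hy (Γ y u v) w
    have b2 := h.metric_φ hy (Γ y w u) v
    have b3 := h.metric_φ hy (Γ y v w) u
    have c1 := h.metric_symm y hy (Γ y u v) (φ y w)
    rw [h.christoffel_symm y hy u w, h.christoffel_symm y hy w v,
      h.christoffel_symm y hy v u] at e
    simp only [hP, map_sub, sub_apply]
    linarith
  -- The normality condition involves ordinary derivatives; symmetry of `Γ` lets them be replaced by
  -- covariant ones.
  have nij : ∀ u v w, g y (P (φ y u) v) w - g y (P (φ y v) u) w - g y (P v u) (φ y w)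
      + g y (P u v) (φ y w) = 0 := by
    intro u v w
    have e : P (φ y u) v - P (φ y v) u + φ y (P v u) - φ y (P u v) = 0 := by
      rw [← h.normal y hy u v]
      simp only [hP, map_sub, map_add]
      rw [h.christoffel_symm y hy (φ y u) (φ y v), h.christoffel_symm y hy (φ y u) v,
        h.christoffel_symm y hy (φ y v) u, h.christoffel_symm y hy v u]
      abel
    have := congrArg (fun t ↦ g y t w) e
    simp only [map_add, map_sub, map_zero, add_apply, sub_apply, zero_apply,
      h.metric_φ hy] at this
    linarith
  have main : ∀ u v w, g y (P w v) (φ y u) = -g y (X v) w * η y u := by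
    intro u v w
    have n := nij u v w
    have c1 := cyc (φ y u) v w
    have c2 := cyc (φ y v) u w
    have s1 := star v w u
    have s2 := skew v (φ y w) u
    have s3 := star u w v
    have s4 := skew u (φ y w) v
    have s5 := star w v u
    have s6 := skew w (φ y u) v
    have b1 := bsymm u v
    have b2 := bsymm u w
    have b3 := bsymm v w
    have x1 : g y (X v) u * η y w = g y (X u) v * η y w := by rw [b1]
    have x2 : g y (X w) u * η y v = g y (X u) w * η y v := by rw [b2]
    have x3 : g y (X w) v * η y u = g y (X v) w * η y u := by rw [b3]
    linarith
  have bzero : ∀ v w, g y (X v) w = 0 := by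
    intro v w
    have := main (ξ y) v w
    rw [h.φ_ξ hy, h.η_ξ y hy, map_zero] at this
    linarith
  have Xzero : ∀ u, X u = 0 := fun u ↦ h.eq_of_metric_eq hy (fun w ↦ by rw [bzero]; simp)
  refine ⟨Xzero, fun u v ↦ sub_eq_zero.1 (h.eq_of_metric_eq hy fun w ↦ ?_)⟩
  change g y (P u v) w = _
  -- Differentiate `φξ = 0`, with `ξ` already known to be parallel.
  have hξ : P u (ξ y) = 0 := by
    have e : (fun y ↦ φ y (ξ y)) =ᶠ[nhds y] fun _ ↦ (0 : F) := by
      filter_upwards [h.eventually_mem hy] with z hz using h.φ_ξ hz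
    have e1 := congrArg (fun L ↦ L u) (e.fderiv_eq (𝕜 := ℝ))
    beta_reduce at e1
    rw [fderiv_clm_apply (h.differentiableAt_φ hy) (h.differentiableAt_ξ hy)] at e1
    simp at e1
    have e2 : fderiv ℝ φ y u (ξ y) = -φ y (fderiv ℝ ξ y u) := by
      rw [eq_neg_iff_add_eq_zero, ← e1]; abel
    have e3 : fderiv ℝ ξ y u = -Γ y u (ξ y) := eq_neg_of_add_eq_zero_left (Xzero u)
    simp only [hP]
    rw [e2, e3, h.φ_ξ hy]
    simp
  -- Splits `w` into a vector in the image of `φ`, handled by `main`, and a multiple of `ξ`, handled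
  -- by skewness and `hξ`.
  have hw : w = -φ y (φ y w) + η y w • ξ y := by rw [h.φ_φ y hy]; abel
  have m := main (φ y w) v u
  rw [bzero] at m
  have k := skew u v (ξ y)
  rw [hξ] at k
  rw [hw, map_add, map_neg, map_smul, m, k]
  simp

theorem parallel_ξ (h : IsCosymplecticOn g Γ φ ξ η U) (hy : y ∈ U) (u : F) :
    fderiv ℝ ξ y u + Γ y u (ξ y) = 0 := (h.parallel_aux hy).1 u

theorem parallel_φ (h : IsCosymplecticOn g Γ φ ξ η U) (hy : y ∈ U) (u v : F) :
    fderiv ℝ φ y u v + Γ y u (φ y v) = φ y (Γ y u v) := (h.parallel_aux hy).2 u v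

end IsCosymplecticOn

end Cosymplectic

/-! ### Curvature of a cosymplectic space form -/

section CosymplecticCurvature

variable {F : Type*} [NormedAddCommGroup F] [NormedSpace ℝ F]
  {g : F → F →L[ℝ] F →L[ℝ] ℝ} {Γ : F → F →L[ℝ] F →L[ℝ] F} {φ : F → F →L[ℝ] F}
  {ξ : F → F} {η : F → F →L[ℝ] ℝ} {U : Set F} {y : F}

theorem curvatureOf_add (Γ : F → F →L[ℝ] F →L[ℝ] F) (y u u' v w : F) :
    curvatureOf Γ y (u + u') v w = curvatureOf Γ y u v w + curvatureOf Γ y u' v w := by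
  simp only [curvatureOf, map_add, add_apply]; abel

theorem curvatureOf_smul (Γ : F → F →L[ℝ] F →L[ℝ] F) (y : F) (t : ℝ) (u v w : F) :
    curvatureOf Γ y (t • u) v w = t • curvatureOf Γ y u v w := by
  simp only [curvatureOf, map_smul, smul_apply, smul_add, smul_sub]

theorem curvatureOf_smul_middle (Γ : F → F →L[ℝ] F →L[ℝ] F) (y : F) (t : ℝ) (u v w : F) :
    curvatureOf Γ y u (t • v) w = t • curvatureOf Γ y u v w := by
  rw [curvatureOf_skew, curvatureOf_smul, curvatureOf_skew Γ y u v, smul_neg]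

theorem curvatureOf_smul_right (Γ : F → F →L[ℝ] F →L[ℝ] F) (y : F) (t : ℝ) (u v w : F) :
    curvatureOf Γ y u v (t • w) = t • curvatureOf Γ y u v w := by
  simp only [curvatureOf, map_smul, smul_add, smul_sub]

namespace IsCosymplecticOn

/-- A parallel `φ` passes through both covariant derivatives in the commutator that defines the
curvature. The inner step is needed on a neighbourhood, since its result is differentiated again. -/
theorem curvature_φ (h : IsCosymplecticOn g Γ φ ξ η U) (hy : y ∈ U) (u v w : F) :
    curvatureOf Γ y u v (φ y w) = φ y (curvatureOf Γ y u v w) := by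
  have hd : ∀ {x}, x ∈ U → ∀ V : F → F, DifferentiableAt ℝ V x → ∀ a,
      covDeriv Γ id (fun z ↦ φ z (V z)) x a = φ x (covDeriv Γ id V x a) := by
    intro x hx V hV a
    exact covDeriv_parallel_endomorphism (j := id) (h.differentiableAt_φ hx) differentiableAt_id
      hV (h.parallel_φ hx) a
  have two : ∀ a b, covDeriv Γ id (fun z ↦ covDeriv Γ id (fun z ↦ φ z w) z b) y a
      = φ y (covDeriv Γ id (fun z ↦ covDeriv Γ id (fun _ ↦ w) z b) y a) := by
    intro a b
    have e : (fun z ↦ covDeriv Γ id (fun z ↦ φ z w) z b)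
        =ᶠ[nhds y] fun z ↦ φ z (covDeriv Γ id (fun _ ↦ w) z b) := by
      filter_upwards [h.eventually_mem hy] with z hz
        using hd hz (fun _ ↦ w) (differentiableAt_const w) b
    rw [covDeriv_congr e]
    exact hd hy _ (differentiableAt_covDeriv (h.differentiableAt_christoffel hy) contDiffAt_id
      contDiffAt_const b) a
  have smooth : ContDiffAt ℝ 2 (fun z ↦ φ z w) y :=
    ((h.smooth_φ y hy).of_le ENat.LEInfty.out).clm_apply contDiffAt_const
  have c1 := covDeriv_commutator (j := id) (V := fun z ↦ φ z w)
    (h.differentiableAt_christoffel hy) contDiffAt_id smooth u v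
  have c2 := covDeriv_commutator (j := id) (V := fun _ ↦ w)
    (h.differentiableAt_christoffel hy) contDiffAt_id contDiffAt_const u v
  simp only [fderiv_id, ContinuousLinearMap.id_apply, id] at c1 c2
  rw [← c1, ← c2, map_sub]
  exact congrArg₂ _ (two u v) (two v u)

/-- Because `φξ = 0` and the curvature commutes with `φ`, the vector `R(u,v)ξ` is a multiple of `ξ`;
skewness of `R(u,v)` makes its `ξ` component zero. -/
theorem curvature_ξ (h : IsCosymplecticOn g Γ φ ξ η U) (hy : y ∈ U) (u v : F) :
    curvatureOf Γ y u v (ξ y) = 0 := by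
  have h1 := h.curvature_φ hy u v (ξ y)
  have h0 : curvatureOf Γ y u v 0 = 0 := by simp [curvatureOf]
  rw [h.φ_ξ hy, h0] at h1
  have h2 := h.φ_φ y hy (curvatureOf Γ y u v (ξ y))
  rw [← h1, map_zero] at h2
  have h3 := h.curvature_metric_skew hy u v (ξ y) (ξ y)
  rw [h.metric_symm y hy, h.metric_ξ hy] at h3
  have h4 : η y (curvatureOf Γ y u v (ξ y)) = 0 := by linarith
  rw [h4, zero_smul, add_zero] at h2
  exact neg_eq_zero.1 h2.symm

theorem curvature_φ_φ (h : IsCosymplecticOn g Γ φ ξ η U) (hy : y ∈ U) (u v w x : F) :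
    g y (curvatureOf Γ y u v (φ y w)) (φ y x) = g y (curvatureOf Γ y u v w) x := by
  rw [h.curvature_φ hy, h.metric_φ_φ y hy, ← h.metric_ξ hy (curvatureOf Γ y u v w),
    h.metric_symm y hy (ξ y), h.curvature_metric_skew hy u v w (ξ y), h.curvature_ξ hy]
  simp

/-- The linear relation between sectional curvatures obtained by polarizing the `φ`-sectional
curvature. -/
theorem sectional_polarization (h : IsCosymplecticOn g Γ φ ξ η U) (hy : y ∈ U) {c : ℝ}
    (hc : ∀ u, η y u = 0 → g y (curvatureOf Γ y u (φ y u) (φ y u)) u = c * g y u u ^ 2)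
    {u v : F} (hu : η y u = 0) (hv : η y v = 0) (huv : g y u v = 0) :
    g y (curvatureOf Γ y u v v) u + 3 * g y (curvatureOf Γ y (φ y u) v v) (φ y u)
      = c * g y u u * g y v v := by
  set R : F → F → F → F → ℝ := fun a b c d ↦ g y (curvatureOf Γ y a b c) d with hR
  have skew : ∀ a b c d, R a b c d = -R b a c d := by
    intro a b c d; simp only [hR]; rw [curvatureOf_skew]; simp
  have skew' : ∀ a b c d, R a b c d = -R a b d c := by
    intro a b c d; simp only [hR]; rw [h.curvature_metric_skew hy, h.metric_symm y hy]
  have pair : ∀ a b c d, R a b c d = R c d a b := h.curvature_pair_symm hy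
  have inv : ∀ a b c d, R a b (φ y c) (φ y d) = R a b c d := h.curvature_φ_φ hy
  have bianchi : ∀ a b c d, R a b c d + R b c a d + R c a b d = 0 := by
    intro a b c d
    have := congrArg (fun t ↦ g y t d) (h.curvature_bianchi hy a b c)
    simpa [hR] using this
  have add1 : ∀ a a' b c d, R (a + a') b c d = R a b c d + R a' b c d := by
    intro a a' b c d; simp only [hR]; rw [curvatureOf_add]; simp
  have add2 : ∀ a b b' c d, R a (b + b') c d = R a b c d + R a b' c d := by
    intro a b b' c d; rw [skew, add1, skew b, skew b']; ring
  have add3 : ∀ a b c c' d, R a b (c + c') d = R a b c d + R a b c' d := by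
    intro a b c c' d; rw [pair, add1, pair c, pair c']
  have add4 : ∀ a b c d d', R a b c (d + d') = R a b c d + R a b c d' := by
    intro a b c d d'; rw [pair, add2, pair c, pair c]
  have neg1 : ∀ a b c d, R (-a) b c d = -R a b c d := by
    intro a b c d
    simp only [hR]
    rw [← neg_one_smul ℝ a, curvatureOf_smul]
    simp
  have neg2 : ∀ a b c d, R a (-b) c d = -R a b c d := by
    intro a b c d; rw [skew, neg1, skew b, neg_neg]
  have neg3 : ∀ a b c d, R a b (-c) d = -R a b c d := by
    intro a b c d; rw [pair, neg1, pair c]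
  have neg4 : ∀ a b c d, R a b c (-d) = -R a b c d := by
    intro a b c d; rw [pair, neg2, pair c]
  have hφu : φ y (φ y u) = -u := by rw [h.φ_φ y hy, hu]; simp
  have hφv : φ y (φ y v) = -v := by rw [h.φ_φ y hy, hv]; simp
  have hvu : g y v u = 0 := by rw [h.metric_symm y hy, huv]
  -- Adding the hypothesis at `u + v` and `u - v` leaves the terms of even degree in `v`. With `S =
  -- R(u,v,v,u)` and `S' = R(φu,v,v,φu)`, the six terms quadratic in both arguments are four copies
  -- of `S'`, by `φ`-invariance, and two of `S + S'`, by the Bianchi identity. Their sum `2S + 6S'`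
  -- equals `2c|u|²|v|²`.
  have q1 : R (u + v) (φ y (u + v)) (φ y (u + v)) (u + v) = c * g y (u + v) (u + v) ^ 2 :=
    hc _ (by rw [map_add, hu, hv, add_zero])
  have q2 : R (u + -v) (φ y (u + -v)) (φ y (u + -v)) (u + -v) = c * g y (u + -v) (u + -v) ^ 2 :=
    hc _ (by rw [map_add, map_neg, hu, hv, neg_zero, add_zero])
  have q3 : R u (φ y u) (φ y u) u = c * g y u u ^ 2 := hc u hu
  have q4 : R v (φ y v) (φ y v) v = c * g y v v ^ 2 := hc v hv
  have n1 : g y (u + v) (u + v) = g y u u + g y v v := by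
    simp only [map_add, add_apply, huv, hvu]; ring
  have n2 : g y (u + -v) (u + -v) = g y u u + g y v v := by
    simp only [map_add, map_neg, add_apply, neg_apply, huv, hvu]; ring
  rw [n1] at q1
  rw [n2] at q2
  rw [map_add] at q1 q2
  rw [map_neg] at q2
  have i1 := inv v (φ y u) (φ y v) u
  have i2 := inv u (φ y v) (φ y v) u
  have i3 := inv v (φ y u) u (φ y v)
  have i4 := inv u (φ y v) (φ y u) v
  have i5 := inv u v u v
  simp only [hφu, hφv, neg3, neg4] at i1 i2 i3 i4
  simp only [add1, add2, add3, add4] at q1 q2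
  simp only [neg1, neg2, neg3, neg4, neg_neg] at q2
  change R u v v u + 3 * R (φ y u) v v (φ y u) = _
  have e1 : R v (φ y u) (φ y u) v = R (φ y u) v v (φ y u) := by rw [skew, skew', neg_neg]
  have s1 := skew' v (φ y u) v (φ y u)
  have p1 := pair u (φ y v) v (φ y u)
  have s2 := skew' u (φ y v) u (φ y v)
  have b1 := bianchi u (φ y u) (φ y v) v
  have p2 := pair (φ y u) (φ y v) u v
  have s3 := skew' u v u v
  have s4 := skew (φ y v) u (φ y u) v
  have p3 := pair v (φ y v) (φ y u) u
  have s5 := skew (φ y u) u v (φ y v)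
  have s6 := skew' u (φ y u) v (φ y v)
  linarith

/-- The sum of the sectional curvatures of the planes `u ∧ v` and `φ u ∧ v` in a cosymplectic space
form, for `v` orthogonal to `ξ`, `u` and `φ u`. -/
theorem sectional_add_sectional_φ (h : IsCosymplecticOn g Γ φ ξ η U) (hy : y ∈ U) {c : ℝ}
    (hc : ∀ u, g y u u = 1 → g y u (ξ y) = 0 →
      g y (curvatureOf Γ y u (φ y u) (φ y u)) u = c)
    {u v : F} (hv : η y v = 0) (huv : g y u v = 0) (hφuv : g y (φ y u) v = 0) :
    g y (curvatureOf Γ y u v v) u + g y (curvatureOf Γ y (φ y u) v v) (φ y u)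
      = c / 2 * (g y u u - η y u ^ 2) * g y v v := by
  -- The hypothesis on unit vectors is made homogeneous of degree four, so that it can be polarized.
  have hc' : ∀ u, η y u = 0 →
      g y (curvatureOf Γ y u (φ y u) (φ y u)) u = c * g y u u ^ 2 := by
    intro u hu
    rcases eq_or_ne u 0 with rfl | h0
    · simp
    have hpos := h.metric_pos y hy u h0
    set r := Real.sqrt (g y u u) with hr
    have hr0 : r ≠ 0 := (Real.sqrt_pos.2 hpos).ne'
    have hrr : r ^ 2 = g y u u := Real.sq_sqrt hpos.le
    have k := hc (r⁻¹ • u) (by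
        simp only [map_smul, smul_apply, smul_eq_mul, ← hrr]; field_simp)
      (by rw [h.metric_symm y hy, h.metric_ξ hy, map_smul, hu, smul_zero])
    have e : curvatureOf Γ y (r⁻¹ • u) (φ y (r⁻¹ • u)) (φ y (r⁻¹ • u))
        = (r⁻¹) ^ 3 • curvatureOf Γ y u (φ y u) (φ y u) := by
      simp only [map_smul, curvatureOf_smul, curvatureOf_smul_middle, curvatureOf_smul_right,
        smul_smul]
      ring_nf
    rw [e] at k
    simp only [map_smul, smul_apply, smul_eq_mul] at k
    rw [← k, ← hrr]
    field_simp
  -- The component of `u` orthogonal to `ξ`: it has the same image under `φ`, and the curvature does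
  -- not see the difference.
  set x := u - η y u • ξ y with hx
  have ηx : η y x = 0 := by simp [hx, h.η_ξ y hy]
  have φx : φ y x = φ y u := by simp [hx, h.φ_ξ hy]
  have ξv : g y (ξ y) v = 0 := by rw [h.metric_ξ hy, hv]
  have gx : g y x x = g y u u - η y u ^ 2 := by
    have s := h.metric_symm y hy u (ξ y)
    rw [h.metric_ξ hy] at s
    simp only [hx, map_sub, map_smul, sub_apply, smul_apply, smul_eq_mul, h.metric_ξ hy,
      h.η_ξ y hy, s]
    ring
  have gxv : g y x v = 0 := by
    simp only [hx, map_sub, map_smul, sub_apply, smul_apply, smul_eq_mul, ξv, huv]; ring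
  have ux : u = x + η y u • ξ y := by rw [hx]; abel
  have Rξ : ∀ a b c, g y (curvatureOf Γ y (ξ y) a b) c = 0 := by
    intro a b c
    rw [h.curvature_pair_symm hy, h.curvature_ξ hy]; simp
  have Rξ' : ∀ a b c, g y (curvatureOf Γ y a b c) (ξ y) = 0 := by
    intro a b c
    rw [h.curvature_metric_skew hy, h.curvature_ξ hy]; simp
  have Rx : g y (curvatureOf Γ y u v v) u = g y (curvatureOf Γ y x v v) x := by
    conv_lhs => rw [ux]
    rw [curvatureOf_add, curvatureOf_smul]
    simp only [map_add, map_smul, add_apply, smul_apply, smul_eq_mul, Rξ, Rξ']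
    ring
  -- The polarized relation for `x` and for `φx` gives `S + 3S'` and `S' + 3S`, both equal to
  -- `c|x|²|v|²`; their sum is four times the required quantity.
  have k1 := h.sectional_polarization hy hc' ηx hv gxv
  have k2 := h.sectional_polarization hy hc' (u := φ y x) (h.η_φ hy x) hv (by rw [φx, hφuv])
  have φφx : φ y (φ y x) = -x := by rw [h.φ_φ y hy, ηx]; simp
  have neg : g y (curvatureOf Γ y (-x) v v) (-x) = g y (curvatureOf Γ y x v v) x := by
    rw [← neg_one_smul ℝ x, curvatureOf_smul]; simp
  rw [φφx, neg, h.metric_φ_φ y hy, ηx] at k2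
  rw [Rx, ← φx, ← gx]
  linarith

end IsCosymplecticOn

end CosymplecticCurvature

/-! ### Inverting a positive definite form -/

section MetricInverse

variable {F : Type*} [NormedAddCommGroup F] [NormedSpace ℝ F] [FiniteDimensional ℝ F]

/-- A positive definite bilinear form, as an isomorphism onto the dual space. -/
theorem exists_equiv_of_pos (B : F →L[ℝ] F →L[ℝ] ℝ) (hB : ∀ u, u ≠ 0 → 0 < B u u) :
    ∃ e : F ≃L[ℝ] (F →L[ℝ] ℝ), (e : F →L[ℝ] F →L[ℝ] ℝ) = B := by
  have inj : Function.Injective B.toLinearMap := by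
    rw [← LinearMap.ker_eq_bot, LinearMap.ker_eq_bot']
    intro u hu
    by_contra h0
    have h1 := hB u h0
    have h2 : B u = 0 := hu
    rw [h2] at h1
    simp at h1
  have dim : Module.finrank ℝ F = Module.finrank ℝ (F →L[ℝ] ℝ) := by
    rw [← (LinearMap.toContinuousLinearMap (𝕜 := ℝ) (E := F) (F' := ℝ)).finrank_eq,
      Module.finrank_linearMap, Module.finrank_self, mul_one]
  exact ⟨(LinearEquiv.ofInjectiveOfFinrankEq B.toLinearMap inj dim).toContinuousLinearEquiv,
    by ext; rfl⟩

theorem apply_inverse_of_pos {B : F →L[ℝ] F →L[ℝ] ℝ} (hB : ∀ u, u ≠ 0 → 0 < B u u)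
    (l : F →L[ℝ] ℝ) : B (B.inverse l) = l := by
  obtain ⟨e, rfl⟩ := exists_equiv_of_pos B hB
  rw [ContinuousLinearMap.inverse_equiv]
  exact e.apply_symm_apply l

theorem contDiffAt_inverse_of_pos {B : F →L[ℝ] F →L[ℝ] ℝ} (hB : ∀ u, u ≠ 0 → 0 < B u u)
    {n : WithTop ℕ∞} :
    ContDiffAt ℝ n (ContinuousLinearMap.inverse : (F →L[ℝ] F →L[ℝ] ℝ) → _) B := by
  obtain ⟨e, rfl⟩ := exists_equiv_of_pos B hB
  have : CompleteSpace F := FiniteDimensional.complete ℝ F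
  exact contDiffAt_map_inverse e

end MetricInverse

/-! ### Isometric immersions of a warped product, in coordinates -/

section WarpedImmersion

variable {E₁ : Type*} [NormedAddCommGroup E₁] [NormedSpace ℝ E₁]
  {E₂ : Type*} [NormedAddCommGroup E₂] [NormedSpace ℝ E₂]
  {F : Type*} [NormedAddCommGroup F] [NormedSpace ℝ F]

/-- On the open set `O`, the map `j` is an isometric immersion of the warped product of the metrics
`g₁` and `g₂`, with warping function `exp ψ`, whose leaves are respectively invariant and
anti-invariant. -/
structure IsWarpedImmersionOn (g : F → F →L[ℝ] F →L[ℝ] ℝ) (φ : F → F →L[ℝ] F) (ξ : F → F)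
    (U : Set F) (g₁ : E₁ → E₁ →L[ℝ] E₁ →L[ℝ] ℝ) (U₁ : Set E₁) (g₂ : E₂ → E₂ →L[ℝ] E₂ →L[ℝ] ℝ)
    (ψ : E₁ → ℝ) (j : E₁ × E₂ → F) (O : Set (E₁ × E₂)) : Prop where
  isOpen : IsOpen O
  smooth : ∀ z ∈ O, ContDiffAt ℝ ∞ j z
  mapsTo : ∀ z ∈ O, j z ∈ U
  fst_mem : ∀ z ∈ O, z.1 ∈ U₁
  smooth_ψ : ∀ z ∈ O, ContDiffAt ℝ ∞ ψ z.1
  smooth_metric₂ : ∀ z ∈ O, ContDiffAt ℝ ∞ g₂ z.2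
  metric₂_pos : ∀ z ∈ O, ∀ v, v ≠ 0 → 0 < g₂ z.2 v v
  isometric : ∀ z ∈ O, ∀ u v : E₁ × E₂, g (j z) (fderiv ℝ j z u) (fderiv ℝ j z v)
    = g₁ z.1 u.1 v.1 + Real.exp (2 * ψ z.1) * g₂ z.2 u.2 v.2
  tangent_ξ : ∀ z ∈ O, ∃ w : E₁, fderiv ℝ j z (w, 0) = ξ (j z)
  invariant : ∀ z ∈ O, ∀ u : E₁, ∃ v : E₁, φ (j z) (fderiv ℝ j z (u, 0)) = fderiv ℝ j z (v, 0)

namespace IsWarpedImmersionOn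

variable {g : F → F →L[ℝ] F →L[ℝ] ℝ} {Γ : F → F →L[ℝ] F →L[ℝ] F} {φ : F → F →L[ℝ] F}
  {ξ : F → F} {η : F → F →L[ℝ] ℝ} {U : Set F} {g₁ : E₁ → E₁ →L[ℝ] E₁ →L[ℝ] ℝ}
  {Γ₁ : E₁ → E₁ →L[ℝ] E₁ →L[ℝ] E₁} {U₁ : Set E₁} {g₂ : E₂ → E₂ →L[ℝ] E₂ →L[ℝ] ℝ}
  {ψ : E₁ → ℝ} {j : E₁ × E₂ → F} {O : Set (E₁ × E₂)} {z : E₁ × E₂}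

theorem eventually_mem (hw : IsWarpedImmersionOn g φ ξ U g₁ U₁ g₂ ψ j O) (hz : z ∈ O) :
    ∀ᶠ z in nhds z, z ∈ O := hw.isOpen.mem_nhds hz

theorem contDiffAt_two (hw : IsWarpedImmersionOn g φ ξ U g₁ U₁ g₂ ψ j O) (hz : z ∈ O) :
    ContDiffAt ℝ 2 j z := (hw.smooth z hz).of_le ENat.LEInfty.out

theorem hasFDerivAt_exp (hw : IsWarpedImmersionOn g φ ξ U g₁ U₁ g₂ ψ j O) (hz : z ∈ O)
    (u : E₁ × E₂) :
    fderiv ℝ (fun z : E₁ × E₂ ↦ Real.exp (2 * ψ z.1)) z u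
      = 2 * fderiv ℝ ψ z.1 u.1 * Real.exp (2 * ψ z.1)
    ∧ DifferentiableAt ℝ (fun z : E₁ × E₂ ↦ Real.exp (2 * ψ z.1)) z := by
  have d : HasFDerivAt ψ (fderiv ℝ ψ z.1) z.1 :=
    ((hw.smooth_ψ z hz).differentiableAt (by simp)).hasFDerivAt
  have d1 := ((d.comp z hasFDerivAt_fst).const_mul 2).exp
  refine ⟨?_, d1.differentiableAt⟩
  have := congrArg (fun L ↦ L u) d1.fderiv
  simp only [Function.comp_apply] at this
  rw [this]
  simp
  ring

theorem fderiv_inducedMetric (hw : IsWarpedImmersionOn g φ ξ U g₁ U₁ g₂ ψ j O)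
    (h₁ : IsLeviCivitaOn g₁ Γ₁ U₁) (hz : z ∈ O) (u v w : E₁ × E₂) :
    fderiv ℝ (fun z ↦ g (j z) (fderiv ℝ j z v) (fderiv ℝ j z w)) z u
      = fderiv ℝ g₁ z.1 u.1 v.1 w.1
        + (2 * fderiv ℝ ψ z.1 u.1 * Real.exp (2 * ψ z.1) * g₂ z.2 v.2 w.2
        + Real.exp (2 * ψ z.1) * fderiv ℝ g₂ z.2 u.2 v.2 w.2) := by
  have e : (fun z ↦ g (j z) (fderiv ℝ j z v) (fderiv ℝ j z w)) =ᶠ[nhds z]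
      fun z ↦ g₁ z.1 v.1 w.1 + Real.exp (2 * ψ z.1) * g₂ z.2 v.2 w.2 := by
    filter_upwards [hw.eventually_mem hz] with x hx using hw.isometric x hx v w
  obtain ⟨e1, d1⟩ := hw.hasFDerivAt_exp hz u
  have d2 := h₁.differentiableAt_metric (hw.fst_mem z hz)
  have d3 : DifferentiableAt ℝ g₂ z.2 := (hw.smooth_metric₂ z hz).differentiableAt (by simp)
  have f2 : DifferentiableAt ℝ (fun y ↦ g₁ y v.1 w.1) z.1 :=
    (DifferentiableAt.clm_apply (G := E₁) (H := E₁ →L[ℝ] ℝ) d2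
      (differentiableAt_const _)).clm_apply (differentiableAt_const _)
  have f3 : DifferentiableAt ℝ (fun y ↦ g₂ y v.2 w.2) z.2 :=
    (DifferentiableAt.clm_apply (G := E₂) (H := E₂ →L[ℝ] ℝ) d3
      (differentiableAt_const _)).clm_apply (differentiableAt_const _)
  have k2 := f2.hasFDerivAt.comp z hasFDerivAt_fst
  have k3 := f3.hasFDerivAt.comp z hasFDerivAt_snd
  have k := congrArg (fun L ↦ L u) (k2.add (d1.hasFDerivAt.mul k3)).fderiv
  have k' : fderiv ℝ (fun z : E₁ × E₂ ↦ g₁ z.1 v.1 w.1 + Real.exp (2 * ψ z.1) * g₂ z.2 v.2 w.2) z u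
    = _ := k
  rw [e.fderiv_eq, k']
  simp only [add_apply, ContinuousLinearMap.comp_apply, ContinuousLinearMap.coe_fst',
    ContinuousLinearMap.coe_snd', smul_apply, smul_eq_mul, e1, Function.comp_apply,
    fderiv_clm_apply₂_const d2, fderiv_clm_apply₂_const d3]
  ring

/-- This and the two lemmas that follow are Koszul's formula for the metric `g₁ + exp(2ψ) g₂`,
tested on constant fields of the factors. Here only derivatives of `g₁` contribute, so the leaves of
the first factor are totally geodesic in the warped product. -/
theorem metric_secondDeriv₁₁ (hw : IsWarpedImmersionOn g φ ξ U g₁ U₁ g₂ ψ j O)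
    (h : IsLeviCivitaOn g Γ U) (h₁ : IsLeviCivitaOn g₁ Γ₁ U₁) (hz : z ∈ O) (u v : E₁)
    (w : E₁ × E₂) :
    g (j z) (secondDeriv Γ j z (u, 0) (v, 0)) (fderiv ℝ j z w) = g₁ z.1 (Γ₁ z.1 u v) w.1 := by
  have k := h.two_mul_metric_secondDeriv (hw.smooth z hz) (hw.mapsTo z hz) (u, 0) (v, 0) w
  have hy := hw.fst_mem z hz
  rw [hw.fderiv_inducedMetric h₁ hz, hw.fderiv_inducedMetric h₁ hz,
    hw.fderiv_inducedMetric h₁ hz] at k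
  simp only [h₁.compat _ hy] at k
  simp only [map_zero, zero_apply, mul_zero, add_zero] at k
  have s1 := h₁.christoffel_symm _ hy u v
  have s2 := h₁.christoffel_symm _ hy w.1 u
  have s3 := h₁.christoffel_symm _ hy w.1 v
  have s4 := h₁.metric_symm _ hy (Γ₁ z.1 w.1 u) v
  rw [s1] at k ⊢
  rw [s4, s2, s3] at k
  linarith

/-- The only nonzero contribution is the derivative of the warping factor: `∇_u v = (uψ) v` in the
warped product. -/
theorem metric_secondDeriv₁₂ (hw : IsWarpedImmersionOn g φ ξ U g₁ U₁ g₂ ψ j O)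
    (h : IsLeviCivitaOn g Γ U) (h₁ : IsLeviCivitaOn g₁ Γ₁ U₁) (hz : z ∈ O) (u : E₁) (v : E₂)
    (w : E₁ × E₂) :
    g (j z) (secondDeriv Γ j z (u, 0) (0, v)) (fderiv ℝ j z w)
      = fderiv ℝ ψ z.1 u * (Real.exp (2 * ψ z.1) * g₂ z.2 v w.2) := by
  have k := h.two_mul_metric_secondDeriv (hw.smooth z hz) (hw.mapsTo z hz) (u, 0) (0, v) w
  rw [hw.fderiv_inducedMetric h₁ hz, hw.fderiv_inducedMetric h₁ hz,
    hw.fderiv_inducedMetric h₁ hz] at k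
  simp only [map_zero, zero_apply, mul_zero, add_zero, zero_mul, zero_add, sub_zero] at k
  linarith

/-- The component along the first factor of `∇_v v'` is `-g(v,v')` times the gradient of `ψ`. The
component along the second factor is not needed. -/
theorem metric_secondDeriv₂₂ (hw : IsWarpedImmersionOn g φ ξ U g₁ U₁ g₂ ψ j O)
    (h : IsLeviCivitaOn g Γ U) (h₁ : IsLeviCivitaOn g₁ Γ₁ U₁) (hz : z ∈ O) (v v' : E₂) (u : E₁) :
    g (j z) (secondDeriv Γ j z (0, v) (0, v')) (fderiv ℝ j z (u, 0))
      = -fderiv ℝ ψ z.1 u * (Real.exp (2 * ψ z.1) * g₂ z.2 v v') := by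
  have k := h.two_mul_metric_secondDeriv (hw.smooth z hz) (hw.mapsTo z hz) (0, v) (0, v') (u, 0)
  rw [hw.fderiv_inducedMetric h₁ hz, hw.fderiv_inducedMetric h₁ hz,
    hw.fderiv_inducedMetric h₁ hz] at k
  simp only [map_zero, zero_apply, mul_zero, add_zero, zero_mul, zero_add] at k
  linarith

/-- The sectional curvature of mixed planes, before splitting off the second fundamental form. -/
theorem gauss_mixed (hw : IsWarpedImmersionOn g φ ξ U g₁ U₁ g₂ ψ j O)
    (h : IsLeviCivitaOn g Γ U) (h₁ : IsLeviCivitaOn g₁ Γ₁ U₁) (hz : z ∈ O) (u : E₁) (v : E₂) :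
    g (j z) (curvatureOf Γ (j z) (fderiv ℝ j z (u, 0)) (fderiv ℝ j z (0, v))
        (fderiv ℝ j z (0, v))) (fderiv ℝ j z (u, 0))
      = -(fderiv ℝ (fderiv ℝ ψ) z.1 u u + 2 * fderiv ℝ ψ z.1 u ^ 2)
          * (Real.exp (2 * ψ z.1) * g₂ z.2 v v)
        - g (j z) (secondDeriv Γ j z (0, v) (0, v)) (secondDeriv Γ j z (u, 0) (u, 0))
        + g (j z) (secondDeriv Γ j z (u, 0) (0, v)) (secondDeriv Γ j z (u, 0) (0, v)) := by
  rw [h.gauss_secondDeriv (hw.smooth z hz) (hw.mapsTo z hz)]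
  -- The two tangential products in the Gauss equation are known near `z`. The first vanishes
  -- identically; the derivative of the second along `u` gives `uuψ + 2(uψ)²`, the square coming
  -- from the warping factor.
  have e1 : (fun z ↦ g (j z) (secondDeriv Γ j z (u, 0) (0, v)) (fderiv ℝ j z (u, 0)))
      =ᶠ[nhds z] fun _ ↦ (0 : ℝ) := by
    filter_upwards [hw.eventually_mem hz] with x hx
    rw [hw.metric_secondDeriv₁₂ h h₁ hx]
    simp
  have e2 : (fun z ↦ g (j z) (secondDeriv Γ j z (0, v) (0, v)) (fderiv ℝ j z (u, 0)))
      =ᶠ[nhds z] fun z ↦ -fderiv ℝ ψ z.1 u * (Real.exp (2 * ψ z.1) * g₂ z.2 v v) := by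
    filter_upwards [hw.eventually_mem hz] with x hx using hw.metric_secondDeriv₂₂ h h₁ hx v v u
  rw [e1.fderiv_eq, e2.fderiv_eq]
  have hψ : ContDiffAt ℝ 2 ψ z.1 := (hw.smooth_ψ z hz).of_le ENat.LEInfty.out
  have dψ : DifferentiableAt ℝ (fun y ↦ fderiv ℝ ψ y u) z.1 :=
    ((hψ.fderiv_right (m := 1) (by norm_num)).differentiableAt (by norm_num)).clm_apply
      (differentiableAt_const _)
  obtain ⟨x1, d1⟩ := hw.hasFDerivAt_exp hz (u, 0)
  have d3 : DifferentiableAt ℝ g₂ z.2 := (hw.smooth_metric₂ z hz).differentiableAt (by simp)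
  have f3 : DifferentiableAt ℝ (fun y ↦ g₂ y v v) z.2 :=
    (DifferentiableAt.clm_apply (G := E₂) (H := E₂ →L[ℝ] ℝ) d3
      (differentiableAt_const _)).clm_apply (differentiableAt_const _)
  have k2 := (dψ.hasFDerivAt.comp z hasFDerivAt_fst).neg
  have k3 := f3.hasFDerivAt.comp z hasFDerivAt_snd
  have k := congrArg (fun L ↦ L (u, 0)) (k2.mul (d1.hasFDerivAt.mul k3)).fderiv
  have k' : fderiv ℝ (fun z : E₁ × E₂ ↦
    -fderiv ℝ ψ z.1 u * (Real.exp (2 * ψ z.1) * g₂ z.2 v v)) z (u, 0) = _ := k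
  rw [k']
  simp only [add_apply, ContinuousLinearMap.comp_apply, ContinuousLinearMap.coe_fst',
    ContinuousLinearMap.coe_snd', smul_apply, smul_eq_mul, x1, Function.comp_apply, neg_apply,
    Pi.neg_apply, map_zero, fderiv_fderiv_apply hψ, fderiv_fun_const, Pi.zero_apply, zero_apply,
    Pi.mul_apply]
  ring

end IsWarpedImmersionOn

end WarpedImmersion

/-! ### The second fundamental form of the warped immersion -/

section SecondFundamentalForm

variable {E₁ : Type*} [NormedAddCommGroup E₁] [NormedSpace ℝ E₁]
  {E₂ : Type*} [NormedAddCommGroup E₂] [NormedSpace ℝ E₂]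
  {F : Type*} [NormedAddCommGroup F] [NormedSpace ℝ F]

/-- `σ` is the normal part of the second derivative of `j` at `z`. -/
structure IsNormalPart {E : Type*} [NormedAddCommGroup E] [NormedSpace ℝ E]
    (g : F → F →L[ℝ] F →L[ℝ] ℝ) (Γ : F → F →L[ℝ] F →L[ℝ] F) (j : E → F) (z : E)
    (σ : E → E → F) : Prop where
  normal : ∀ u v w, g (j z) (σ u v) (fderiv ℝ j z w) = 0
  tangent : ∀ u v, ∃ t, secondDeriv Γ j z u v = σ u v + fderiv ℝ j z t

/-- Identifies the tangential part of the second derivative from its inner products with tangent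
vectors; the difference of two candidates is tangent and orthogonal to itself. -/
theorem IsLeviCivitaOn.secondDeriv_eq {E : Type*} [NormedAddCommGroup E] [NormedSpace ℝ E]
    {g : F → F →L[ℝ] F →L[ℝ] ℝ} {Γ : F → F →L[ℝ] F →L[ℝ] F} {U : Set F}
    (h : IsLeviCivitaOn g Γ U) {j : E → F} {z : E} (hz : j z ∈ U) {σ : E → E → F}
    (hσ : IsNormalPart g Γ j z σ) {u v s : E}
    (hs : ∀ w, g (j z) (secondDeriv Γ j z u v) (fderiv ℝ j z w)
      = g (j z) (fderiv ℝ j z s) (fderiv ℝ j z w)) :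
    secondDeriv Γ j z u v = σ u v + fderiv ℝ j z s := by
  obtain ⟨t, ht⟩ := hσ.tangent u v
  have k := hs (t - s)
  rw [ht, map_add, add_apply, hσ.normal, zero_add] at k
  have k0 : fderiv ℝ j z (t - s) = 0 := by
    by_contra hne
    have pos := h.metric_pos _ hz _ hne
    have e : g (j z) (fderiv ℝ j z (t - s))
        = g (j z) (fderiv ℝ j z t) - g (j z) (fderiv ℝ j z s) := by
      rw [map_sub, map_sub]
    rw [e, sub_apply] at pos
    linarith
  rw [map_sub, sub_eq_zero] at k0
  rw [ht, k0]

namespace IsWarpedImmersionOn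

variable {g : F → F →L[ℝ] F →L[ℝ] ℝ} {Γ : F → F →L[ℝ] F →L[ℝ] F} {φ : F → F →L[ℝ] F}
  {ξ : F → F} {η : F → F →L[ℝ] ℝ} {U : Set F} {g₁ : E₁ → E₁ →L[ℝ] E₁ →L[ℝ] ℝ}
  {Γ₁ : E₁ → E₁ →L[ℝ] E₁ →L[ℝ] E₁} {U₁ : Set E₁} {g₂ : E₂ → E₂ →L[ℝ] E₂ →L[ℝ] ℝ}
  {ψ : E₁ → ℝ} {j : E₁ × E₂ → F} {O : Set (E₁ × E₂)} {z : E₁ × E₂}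
  {σ : E₁ × E₂ → E₁ × E₂ → F}

theorem secondDeriv₁₁_eq (hw : IsWarpedImmersionOn g φ ξ U g₁ U₁ g₂ ψ j O)
    (h : IsLeviCivitaOn g Γ U) (h₁ : IsLeviCivitaOn g₁ Γ₁ U₁) (hz : z ∈ O)
    (hσ : IsNormalPart g Γ j z σ) (u v : E₁) :
    secondDeriv Γ j z (u, 0) (v, 0) = σ (u, 0) (v, 0) + fderiv ℝ j z (Γ₁ z.1 u v, 0) := by
  refine h.secondDeriv_eq (hw.mapsTo z hz) hσ fun w ↦ ?_
  rw [hw.metric_secondDeriv₁₁ h h₁ hz, hw.isometric z hz]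
  simp

theorem secondDeriv₁₂_eq (hw : IsWarpedImmersionOn g φ ξ U g₁ U₁ g₂ ψ j O)
    (h : IsLeviCivitaOn g Γ U) (h₁ : IsLeviCivitaOn g₁ Γ₁ U₁) (hz : z ∈ O)
    (hσ : IsNormalPart g Γ j z σ) (u : E₁) (v : E₂) :
    secondDeriv Γ j z (u, 0) (0, v)
      = σ (u, 0) (0, v) + fderiv ℝ ψ z.1 u • fderiv ℝ j z (0, v) := by
  rw [← map_smul]
  refine h.secondDeriv_eq (hw.mapsTo z hz) hσ fun w ↦ ?_
  rw [hw.metric_secondDeriv₁₂ h h₁ hz, map_smul, map_smul, smul_apply, hw.isometric z hz]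
  simp

theorem normalPart_symm (hw : IsWarpedImmersionOn g φ ξ U g₁ U₁ g₂ ψ j O)
    (h : IsLeviCivitaOn g Γ U) (h₁ : IsLeviCivitaOn g₁ Γ₁ U₁) (hz : z ∈ O)
    (hσ : IsNormalPart g Γ j z σ) (u v : E₁) : σ (u, 0) (v, 0) = σ (v, 0) (u, 0) := by
  have k1 := hw.secondDeriv₁₁_eq h h₁ hz hσ u v
  have k2 := hw.secondDeriv₁₁_eq h h₁ hz hσ v u
  rw [secondDeriv_symm (hw.contDiffAt_two hz) (h.christoffel_symm _ (hw.mapsTo z hz)), k2,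
    h₁.christoffel_symm _ (hw.fst_mem z hz)] at k1
  exact (add_right_cancel k1).symm

/-- The Gauss equation for mixed planes of a warped product. -/
theorem gauss_warped (hw : IsWarpedImmersionOn g φ ξ U g₁ U₁ g₂ ψ j O)
    (h : IsLeviCivitaOn g Γ U) (h₁ : IsLeviCivitaOn g₁ Γ₁ U₁) (hz : z ∈ O)
    (hσ : IsNormalPart g Γ j z σ) (u : E₁) (v : E₂) :
    g (j z) (curvatureOf Γ (j z) (fderiv ℝ j z (u, 0)) (fderiv ℝ j z (0, v))
        (fderiv ℝ j z (0, v))) (fderiv ℝ j z (u, 0))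
      = -(fderiv ℝ (fderiv ℝ ψ) z.1 u u - fderiv ℝ ψ z.1 (Γ₁ z.1 u u) + fderiv ℝ ψ z.1 u ^ 2)
          * (Real.exp (2 * ψ z.1) * g₂ z.2 v v)
        - g (j z) (σ (0, v) (0, v)) (σ (u, 0) (u, 0))
        + g (j z) (σ (u, 0) (0, v)) (σ (u, 0) (0, v)) := by
  have hy := hw.mapsTo z hz
  rw [hw.gauss_mixed h h₁ hz]
  -- The tangential part of the second derivative along `u` supplies the Christoffel term that turns
  -- the coordinate second derivative of `ψ` into its Hessian.
  have a1 : g (j z) (secondDeriv Γ j z (0, v) (0, v)) (secondDeriv Γ j z (u, 0) (u, 0))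
      = g (j z) (σ (0, v) (0, v)) (σ (u, 0) (u, 0))
        - fderiv ℝ ψ z.1 (Γ₁ z.1 u u) * (Real.exp (2 * ψ z.1) * g₂ z.2 v v) := by
    rw [hw.secondDeriv₁₁_eq h h₁ hz hσ, map_add, hw.metric_secondDeriv₂₂ h h₁ hz]
    obtain ⟨t, ht⟩ := hσ.tangent (0, v) (0, v)
    have n := hσ.normal (u, 0) (u, 0) t
    rw [h.metric_symm _ hy] at n
    rw [ht, map_add, add_apply, n]
    ring
  -- The tangential part `(uψ)v` of the mixed second derivative removes one of the two copies of
  -- `(uψ)²`.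
  have a2 : g (j z) (secondDeriv Γ j z (u, 0) (0, v)) (secondDeriv Γ j z (u, 0) (0, v))
      = g (j z) (σ (u, 0) (0, v)) (σ (u, 0) (0, v))
        + fderiv ℝ ψ z.1 u ^ 2 * (Real.exp (2 * ψ z.1) * g₂ z.2 v v) := by
    rw [hw.secondDeriv₁₂_eq h h₁ hz hσ]
    have n := hσ.normal (u, 0) (0, v) (0, v)
    have n' := n
    rw [h.metric_symm _ hy] at n'
    have i := hw.isometric z hz (0, v) (0, v)
    simp only [map_zero, zero_add] at i
    simp only [map_add, map_smul, add_apply, smul_apply, smul_eq_mul, n, n', i]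
    ring
  rw [a1, a2]
  ring

theorem η_normalPart (hw : IsWarpedImmersionOn g φ ξ U g₁ U₁ g₂ ψ j O)
    (h : IsCosymplecticOn g Γ φ ξ η U) (hz : z ∈ O)
    (hσ : IsNormalPart g Γ j z σ) (u v : E₁ × E₂) : η (j z) (σ u v) = 0 := by
  have hy := hw.mapsTo z hz
  obtain ⟨w, hw'⟩ := hw.tangent_ξ z hz
  rw [← h.metric_ξ hy, h.metric_symm _ hy, ← hw']
  exact hσ.normal u v (w, 0)

variable [FiniteDimensional ℝ E₁]

set_option synthInstance.maxHeartbeats 200000 in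
/-- A differentiable field along `j` that is tangent to the first factor has differentiable
components. -/
theorem exists_components (hw : IsWarpedImmersionOn g φ ξ U g₁ U₁ g₂ ψ j O)
    (h : IsLeviCivitaOn g Γ U) (h₁ : IsLeviCivitaOn g₁ Γ₁ U₁) (hz : z ∈ O) {V : E₁ × E₂ → F}
    (hV : DifferentiableAt ℝ V z) (hVj : ∀ x ∈ O, ∃ a : E₁, V x = fderiv ℝ j x (a, 0)) :
    ∃ X : E₁ × E₂ → E₁, DifferentiableAt ℝ X z ∧ ∀ x ∈ O, V x = fderiv ℝ j x (X x, 0) := by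
  -- The components solve `g₁(X, ·) = g(V, dj(·, 0))`, an equation whose solution depends
  -- differentiably on the point because `g₁` is invertible.
  refine ⟨fun x ↦ (g₁ x.1).inverse ((g (j x) (V x)).comp
    ((fderiv ℝ j x).comp (ContinuousLinearMap.inl ℝ E₁ E₂))), ?_, ?_⟩
  · have d1 : DifferentiableAt ℝ (fun x : E₁ × E₂ ↦ (g₁ x.1).inverse) z := by
      have hy := hw.fst_mem z hz
      have k1 : DifferentiableAt ℝ (ContinuousLinearMap.inverse : (E₁ →L[ℝ] E₁ →L[ℝ] ℝ) → _)
          (g₁ z.1) :=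
        (contDiffAt_inverse_of_pos (n := 1) (h₁.metric_pos _ hy)).differentiableAt (by norm_num)
      have k2 : DifferentiableAt ℝ (fun x : E₁ × E₂ ↦ g₁ x.1) z :=
        DifferentiableAt.comp (𝕜 := ℝ) (F := E₁) (G := E₁ →L[ℝ] E₁ →L[ℝ] ℝ) (g := g₁)
          (f := Prod.fst) z (h₁.differentiableAt_metric hy) differentiableAt_fst
      exact DifferentiableAt.comp (𝕜 := ℝ) (F := E₁ →L[ℝ] E₁ →L[ℝ] ℝ)
        (G := (E₁ →L[ℝ] ℝ) →L[ℝ] E₁) (g := ContinuousLinearMap.inverse) (f := fun x ↦ g₁ x.1)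
        z k1 k2
    have hj2 := hw.contDiffAt_two hz
    have d2 : DifferentiableAt ℝ (fderiv ℝ j) z :=
      (hj2.fderiv_right (m := 1) (by norm_num)).differentiableAt (by norm_num)
    have d3 : DifferentiableAt ℝ (fun x ↦ g (j x)) z :=
      DifferentiableAt.comp (G := F →L[ℝ] F →L[ℝ] ℝ) z
        (h.differentiableAt_metric (hw.mapsTo z hz)) (hj2.differentiableAt (by norm_num))
    have d4 := DifferentiableAt.clm_apply (G := F) (H := F →L[ℝ] ℝ) d3 hV
    exact d1.clm_apply (d4.clm_comp (d2.clm_comp (differentiableAt_const _)))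
  · intro x hx
    obtain ⟨a, ha⟩ := hVj x hx
    have hy := hw.fst_mem x hx
    rw [ha]
    congr 2
    refine h₁.eq_of_metric_eq hy fun w ↦ ?_
    rw [apply_inverse_of_pos (h₁.metric_pos _ hy)]
    simp only [ContinuousLinearMap.comp_apply, ContinuousLinearMap.inl_apply]
    rw [ha, hw.isometric x hx]
    simp

/-- On the invariant factor, the second fundamental form is complex linear. -/
theorem normalPart_φ (hw : IsWarpedImmersionOn g φ ξ U g₁ U₁ g₂ ψ j O)
    (h : IsCosymplecticOn g Γ φ ξ η U) (h₁ : IsLeviCivitaOn g₁ Γ₁ U₁) (hz : z ∈ O)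
    (hσ : IsNormalPart g Γ j z σ) {u v v' : E₁}
    (hv : φ (j z) (fderiv ℝ j z (v, 0)) = fderiv ℝ j z (v', 0)) :
    σ (u, 0) (v', 0) = φ (j z) (σ (u, 0) (v, 0)) := by
  have h' := h.toIsLeviCivitaOn
  have hy := hw.mapsTo z hz
  have hj2 := hw.contDiffAt_two hz
  have dj := hj2.differentiableAt (by norm_num)
  have d2 : DifferentiableAt ℝ (fderiv ℝ j) z :=
    (hj2.fderiv_right (m := 1) (by norm_num)).differentiableAt (by norm_num)
  have dv : DifferentiableAt ℝ (fun x ↦ fderiv ℝ j x (v, 0)) z :=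
    d2.clm_apply (differentiableAt_const _)
  have dV : DifferentiableAt ℝ (fun x ↦ φ (j x) (fderiv ℝ j x (v, 0))) z :=
    (DifferentiableAt.comp (G := F →L[ℝ] F) z (h.differentiableAt_φ hy) dj).clm_apply dv
  obtain ⟨X, dX, hX⟩ := hw.exists_components h' h₁ hz dV fun x hx ↦ hw.invariant x hx v
  have inj : ∀ a b : E₁, fderiv ℝ j z (a, 0) = fderiv ℝ j z (b, 0) → a = b := by
    intro a b hab
    refine h₁.eq_of_metric_eq (hw.fst_mem z hz) fun w ↦ ?_
    have i1 := hw.isometric z hz (a, 0) (w, 0)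
    have i2 := hw.isometric z hz (b, 0) (w, 0)
    rw [hab, i2] at i1
    simpa using i1.symm
  have hXz : X z = v' := inj _ _ (by rw [← hv, hX z hz])
  have e : (fun x ↦ φ (j x) (fderiv ℝ j x (v, 0)))
      =ᶠ[nhds z] fun x ↦ fderiv ℝ j x (X x, (0 : E₂)) := by
    filter_upwards [hw.eventually_mem hz] with x hx using hX x hx
  -- Along `j`, the field `φ dj(v)` is again `dj(X)` with `X` tangent to the first factor.
  -- Differentiating both descriptions compares `σ(u, v')` with `φσ(u, v)` up to a vector `dj(t,
  -- 0)`.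
  have c1 := covDeriv_parallel_endomorphism (h.differentiableAt_φ hy) dj dv (h.parallel_φ hy) (u, 0)
  have dX' : HasFDerivAt (fun x ↦ (X x, (0 : E₂))) ((fderiv ℝ X z).prod 0) z :=
    dX.hasFDerivAt.prodMk (hasFDerivAt_const _ _)
  rw [covDeriv_congr e, covDeriv_fderiv_field hj2 dX'.differentiableAt, covDeriv_fderiv hj2,
    dX'.fderiv, hXz, hw.secondDeriv₁₁_eq h' h₁ hz hσ, hw.secondDeriv₁₁_eq h' h₁ hz hσ,
    map_add] at c1
  obtain ⟨b, hb⟩ := hw.invariant z hz (Γ₁ z.1 u v)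
  rw [hb] at c1
  simp only [ContinuousLinearMap.prod_apply, zero_apply] at c1
  set t : E₁ := b - fderiv ℝ X z (u, 0) - Γ₁ z.1 u v' with ht
  have c2 : σ (u, 0) (v', 0) = φ (j z) (σ (u, 0) (v, 0)) + fderiv ℝ j z (t, 0) := by
    have et : ((t, 0) : E₁ × E₂) = (b, 0) - (fderiv ℝ X z (u, 0), 0) - (Γ₁ z.1 u v', 0) := by
      simp [ht]
    rw [et, map_sub, map_sub]
    rw [← eq_sub_iff_add_eq, ← eq_sub_iff_add_eq] at c1
    rw [c1]; abel
  -- `σ(u, v')` is normal, and `φσ(u, v)` is orthogonal to the leaf because `φ` is skew and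
  -- preserves its tangent spaces. Hence `dj(t, 0)` is orthogonal to itself.
  have t0 : fderiv ℝ j z (t, 0) = 0 := by
    refine h'.eq_of_metric_eq hy fun w ↦ ?_
    by_contra hne
    have ne : fderiv ℝ j z (t, 0) ≠ 0 := by
      intro h0; rw [h0] at hne; exact hne rfl
    have pos := h'.metric_pos _ hy _ ne
    have n := hσ.normal (u, 0) (v', 0) (t, 0)
    obtain ⟨t', ht'⟩ := hw.invariant z hz t
    rw [c2, map_add, add_apply, h.metric_φ hy, ht', hσ.normal] at n
    linarith
  rw [c2, t0, add_zero]

/-- Complex linearity in both arguments gives `σ(φu, φu) = φ²σ(u, u)`, and `η ∘ σ = 0` since `ξ` is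
tangent. -/
theorem normalPart_φ_φ (hw : IsWarpedImmersionOn g φ ξ U g₁ U₁ g₂ ψ j O)
    (h : IsCosymplecticOn g Γ φ ξ η U) (h₁ : IsLeviCivitaOn g₁ Γ₁ U₁) (hz : z ∈ O)
    (hσ : IsNormalPart g Γ j z σ) {u u' : E₁}
    (hu : φ (j z) (fderiv ℝ j z (u, 0)) = fderiv ℝ j z (u', 0)) :
    σ (u', 0) (u', 0) = -σ (u, 0) (u, 0) := by
  rw [hw.normalPart_φ h h₁ hz hσ hu, hw.normalPart_symm h.toIsLeviCivitaOn h₁ hz hσ,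
    hw.normalPart_φ h h₁ hz hσ hu, h.φ_φ _ (hw.mapsTo z hz), hw.η_normalPart h hz hσ]
  simp

/-- The mixed second fundamental form of a contact CR-warped product in a cosymplectic space
form. -/
theorem mixed_normalPart_add (hw : IsWarpedImmersionOn g φ ξ U g₁ U₁ g₂ ψ j O)
    (h : IsCosymplecticOn g Γ φ ξ η U) (h₁ : IsLeviCivitaOn g₁ Γ₁ U₁) (hz : z ∈ O) {c : ℝ}
    (hc : ∀ u, g (j z) u u = 1 → g (j z) u (ξ (j z)) = 0 →
      g (j z) (curvatureOf Γ (j z) u (φ (j z) u) (φ (j z) u)) u = c)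
    (hσ : IsNormalPart g Γ j z σ) {u u' : E₁}
    (hu : φ (j z) (fderiv ℝ j z (u, 0)) = fderiv ℝ j z (u', 0)) (v : E₂) :
    g (j z) (σ (u, 0) (0, v)) (σ (u, 0) (0, v)) + g (j z) (σ (u', 0) (0, v)) (σ (u', 0) (0, v))
      = (Real.exp (2 * ψ z.1) * g₂ z.2 v v) *
        ((fderiv ℝ (fderiv ℝ ψ) z.1 u u - fderiv ℝ ψ z.1 (Γ₁ z.1 u u) + fderiv ℝ ψ z.1 u ^ 2)
        + (fderiv ℝ (fderiv ℝ ψ) z.1 u' u' - fderiv ℝ ψ z.1 (Γ₁ z.1 u' u') + fderiv ℝ ψ z.1 u' ^ 2)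
        + c / 2 * (g₁ z.1 u u - η (j z) (fderiv ℝ j z (u, 0)) ^ 2)) := by
  have h' := h.toIsLeviCivitaOn
  have hy := hw.mapsTo z hz
  have ortho : ∀ a : E₁, g (j z) (fderiv ℝ j z (a, 0)) (fderiv ℝ j z (0, v)) = 0 := by
    intro a; rw [hw.isometric z hz]; simp
  have ηv : η (j z) (fderiv ℝ j z (0, v)) = 0 := by
    obtain ⟨w, hw'⟩ := hw.tangent_ξ z hz
    rw [← h.metric_ξ hy, ← hw', ortho]
  -- Adding the Gauss equations of `u ∧ v` and `φu ∧ v` cancels the products with `σ(v, v)`, as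
  -- `σ(u', u') = -σ(u, u)`.
  have k := h.sectional_add_sectional_φ hy hc ηv (ortho u) (by rw [hu, ortho])
  rw [hu, hw.gauss_warped h' h₁ hz hσ, hw.gauss_warped h' h₁ hz hσ,
    hw.normalPart_φ_φ h h₁ hz hσ hu, map_neg, hw.isometric z hz, hw.isometric z hz] at k
  simp only [map_zero, mul_zero, add_zero, zero_add] at k
  linarith

/-- Write the parallel field `ξ` as `dj(X, 0)` and differentiate. In the direction `v`, the normal
part gives `σ(ξ, v) = 0` and the part along `v` gives `ξψ = 0`. In the direction `ξ`, one gets `∇_ξ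
ξ = 0` in the first factor, so differentiating `ξψ = 0` along `ξ` gives `Hess ψ(ξ, ξ) = 0`. A
nonzero `v` is needed for the second claim: without a second factor, `ψ` is unconstrained. -/
theorem mixed_normalPart_ξ (hw : IsWarpedImmersionOn g φ ξ U g₁ U₁ g₂ ψ j O)
    (h : IsCosymplecticOn g Γ φ ξ η U) (h₁ : IsLeviCivitaOn g₁ Γ₁ U₁) (hz : z ∈ O)
    (hσ : IsNormalPart g Γ j z σ) {w : E₁} (hwξ : fderiv ℝ j z (w, 0) = ξ (j z)) (v : E₂) :
    σ (w, 0) (0, v) = 0 ∧ (v ≠ 0 →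
      fderiv ℝ (fderiv ℝ ψ) z.1 w w - fderiv ℝ ψ z.1 (Γ₁ z.1 w w) + fderiv ℝ ψ z.1 w ^ 2 = 0) := by
  have h' := h.toIsLeviCivitaOn
  have dξ : ∀ {x}, x ∈ O → DifferentiableAt ℝ (fun x ↦ ξ (j x)) x := fun {x} hx ↦
    (h.differentiableAt_ξ (hw.mapsTo x hx)).comp x
      ((hw.contDiffAt_two hx).differentiableAt (by norm_num))
  obtain ⟨X, dX, hX⟩ := hw.exists_components h' h₁ hz (dξ hz) fun x hx ↦ by
    obtain ⟨a, ha⟩ := hw.tangent_ξ x hx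
    exact ⟨a, ha.symm⟩
  have hder : ∀ {x}, x ∈ O → ∀ {Y : E₁ × E₂ → E₁}, DifferentiableAt ℝ Y x →
      (∀ x ∈ O, ξ (j x) = fderiv ℝ j x (Y x, 0)) → ∀ a,
      secondDeriv Γ j x a (Y x, 0) + fderiv ℝ j x (fderiv ℝ Y x a, 0) = 0 := by
    intro x hx Y dY hY a
    have hy := hw.mapsTo x hx
    have hj2 := hw.contDiffAt_two hx
    have e : (fun x ↦ ξ (j x)) =ᶠ[nhds x] fun x ↦ fderiv ℝ j x (Y x, (0 : E₂)) := by
      filter_upwards [hw.eventually_mem hx] with b hb using hY b hb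
    have c1 := covDeriv_parallel_field (h.differentiableAt_ξ hy)
      (hj2.differentiableAt (by norm_num)) (h.parallel_ξ hy) a
    have dY' : HasFDerivAt (fun x ↦ (Y x, (0 : E₂))) ((fderiv ℝ Y x).prod 0) x :=
      dY.hasFDerivAt.prodMk (hasFDerivAt_const _ _)
    rw [covDeriv_congr e, covDeriv_fderiv_field hj2 dY'.differentiableAt, dY'.fderiv] at c1
    simpa using c1
  have inj : ∀ {x}, x ∈ O → ∀ a b : E₁, fderiv ℝ j x (a, 0) = fderiv ℝ j x (b, 0) → a = b := by
    intro x hx a b hab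
    refine h₁.eq_of_metric_eq (hw.fst_mem x hx) fun w ↦ ?_
    have i1 := hw.isometric x hx (a, 0) (w, 0)
    have i2 := hw.isometric x hx (b, 0) (w, 0)
    rw [hab, i2] at i1
    simpa using i1.symm
  have hXw : X z = w := inj hz _ _ (by rw [hwξ, hX z hz])
  have zero : ∀ x ∈ O, v ≠ 0 → fderiv ℝ ψ x.1 (X x) = 0 := by
    intro x hx hv
    -- `X` is known to be differentiable only at `z`. At another point `x` a component field
    -- differentiable there is used instead; it agrees with `X` because `dj` is injective on the
    -- first factor.
    obtain ⟨Y, dY, hY⟩ := hw.exists_components h' h₁ hx (dξ hx) fun x hx ↦ by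
      obtain ⟨a, ha⟩ := hw.tangent_ξ x hx
      exact ⟨a, ha.symm⟩
    have hXY : X x = Y x := inj hx _ _ (by rw [← hX x hx, ← hY x hx])
    have hy := hw.mapsTo x hx
    have k := hder hx dY hY (0, v)
    rw [secondDeriv_symm (hw.contDiffAt_two hx) (h'.christoffel_symm _ hy)] at k
    have k' := congrArg (fun t ↦ g (j x) t (fderiv ℝ j x (0, v))) k
    simp only [map_add, add_apply, map_zero, zero_apply, hw.metric_secondDeriv₁₂ h' h₁ hx,
      hw.isometric x hx, mul_zero, add_zero] at k'
    have pos := mul_pos (Real.exp_pos (2 * ψ x.1)) (hw.metric₂_pos x hx v hv)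
    rw [hXY]
    exact (mul_eq_zero.1 k').resolve_right pos.ne'
  have hy := hw.mapsTo z hz
  constructor
  · rcases eq_or_ne v 0 with rfl | hv
    · have k := hw.secondDeriv₁₂_eq h' h₁ hz hσ w 0
      have e : ((0, 0) : E₁ × E₂) = 0 := rfl
      rw [e, map_zero, smul_zero, add_zero, secondDeriv, map_zero, map_zero, map_zero,
        add_zero] at k
      exact k.symm
    have k := hder hz dX hX (0, v)
    rw [secondDeriv_symm (hw.contDiffAt_two hz) (h'.christoffel_symm _ hy),
      hw.secondDeriv₁₂_eq h' h₁ hz hσ, zero z hz hv, zero_smul, add_zero, hXw] at k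
    refine h'.eq_of_metric_eq hy fun a ↦ ?_
    by_contra hne
    have ne : σ (w, 0) (0, v) ≠ 0 := by intro h0; rw [h0] at hne; exact hne rfl
    have pos := h'.metric_pos _ hy _ ne
    have n := hσ.normal (w, 0) (0, v) (fderiv ℝ X z (0, v), 0)
    have k' := congrArg (fun t ↦ g (j z) (σ (w, 0) (0, v)) t) k
    simp only [map_add, map_zero, n] at k'
    linarith
  · intro hv
    have z0 := zero z hz hv
    rw [hXw] at z0
    have k := hder hz dX hX (w, 0)
    rw [hXw, hw.secondDeriv₁₁_eq h' h₁ hz hσ] at k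
    have k1 : Γ₁ z.1 w w + fderiv ℝ X z (w, 0) = 0 := by
      refine h₁.eq_of_metric_eq (hw.fst_mem z hz) fun a ↦ ?_
      have k' := congrArg (fun t ↦ g (j z) t (fderiv ℝ j z (a, 0))) k
      simp only [map_add, add_apply, map_zero, zero_apply, hσ.normal, hw.isometric z hz, mul_zero,
        add_zero, zero_add] at k' ⊢
      exact k'
    have e : (fun x : E₁ × E₂ ↦ fderiv ℝ ψ x.1 (X x)) =ᶠ[nhds z] fun _ ↦ (0 : ℝ) := by
      filter_upwards [hw.eventually_mem hz] with x hx using zero x hx hv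
    have hψ : ContDiffAt ℝ 2 ψ z.1 := (hw.smooth_ψ z hz).of_le ENat.LEInfty.out
    have dψ : DifferentiableAt ℝ (fderiv ℝ ψ) z.1 :=
      (hψ.fderiv_right (m := 1) (by norm_num)).differentiableAt (by norm_num)
    have dψ' := dψ.hasFDerivAt.comp z (hasFDerivAt_fst (𝕜 := ℝ) (E := E₁) (F := E₂))
    have f1 := congrArg (fun L ↦ L (w, 0)) (dψ'.clm_apply dX.hasFDerivAt).fderiv
    simp only [Function.comp_apply] at f1
    rw [e.fderiv_eq] at f1
    simp [hXw] at f1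
    have f2 : fderiv ℝ X z (w, 0) = -Γ₁ z.1 w w := eq_neg_of_add_eq_zero_right k1
    rw [f2, map_neg] at f1
    rw [z0]
    linarith

end IsWarpedImmersionOn

end SecondFundamentalForm

/-! ### Vector fields and Lie brackets in charts -/

section Charts

variable {E : Type*} [NormedAddCommGroup E] [NormedSpace ℝ E]
  {H : Type*} [TopologicalSpace H] (I : ModelWithCorners ℝ E H)
  {M : Type*} [TopologicalSpace M] [ChartedSpace H M] [IsManifold I ∞ M]

/-- The components of tangent vectors at `p` in the preferred chart around `x₀`. -/
def components (x₀ p : M) : TangentSpace I p →L[ℝ] E :=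
  mvfderiv I (extChartAt I x₀) p

/-- The coordinate field with components `u` of the preferred chart around `x₀`. -/
def coordField (x₀ : M) (u : E) (p : M) : TangentSpace I p :=
  (trivializationAt E (TangentSpace I) x₀).symmL ℝ p u

variable {I}

theorem mdifferentiableAt_chart {x₀ p : M} (hp : p ∈ (extChartAt I x₀).source) :
    MDifferentiableAt I 𝓘(ℝ, E) (extChartAt I x₀) p :=
  haveI : IsManifold I 1 M := .of_le (n := ∞) (by simp)
  mdifferentiableAt_extChartAt (by rwa [← extChartAt_source I])

theorem components_eq_trivialization {x₀ p : M} (hp : p ∈ (extChartAt I x₀).source)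
    (a : TangentSpace I p) :
    components I x₀ p a = (trivializationAt E (TangentSpace I) x₀ ⟨p, a⟩).2 := by
  have : IsManifold I 1 M := .of_le (n := ∞) (by simp)
  rw [extChartAt_source] at hp
  have h := TangentBundle.continuousLinearMapAt_trivializationAt (I := I) (𝕜 := ℝ) hp
  have h1 : (trivializationAt E (TangentSpace I) x₀).continuousLinearMapAt ℝ p a
      = (trivializationAt E (TangentSpace I) x₀ ⟨p, a⟩).2 := by
    rw [Trivialization.continuousLinearMapAt_apply, Trivialization.linearMapAt_apply]
    rw [if_pos]
    simpa using hp
  rw [← h1, h]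
  rfl

theorem smoothFieldAt_coordField {x₀ p : M} (hp : p ∈ (extChartAt I x₀).source) (u : E) :
    SmoothFieldAt (coordField I x₀ u) p := by
  have hb : p ∈ (trivializationAt E (TangentSpace I) x₀).baseSet := by
    simpa using hp
  refine ((trivializationAt E (TangentSpace I) x₀).contMDiffAt_section_iff hb).2 ?_
  refine (contMDiffAt_const (c := u)).congr_of_eventuallyEq ?_
  filter_upwards [(trivializationAt E (TangentSpace I) x₀).open_baseSet.mem_nhds hb] with q hq
  rw [coordField, Trivialization.symmL_apply _ hq,
    Trivialization.apply_mk_symm _ hq]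

variable [I.Boundaryless]

theorem contMDiffAt_chart_symm {x₀ : M} {y : E} (hy : y ∈ (extChartAt I x₀).target) :
    ContMDiffAt 𝓘(ℝ, E) I ∞ (extChartAt I x₀).symm y :=
  (contMDiffOn_extChartAt_symm x₀).contMDiffAt ((isOpen_extChartAt_target x₀).mem_nhds hy)

theorem mdifferentiableAt_chart_symm {x₀ : M} {y : E} (hy : y ∈ (extChartAt I x₀).target) :
    MDifferentiableAt 𝓘(ℝ, E) I (extChartAt I x₀).symm y :=
  (contMDiffAt_chart_symm hy).mdifferentiableAt (by simp)

theorem components_coordFrame {x₀ : M} {y : E} (hy : y ∈ (extChartAt I x₀).target) (u : E) :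
    components I x₀ ((extChartAt I x₀).symm y) (coordFrame I x₀ y u) = u := by
  have : IsManifold I 1 M := .of_le (n := ∞) (by simp)
  have h := mfderiv_extChartAt_comp_mfderivWithin_extChartAt_symm (I := I) hy
  rw [I.range_eq_univ, mfderivWithin_univ] at h
  exact congrArg (fun L ↦ L u) h

theorem coordFrame_components {x₀ : M} {y : E} (hy : y ∈ (extChartAt I x₀).target)
    (a : TangentSpace I ((extChartAt I x₀).symm y)) :
    coordFrame I x₀ y (components I x₀ ((extChartAt I x₀).symm y) a) = a := by
  have : IsManifold I 1 M := .of_le (n := ∞) (by simp)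
  have h := mfderivWithin_extChartAt_symm_comp_mfderiv_extChartAt (I := I) hy
  rw [I.range_eq_univ, mfderivWithin_univ] at h
  exact congrArg (fun L ↦ L a) h

/-- Connects the two descriptions of coordinate fields: sections of the tangent bundle
trivialization, which are smooth, and differentials of the inverse chart, in which the metric
coefficients are defined. -/
theorem coordField_symm {x₀ : M} {y : E} (hy : y ∈ (extChartAt I x₀).target) (u : E) :
    coordField I x₀ u ((extChartAt I x₀).symm y) = coordFrame I x₀ y u := by
  have : IsManifold I 1 M := .of_le (n := ∞) (by simp)
  have hp : (extChartAt I x₀).symm y ∈ (chartAt H x₀).source := by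
    rw [← extChartAt_source I]; exact (extChartAt I x₀).map_target hy
  have h := TangentBundle.symmL_trivializationAt (I := I) (𝕜 := ℝ) hp
  rw [coordField, h, I.range_eq_univ, mfderivWithin_univ, (extChartAt I x₀).right_inv hy]
  rfl

theorem contDiffAt_components {x₀ : M} {y : E} (hy : y ∈ (extChartAt I x₀).target)
    {X : ∀ p : M, TangentSpace I p} (hX : SmoothFieldAt X ((extChartAt I x₀).symm y)) :
    ContDiffAt ℝ ∞
      (fun y ↦ components I x₀ ((extChartAt I x₀).symm y) (X ((extChartAt I x₀).symm y))) y := by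
  have hp := (extChartAt I x₀).map_target hy
  have hb : (extChartAt I x₀).symm y ∈ (trivializationAt E (TangentSpace I) x₀).baseSet := by
    simpa using hp
  have h1 := ((trivializationAt E (TangentSpace I) x₀).contMDiffAt_section_iff hb).1 hX
  have h2 := ContMDiffAt.comp y h1 (contMDiffAt_chart_symm hy)
  refine h2.contDiffAt.congr_of_eventuallyEq ?_
  filter_upwards [(isOpen_extChartAt_target x₀).mem_nhds hy] with z hz
  exact components_eq_trivialization ((extChartAt I x₀).map_target hz) _

theorem contDiffAt_comp_chart_symm {x₀ : M} {y : E} (hy : y ∈ (extChartAt I x₀).target)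
    {s : M → ℝ} (hs : ContMDiffAt I 𝓘(ℝ, ℝ) ∞ s ((extChartAt I x₀).symm y)) :
    ContDiffAt ℝ ∞ (fun y ↦ s ((extChartAt I x₀).symm y)) y :=
  (ContMDiffAt.comp y hs (contMDiffAt_chart_symm hy)).contDiffAt

theorem mvfderiv_coordFrame {x₀ : M} {y : E} (hy : y ∈ (extChartAt I x₀).target)
    {s : M → ℝ} (hs : ContMDiffAt I 𝓘(ℝ, ℝ) ∞ s ((extChartAt I x₀).symm y)) (u : E) :
    mvfderiv I s ((extChartAt I x₀).symm y) (coordFrame I x₀ y u)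
      = fderiv ℝ (fun y ↦ s ((extChartAt I x₀).symm y)) y u := by
  have h := mfderiv_comp y (hs.mdifferentiableAt (by simp)) (mdifferentiableAt_chart_symm hy)
  rw [mfderiv_eq_fderiv] at h
  exact (congrArg (fun L ↦ L u) h).symm

/-- Brackets are natural under pullback by the inverse chart, and on the model space the bracket is
the difference of directional derivatives. -/
theorem mlieBracket_chart_symm [CompleteSpace E] {x₀ : M} {y : E}
    (hy : y ∈ (extChartAt I x₀).target)
    {X Y : ∀ p : M, TangentSpace I p} (hX : SmoothFieldAt X ((extChartAt I x₀).symm y))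
    (hY : SmoothFieldAt Y ((extChartAt I x₀).symm y)) {X' Y' : E → E}
    (hX' : ∀ y ∈ (extChartAt I x₀).target,
      components I x₀ ((extChartAt I x₀).symm y) (X ((extChartAt I x₀).symm y)) = X' y)
    (hY' : ∀ y ∈ (extChartAt I x₀).target,
      components I x₀ ((extChartAt I x₀).symm y) (Y ((extChartAt I x₀).symm y)) = Y' y) :
    mlieBracket I X Y ((extChartAt I x₀).symm y)
      = coordFrame I x₀ y (fderiv ℝ Y' y (X' y) - fderiv ℝ X' y (Y' y)) := by
  have : IsManifold I (minSmoothness ℝ 3) M := .of_le (n := ∞) (by simp; exact ENat.LEInfty.out)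
  have : IsManifold I 1 M := .of_le (n := ∞) (by simp)
  have inv : ∀ y ∈ (extChartAt I x₀).target,
      (mfderiv 𝓘(ℝ, E) I (extChartAt I x₀).symm y).inverse
        = mfderiv I 𝓘(ℝ, E) (extChartAt I x₀) ((extChartAt I x₀).symm y) := by
    intro y hy
    have h1 := mfderivWithin_extChartAt_symm_comp_mfderiv_extChartAt (I := I) hy
    have h2 := mfderiv_extChartAt_comp_mfderivWithin_extChartAt_symm (I := I) hy
    rw [I.range_eq_univ, mfderivWithin_univ] at h1 h2
    exact ContinuousLinearMap.inverse_eq h1 h2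
  have h := mpullback_mlieBracket (I := 𝓘(ℝ, E)) (I' := I) (f := (extChartAt I x₀).symm) (x₀ := y)
    (hX.mdifferentiableAt (by simp)) (hY.mdifferentiableAt (by simp)) (contMDiffAt_chart_symm hy)
    (by simp; exact ENat.LEInfty.out)
  have eX : mpullback 𝓘(ℝ, E) I (extChartAt I x₀).symm X =ᶠ[nhds y] X' := by
    filter_upwards [(isOpen_extChartAt_target x₀).mem_nhds hy] with z hz
    rw [mpullback_apply, inv z hz]
    exact hX' z hz
  have eY : mpullback 𝓘(ℝ, E) I (extChartAt I x₀).symm Y =ᶠ[nhds y] Y' := by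
    filter_upwards [(isOpen_extChartAt_target x₀).mem_nhds hy] with z hz
    rw [mpullback_apply, inv z hz]
    exact hY' z hz
  rw [Filter.EventuallyEq.mlieBracket_vectorField_eq eX eY, mpullback_apply, inv y hy] at h
  have hb : mlieBracket 𝓘(ℝ, E) X' Y' y = lieBracket ℝ X' Y' y := by
    have e1 := congrFun (mlieBracketWithin_univ (I := 𝓘(ℝ, E)) (V := X') (W := Y')) y
    have e2 := congrFun
      (mlieBracketWithin_eq_lieBracketWithin (𝕜 := ℝ) (V := X') (W := Y') (s := Set.univ)) y
    exact e1.symm.trans (e2.trans (congrFun lieBracketWithin_univ y))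
  have h3 := congrArg (coordFrame I x₀ y) (h.trans hb)
  exact (coordFrame_components hy _).symm.trans h3

theorem mlieBracket_coordField [CompleteSpace E] {x₀ : M} {y : E}
    (hy : y ∈ (extChartAt I x₀).target) (u v : E) :
    mlieBracket I (coordField I x₀ u) (coordField I x₀ v) ((extChartAt I x₀).symm y) = 0 := by
  have hp := (extChartAt I x₀).map_target hy
  rw [mlieBracket_chart_symm hy (smoothFieldAt_coordField hp u) (smoothFieldAt_coordField hp v)
    (X' := fun _ ↦ u) (Y' := fun _ ↦ v)
    (fun z hz ↦ by rw [coordField_symm hz, components_coordFrame hz])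
    (fun z hz ↦ by rw [coordField_symm hz, components_coordFrame hz])]
  simp only [fderiv_fun_const, Pi.zero_apply, zero_apply, sub_self]
  exact map_zero _

end Charts

/-! ### The metric and the Christoffel symbols in charts -/

section RiemannianCharts

variable {E : Type*} [NormedAddCommGroup E] [NormedSpace ℝ E]
  {H : Type*} [TopologicalSpace H] (I : ModelWithCorners ℝ E H)
  {M : Type*} [TopologicalSpace M] [ChartedSpace H M]
  [RiemannianBundle (fun x : M ↦ TangentSpace I x)]

variable {I}

theorem coordMetric_apply (x₀ : M) (y u v : E) :
    coordMetric I x₀ y u v = inner ℝ (coordFrame I x₀ y u) (coordFrame I x₀ y v) := rfl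

section

variable [I.Boundaryless] [IsManifold I ∞ M]

theorem inner_eq_coordMetric {x₀ p : M} (hp : p ∈ (extChartAt I x₀).source)
    (a b : TangentSpace I p) :
    inner ℝ a b = coordMetric I x₀ (extChartAt I x₀ p) (components I x₀ p a)
      (components I x₀ p b) := by
  obtain ⟨y, hy, rfl⟩ : ∃ y ∈ (extChartAt I x₀).target, (extChartAt I x₀).symm y = p :=
    ⟨_, (extChartAt I x₀).map_source hp, (extChartAt I x₀).left_inv hp⟩
  rw [(extChartAt I x₀).right_inv hy, coordMetric_apply, coordFrame_components hy,
    coordFrame_components hy]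

theorem coordMetric_pos {x₀ : M} {y : E} (hy : y ∈ (extChartAt I x₀).target) (u : E)
    (hu : u ≠ 0) : 0 < coordMetric I x₀ y u u := by
  rw [coordMetric_apply]
  refine real_inner_self_pos.2 fun h ↦ hu ?_
  rw [← components_coordFrame hy u, h, map_zero]

end

variable (I) [FiniteDimensional ℝ E]

/-- The Christoffel symbols in the preferred chart around `x₀`, as bilinear maps. -/
def christoffelMap (x₀ : M) (y : E) : E →L[ℝ] E →L[ℝ] E :=
  (LinearMap.mk₂ ℝ (christoffel I x₀ y)
    (fun u u' v ↦ by
      rw [christoffel, christoffel, christoffel, ← map_add]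
      congr 1
      ext w
      simp [christoffelFirst]
      ring)
    (fun t u v ↦ by
      rw [christoffel, christoffel, ← map_smul]
      congr 1
      ext w
      simp [christoffelFirst]
      ring)
    (fun u v v' ↦ by
      rw [christoffel, christoffel, christoffel, ← map_add]
      congr 1
      ext w
      simp [christoffelFirst]
      ring)
    (fun t u v ↦ by
      rw [christoffel, christoffel, ← map_smul]
      congr 1
      ext w
      simp [christoffelFirst]
      ring)).toContinuousBilinearMap

theorem christoffelMap_apply (x₀ : M) (y u v : E) :
    christoffelMap I x₀ y u v = christoffel I x₀ y u v := rfl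

variable {I}

variable [I.Boundaryless] [IsManifold I ∞ M]

variable [IsContMDiffRiemannianBundle I ∞ E (fun x : M ↦ TangentSpace I x)]

/-- In finite dimension, smoothness of a bilinear-form-valued map can be tested on fixed vectors,
where it is smoothness of the inner product of two coordinate fields. -/
theorem contDiffOn_coordMetric (x₀ : M) :
    ContDiffOn ℝ ∞ (coordMetric I x₀) (extChartAt I x₀).target := by
  rw [contDiffOn_clm_apply]
  intro u
  rw [contDiffOn_clm_apply]
  intro v y hy
  refine ContDiffAt.contDiffWithinAt ?_
  have hp := (extChartAt I x₀).map_target hy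
  have h := ContMDiffAt.inner_bundle (F := E) (IB := I)
    (E := fun x : M ↦ TangentSpace I x) (b := fun p ↦ p) (smoothFieldAt_coordField hp u)
    (smoothFieldAt_coordField hp v)
  refine (contDiffAt_comp_chart_symm hy h).congr_of_eventuallyEq ?_
  filter_upwards [(isOpen_extChartAt_target x₀).mem_nhds hy] with z hz
  rw [coordMetric_apply, coordField_symm hz, coordField_symm hz]

/-- The symbols are the inverse metric applied to the symbols of the first kind, and inversion is
smooth at a positive definite form. -/
theorem contDiffAt_christoffelMap {x₀ : M} {y : E} (hy : y ∈ (extChartAt I x₀).target) :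
    ContDiffAt ℝ ∞ (christoffelMap I x₀) y := by
  have ho := isOpen_extChartAt_target (I := I) x₀
  have hg : ∀ z ∈ (extChartAt I x₀).target, ContDiffAt ℝ ∞ (coordMetric I x₀) z := fun z hz ↦
    (contDiffOn_coordMetric x₀).contDiffAt (ho.mem_nhds hz)
  have hdg : ∀ u v w, ContDiffOn ℝ ∞ (fun z ↦ fderiv ℝ (coordMetric I x₀) z u v w)
      (extChartAt I x₀).target := by
    intro u v w z hz
    have hs := contDiffOn_clm_apply.1
      (contDiffOn_clm_apply.1 (contDiffOn_coordMetric (I := I) x₀) v) w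
    have h1 := ((hs.contDiffAt (ho.mem_nhds hz)).fderiv_right (m := ∞) (by simp)).clm_apply
      (contDiffAt_const (c := u))
    refine (h1.congr_of_eventuallyEq ?_).contDiffWithinAt
    filter_upwards [ho.mem_nhds hz] with t ht
    exact (fderiv_clm_apply₂_const ((hg t ht).differentiableAt (by simp)) u v w).symm
  suffices ContDiffOn ℝ ∞ (christoffelMap I x₀) (extChartAt I x₀).target from
    this.contDiffAt (ho.mem_nhds hy)
  rw [contDiffOn_clm_apply]
  intro u
  rw [contDiffOn_clm_apply]
  intro v
  have hf : ContDiffOn ℝ ∞ (fun z ↦ christoffelFirst I x₀ z u v) (extChartAt I x₀).target := by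
    rw [contDiffOn_clm_apply]
    intro w
    exact contDiffOn_const.mul (((hdg u v w).add (hdg v u w)).sub (hdg w u v))
  intro z hz
  have hi := (contDiffAt_inverse_of_pos (n := ∞) (coordMetric_pos hz)).comp z (hg z hz)
  exact (hi.clm_apply (hf.contDiffAt (ho.mem_nhds hz))).contDiffWithinAt

/-- In a chart, the Christoffel symbols are those of the Levi-Civita connection. -/
theorem isLeviCivitaOn_coordMetric (x₀ : M) :
    IsLeviCivitaOn (coordMetric I x₀) (christoffelMap I x₀) (extChartAt I x₀).target := by
  have ho := isOpen_extChartAt_target (I := I) x₀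
  have hg : ∀ z ∈ (extChartAt I x₀).target, ContDiffAt ℝ ∞ (coordMetric I x₀) z := fun z hz ↦
    (contDiffOn_coordMetric x₀).contDiffAt (ho.mem_nhds hz)
  have symm : ∀ y u v, coordMetric I x₀ y u v = coordMetric I x₀ y v u := fun y u v ↦ by
    rw [coordMetric_apply, coordMetric_apply, real_inner_comm]
  have dsymm : ∀ y ∈ (extChartAt I x₀).target, ∀ u v w, fderiv ℝ (coordMetric I x₀) y u v w
      = fderiv ℝ (coordMetric I x₀) y u w v := by
    intro y hy u v w
    have hd : DifferentiableAt ℝ (coordMetric I x₀) y := (hg y hy).differentiableAt (by simp)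
    rw [← fderiv_clm_apply₂_const hd, ← fderiv_clm_apply₂_const hd]
    simp_rw [symm _ v w]
  -- Koszul's formula. Metric compatibility is the sum of two instances of it, and symmetry is
  -- visible from its right-hand side.
  have first : ∀ y ∈ (extChartAt I x₀).target, ∀ u v w,
      2 * coordMetric I x₀ y (christoffelMap I x₀ y u v) w = fderiv ℝ (coordMetric I x₀) y u v w
        + fderiv ℝ (coordMetric I x₀) y v u w - fderiv ℝ (coordMetric I x₀) y w u v := by
    intro y hy u v w
    rw [christoffelMap_apply, christoffel, apply_inverse_of_pos (coordMetric_pos hy)]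
    simp [christoffelFirst]
  refine ⟨ho, hg, fun y hy ↦ contDiffAt_christoffelMap hy, fun y _ ↦ symm y,
    fun y hy ↦ coordMetric_pos hy, ?_, ?_⟩
  · intro y hy u v
    rw [christoffelMap_apply, christoffelMap_apply, christoffel, christoffel]
    congr 1
    ext w
    have := dsymm y hy w u v
    simp [christoffelFirst, this]
    ring
  · intro y hy u v w
    have f1 := first y hy u v w
    have f2 := first y hy u w v
    rw [symm] at f2
    have d1 := dsymm y hy u v w
    have d2 := dsymm y hy v u w
    have d3 := dsymm y hy w u v
    linarith

theorem coordCurvature_eq (x₀ : M) {y : E} (hy : y ∈ (extChartAt I x₀).target) (u v w : E) :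
    coordCurvature I x₀ y u v w = curvatureOf (christoffelMap I x₀) y u v w := by
  have hd : DifferentiableAt ℝ (christoffelMap I x₀) y :=
    (contDiffAt_christoffelMap hy).differentiableAt (by simp)
  have e : ∀ a b c, fderiv ℝ (fun z ↦ christoffel I x₀ z a b) y c
      = fderiv ℝ (christoffelMap I x₀) y c a b := fun a b c ↦ fderiv_clm_apply₂_const hd c a b
  rw [coordCurvature, curvatureOf, e, e]
  rfl

end RiemannianCharts

/-! ### Cosymplectic structures in charts -/

section CosymplecticCharts

variable {E : Type*} [NormedAddCommGroup E] [NormedSpace ℝ E]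
  {H : Type*} [TopologicalSpace H] {I : ModelWithCorners ℝ E H}
  {M : Type*} [TopologicalSpace M] [ChartedSpace H M] [IsManifold I ∞ M]
  [RiemannianBundle (fun x : M ↦ TangentSpace I x)]

namespace AlmostContactMetric

/-- The components of `φ` in the preferred chart around `x₀`. -/
def coordφ (S : AlmostContactMetric I M) (x₀ : M) (y : E) : E →L[ℝ] E :=
  (components I x₀ ((extChartAt I x₀).symm y)).comp
    ((S.φ ((extChartAt I x₀).symm y)).comp (coordFrame I x₀ y))

/-- The components of `ξ` in the preferred chart around `x₀`. -/
def coordξ (S : AlmostContactMetric I M) (x₀ : M) (y : E) : E :=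
  components I x₀ ((extChartAt I x₀).symm y) (S.ξ ((extChartAt I x₀).symm y))

/-- The components of `η` in the preferred chart around `x₀`. -/
def coordη (S : AlmostContactMetric I M) (x₀ : M) (y : E) : E →L[ℝ] ℝ :=
  (S.η ((extChartAt I x₀).symm y)).comp (coordFrame I x₀ y)

theorem coordφ_apply (S : AlmostContactMetric I M) (x₀ : M) (y u : E) :
    S.coordφ x₀ y u = components I x₀ ((extChartAt I x₀).symm y)
      (S.φ ((extChartAt I x₀).symm y) (coordFrame I x₀ y u)) := rfl

theorem coordη_apply (S : AlmostContactMetric I M) (x₀ : M) (y u : E) :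
    S.coordη x₀ y u = S.η ((extChartAt I x₀).symm y) (coordFrame I x₀ y u) := rfl

theorem smoothFieldAt_φ (S : AlmostContactMetric I M) {X : ∀ p : M, TangentSpace I p} {p : M}
    (hX : SmoothFieldAt X p) : SmoothFieldAt (fun p ↦ S.φ p (X p)) p :=
  ContMDiffAt.clm_bundle_apply (F₁ := E) (F₂ := E) (IB := I) (E₁ := fun x : M ↦ TangentSpace I x)
    (E₂ := fun x : M ↦ TangentSpace I x) (b := fun p ↦ p) (ϕ := S.φ) (v := X)
    (S.contMDiff_φ p) hX

theorem contMDiffAt_η (S : AlmostContactMetric I M) {X : ∀ p : M, TangentSpace I p} {p : M}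
    (hX : SmoothFieldAt X p) : ContMDiffAt I 𝓘(ℝ, ℝ) ∞ (fun p ↦ S.η p (X p)) p := by
  have h := ContMDiffAt.clm_bundle_apply (F₁ := E) (F₂ := ℝ) (IB := I)
    (E₁ := fun x : M ↦ TangentSpace I x)
    (E₂ := Trivial M ℝ) (b := fun p ↦ p) (ϕ := S.η) (v := X) (S.contMDiff_η p) hX
  rw [contMDiffAt_totalSpace] at h
  exact h.2

theorem components_ξ (S : AlmostContactMetric I M) {x₀ p : M} (hp : p ∈ (extChartAt I x₀).source) :
    components I x₀ p (S.ξ p) = S.coordξ x₀ (extChartAt I x₀ p) := by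
  obtain ⟨y, hy, rfl⟩ : ∃ y ∈ (extChartAt I x₀).target, (extChartAt I x₀).symm y = p :=
    ⟨_, (extChartAt I x₀).map_source hp, (extChartAt I x₀).left_inv hp⟩
  rw [(extChartAt I x₀).right_inv hy, coordξ]

variable [I.Boundaryless] (S : AlmostContactMetric I M) {x₀ : M} {y : E}

theorem coordFrame_coordφ (hy : y ∈ (extChartAt I x₀).target) (u : E) :
    coordFrame I x₀ y (S.coordφ x₀ y u)
      = S.φ ((extChartAt I x₀).symm y) (coordFrame I x₀ y u) :=
  coordFrame_components hy _

theorem coordFrame_coordξ (hy : y ∈ (extChartAt I x₀).target) :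
    coordFrame I x₀ y (S.coordξ x₀ y) = S.ξ ((extChartAt I x₀).symm y) :=
  coordFrame_components hy _

theorem components_φ {p : M} (hp : p ∈ (extChartAt I x₀).source) (a : TangentSpace I p) :
    components I x₀ p (S.φ p a) = S.coordφ x₀ (extChartAt I x₀ p) (components I x₀ p a) := by
  obtain ⟨y, hy, rfl⟩ : ∃ y ∈ (extChartAt I x₀).target, (extChartAt I x₀).symm y = p :=
    ⟨_, (extChartAt I x₀).map_source hp, (extChartAt I x₀).left_inv hp⟩
  rw [(extChartAt I x₀).right_inv hy, coordφ_apply, coordFrame_components hy]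

theorem contDiffAt_coordξ (hy : y ∈ (extChartAt I x₀).target) :
    ContDiffAt ℝ ∞ (S.coordξ x₀) y :=
  contDiffAt_components hy (S.contMDiff_ξ _)

variable [FiniteDimensional ℝ E]

theorem contDiffAt_coordφ (hy : y ∈ (extChartAt I x₀).target) :
    ContDiffAt ℝ ∞ (S.coordφ x₀) y := by
  have ho := isOpen_extChartAt_target (I := I) x₀
  suffices ContDiffOn ℝ ∞ (S.coordφ x₀) (extChartAt I x₀).target from
    this.contDiffAt (ho.mem_nhds hy)
  rw [contDiffOn_clm_apply]
  intro u z hz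
  have h := contDiffAt_components hz
    (S.smoothFieldAt_φ (smoothFieldAt_coordField ((extChartAt I x₀).map_target hz) u))
  refine (h.congr_of_eventuallyEq ?_).contDiffWithinAt
  filter_upwards [ho.mem_nhds hz] with t ht
  rw [coordφ_apply, coordField_symm ht]

theorem contDiffAt_coordη (hy : y ∈ (extChartAt I x₀).target) :
    ContDiffAt ℝ ∞ (S.coordη x₀) y := by
  have ho := isOpen_extChartAt_target (I := I) x₀
  suffices ContDiffOn ℝ ∞ (S.coordη x₀) (extChartAt I x₀).target from
    this.contDiffAt (ho.mem_nhds hy)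
  rw [contDiffOn_clm_apply]
  intro u z hz
  have h := contDiffAt_comp_chart_symm hz
    (S.contMDiffAt_η (smoothFieldAt_coordField ((extChartAt I x₀).map_target hz) u))
  refine (h.congr_of_eventuallyEq ?_).contDiffWithinAt
  filter_upwards [ho.mem_nhds hz] with t ht
  rw [coordη_apply, coordField_symm ht]

/-- The bracket of coordinate fields is zero, so only the antisymmetrized derivative of the
components of `η` remains. -/
theorem dEta_coordField (hy : y ∈ (extChartAt I x₀).target) (u v : E) :
    S.dEta (coordField I x₀ u) (coordField I x₀ v) ((extChartAt I x₀).symm y)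
      = fderiv ℝ (S.coordη x₀) y u v - fderiv ℝ (S.coordη x₀) y v u := by
  have ho := isOpen_extChartAt_target (I := I) x₀
  have hp := (extChartAt I x₀).map_target hy
  have hd : DifferentiableAt ℝ (S.coordη x₀) y :=
    (S.contDiffAt_coordη hy).differentiableAt (by simp)
  have key : ∀ u v : E, mvfderiv I (fun z ↦ S.η z (coordField I x₀ v z))
      ((extChartAt I x₀).symm y) (coordFrame I x₀ y u) = fderiv ℝ (S.coordη x₀) y u v := by
    intro u v
    rw [mvfderiv_coordFrame hy (S.contMDiffAt_η (smoothFieldAt_coordField hp v))]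
    have e : (fun y ↦ S.η ((extChartAt I x₀).symm y)
        (coordField I x₀ v ((extChartAt I x₀).symm y))) =ᶠ[nhds y] fun y ↦ S.coordη x₀ y v := by
      filter_upwards [ho.mem_nhds hy] with t ht
      rw [coordη_apply, coordField_symm ht]
    rw [e.fderiv_eq (𝕜 := ℝ)]
    have h1 := (hd.hasFDerivAt.clm_apply (hasFDerivAt_const v y)).fderiv
    rw [h1]
    simp
  have : CompleteSpace E := FiniteDimensional.complete ℝ E
  rw [dEta, mlieBracket_coordField hy, coordField_symm hy, coordField_symm hy, key, key,
    map_zero, sub_zero]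

/-- In the brackets with `φ∂_u` or `φ∂_v` only derivatives of the components of `φ` appear, the
coordinate fields having constant components. -/
theorem nijenhuis_coordField (hy : y ∈ (extChartAt I x₀).target) (u v : E) :
    S.nijenhuis (coordField I x₀ u) (coordField I x₀ v) ((extChartAt I x₀).symm y)
      = coordFrame I x₀ y (fderiv ℝ (S.coordφ x₀) y (S.coordφ x₀ y u) v
          - fderiv ℝ (S.coordφ x₀) y (S.coordφ x₀ y v) u
          + S.coordφ x₀ y (fderiv ℝ (S.coordφ x₀) y v u)
          - S.coordφ x₀ y (fderiv ℝ (S.coordφ x₀) y u v)) := by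
  have : CompleteSpace E := FiniteDimensional.complete ℝ E
  have hp := (extChartAt I x₀).map_target hy
  have hd : DifferentiableAt ℝ (S.coordφ x₀) y :=
    (S.contDiffAt_coordφ hy).differentiableAt (by simp)
  have hf : ∀ u, SmoothFieldAt (coordField I x₀ u) ((extChartAt I x₀).symm y) := fun u ↦
    smoothFieldAt_coordField hp u
  have hc : ∀ u : E, ∀ z ∈ (extChartAt I x₀).target, components I x₀ ((extChartAt I x₀).symm z)
      (coordField I x₀ u ((extChartAt I x₀).symm z)) = (fun _ : E ↦ u) z := fun u z hz ↦ by
    rw [coordField_symm hz, components_coordFrame hz]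
  have hcφ : ∀ u : E, ∀ z ∈ (extChartAt I x₀).target, components I x₀ ((extChartAt I x₀).symm z)
      (S.φ ((extChartAt I x₀).symm z) (coordField I x₀ u ((extChartAt I x₀).symm z)))
        = (fun z ↦ S.coordφ x₀ z u) z := fun u z hz ↦ by
    rw [coordField_symm hz]
    rfl
  have e : ∀ a b, fderiv ℝ (fun z ↦ S.coordφ x₀ z a) y b = fderiv ℝ (S.coordφ x₀) y b a := by
    intro a b
    have h1 := (hd.hasFDerivAt.clm_apply (hasFDerivAt_const a y)).fderiv
    rw [h1]
    simp
  rw [nijenhuis, mlieBracket_coordField hy,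
    mlieBracket_chart_symm hy (S.smoothFieldAt_φ (hf u)) (S.smoothFieldAt_φ (hf v)) (hcφ u) (hcφ v),
    mlieBracket_chart_symm hy (S.smoothFieldAt_φ (hf u)) (hf v) (hcφ u) (hc v),
    mlieBracket_chart_symm hy (hf u) (S.smoothFieldAt_φ (hf v)) (hc u) (hcφ v)]
  simp only [e, ← S.coordFrame_coordφ hy, fderiv_fun_const, Pi.zero_apply, zero_apply, map_zero,
    zero_sub, sub_zero, zero_add, map_sub, map_add, map_neg]
  abel

variable [IsContMDiffRiemannianBundle I ∞ E (fun x : M ↦ TangentSpace I x)]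

theorem dPhi_coordField (hy : y ∈ (extChartAt I x₀).target) (u v w : E) :
    S.dPhi (coordField I x₀ u) (coordField I x₀ v) (coordField I x₀ w)
        ((extChartAt I x₀).symm y)
      = fderiv ℝ (fun y ↦ coordMetric I x₀ y v (S.coordφ x₀ y w)) y u
        + fderiv ℝ (fun y ↦ coordMetric I x₀ y w (S.coordφ x₀ y u)) y v
        + fderiv ℝ (fun y ↦ coordMetric I x₀ y u (S.coordφ x₀ y v)) y w := by
  have ho := isOpen_extChartAt_target (I := I) x₀
  have hp := (extChartAt I x₀).map_target hy
  have h0 : ∀ (p : M) (a : TangentSpace I p), S.fundamentalForm p 0 a = 0 := fun p a ↦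
    inner_zero_left _
  have key : ∀ u v w : E, mvfderiv I
      (fun z ↦ S.fundamentalForm z (coordField I x₀ v z) (coordField I x₀ w z))
      ((extChartAt I x₀).symm y) (coordFrame I x₀ y u)
        = fderiv ℝ (fun y ↦ coordMetric I x₀ y v (S.coordφ x₀ y w)) y u := by
    intro u v w
    have hs : ContMDiffAt I 𝓘(ℝ, ℝ) ∞
        (fun z ↦ S.fundamentalForm z (coordField I x₀ v z) (coordField I x₀ w z))
        ((extChartAt I x₀).symm y) :=
      ContMDiffAt.inner_bundle (F := E) (IB := I)
        (E := fun x : M ↦ TangentSpace I x) (b := fun p ↦ p) (smoothFieldAt_coordField hp v)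
        (S.smoothFieldAt_φ (smoothFieldAt_coordField hp w))
    rw [mvfderiv_coordFrame hy hs]
    refine congrArg (fun L : E →L[ℝ] ℝ ↦ L u) (Filter.EventuallyEq.fderiv_eq (𝕜 := ℝ) ?_)
    filter_upwards [ho.mem_nhds hy] with t ht
    rw [fundamentalForm, coordMetric_apply, coordField_symm ht, coordField_symm ht,
      S.coordFrame_coordφ ht]
  have : CompleteSpace E := FiniteDimensional.complete ℝ E
  rw [dPhi, mlieBracket_coordField hy, mlieBracket_coordField hy, mlieBracket_coordField hy,
    coordField_symm hy, coordField_symm hy, coordField_symm hy, key, key, key, h0, h0, h0,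
    sub_zero, sub_zero, sub_zero]

/-- The conditions on arbitrary fields are tested on coordinate fields, where they become the
component identities. -/
theorem isCosymplecticOn (hS : S.IsCosymplectic) (x₀ : M) :
    IsCosymplecticOn (coordMetric I x₀) (christoffelMap I x₀) (S.coordφ x₀) (S.coordξ x₀)
      (S.coordη x₀) (extChartAt I x₀).target where
  toIsLeviCivitaOn := isLeviCivitaOn_coordMetric x₀
  smooth_φ y hy := S.contDiffAt_coordφ hy
  smooth_ξ y hy := S.contDiffAt_coordξ hy
  smooth_η y hy := S.contDiffAt_coordη hy
  φ_φ y hy u := by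
    rw [coordφ_apply, S.coordFrame_coordφ hy, S.φ_φ, map_add, map_neg, components_coordFrame hy,
      map_smul]
    rfl
  η_ξ y hy := by rw [coordη_apply, S.coordFrame_coordξ hy, S.η_ξ]
  metric_φ_φ y hy u v := by
    rw [coordMetric_apply, S.coordFrame_coordφ hy, S.coordFrame_coordφ hy, S.compatible]
    rfl
  closed_η y hy u v := by
    have hp := (extChartAt I x₀).map_target hy
    have h := hS.1.1 _ _ _ (smoothFieldAt_coordField hp u) (smoothFieldAt_coordField hp v)
    rw [S.dEta_coordField hy] at h
    exact sub_eq_zero.1 h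
  closed_form y hy u v w := by
    have hp := (extChartAt I x₀).map_target hy
    rw [← S.dPhi_coordField hy]
    exact hS.1.2 _ _ _ _ (smoothFieldAt_coordField hp u) (smoothFieldAt_coordField hp v)
      (smoothFieldAt_coordField hp w)
  normal y hy u v := by
    have hp := (extChartAt I x₀).map_target hy
    have h := hS.2 _ _ _ (smoothFieldAt_coordField hp u) (smoothFieldAt_coordField hp v)
    rw [hS.1.1 _ _ _ (smoothFieldAt_coordField hp u) (smoothFieldAt_coordField hp v), zero_smul,
      add_zero, S.nijenhuis_coordField hy] at h
    have h' := congrArg (components I x₀ ((extChartAt I x₀).symm y)) h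
    rwa [components_coordFrame hy, map_zero] at h'

end AlmostContactMetric

end CosymplecticCharts

/-! ### Immersions and their second fundamental forms in charts -/

section MapsInCharts

variable {E : Type*} [NormedAddCommGroup E] [NormedSpace ℝ E]
  {H : Type*} [TopologicalSpace H] {I : ModelWithCorners ℝ E H}
  {M : Type*} [TopologicalSpace M] [ChartedSpace H M]
  {E' : Type*} [NormedAddCommGroup E'] [NormedSpace ℝ E']
  {H' : Type*} [TopologicalSpace H'] {J : ModelWithCorners ℝ E' H'}
  {N : Type*} [TopologicalSpace N] [ChartedSpace H' N]

theorem writtenInExtChartAt_self (F : M → N) (x : M) :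
    writtenInExtChartAt I J x F (extChartAt I x x) = extChartAt J (F x) (F x) := by
  simp [writtenInExtChartAt]

theorem sff_eq [FiniteDimensional ℝ E'] [RiemannianBundle (fun x : N ↦ TangentSpace J x)]
    (F : M → N) (x : M) (u v : TangentSpace I x) :
    sff I J F x u v = (tangentImage I J F x)ᗮ.starProjection (ofCoord J (F x)
      (secondDeriv (christoffelMap J (F x)) (writtenInExtChartAt I J x F) (extChartAt I x x)
        (toCoord I x u) (toCoord I x v))) := by
  rw [secondDeriv, writtenInExtChartAt_self]
  rfl

variable (I J) in
/-- The components of the second fundamental form, as a bilinear map. -/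
def coordSff [FiniteDimensional ℝ E'] [RiemannianBundle (fun x : N ↦ TangentSpace J x)]
    (F : M → N) (x : M) : E →ₗ[ℝ] E →ₗ[ℝ] E' :=
  LinearMap.mk₂ ℝ (fun u v ↦ toCoord J (F x) (sff I J F x (ofCoord I x u) (ofCoord I x v)))
    (fun u u' v ↦ by
      rw [← map_add, sff_eq, sff_eq, sff_eq, ← map_add, ← map_add]
      simp only [map_add, secondDeriv, add_apply]
      abel_nf)
    (fun t u v ↦ by
      rw [← map_smul, sff_eq, sff_eq, ← map_smul, ← map_smul]
      simp only [map_smul, secondDeriv, smul_apply, smul_add])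
    (fun u v v' ↦ by
      rw [← map_add, sff_eq, sff_eq, sff_eq, ← map_add, ← map_add]
      simp only [map_add, secondDeriv]
      abel_nf)
    (fun t u v ↦ by
      rw [← map_smul, sff_eq, sff_eq, ← map_smul, ← map_smul]
      simp only [map_smul, secondDeriv, smul_add])

theorem coordSff_apply [FiniteDimensional ℝ E']
    [RiemannianBundle (fun x : N ↦ TangentSpace J x)] (F : M → N) (x : M) (u v : E) :
    coordSff I J F x u v = toCoord J (F x) (sff I J F x (ofCoord I x u) (ofCoord I x v)) := rfl

variable [IsManifold I ∞ M]

/-- At its own base point the preferred chart has differential the identity, since the tangent space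
is modelled on that chart. Hence `toCoord` and `ofCoord` are inverse to each other. -/
theorem toCoord_eq_refl (x : M) :
    toCoord I x = (ContinuousLinearEquiv.refl ℝ E : E →L[ℝ] E) := by
  have : IsManifold I 1 M := .of_le (n := ∞) (by simp)
  have h := mfderiv_extChartAt_self (I := I) (x := x)
  ext u
  exact congrArg (fun L ↦ L u) h

theorem toCoord_ofCoord (x : M) (u : E) : toCoord I x (ofCoord I x u) = u := by
  have h : ofCoord I x = (ContinuousLinearEquiv.refl ℝ E : E →L[ℝ] E) := by
    rw [ofCoord, toCoord_eq_refl]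
    exact ContinuousLinearMap.inverse_equiv _
  rw [h, toCoord_eq_refl]
  rfl

theorem ofCoord_toCoord (x : M) (a : TangentSpace I x) : ofCoord I x (toCoord I x a) = a := by
  have h : ofCoord I x = (ContinuousLinearEquiv.refl ℝ E : E →L[ℝ] E) := by
    rw [ofCoord, toCoord_eq_refl]
    exact ContinuousLinearMap.inverse_equiv _
  rw [h, toCoord_eq_refl]
  rfl

theorem toCoord_sff [FiniteDimensional ℝ E'] [RiemannianBundle (fun x : N ↦ TangentSpace J x)]
    (F : M → N) (x : M) (a b : TangentSpace I x) :
    toCoord J (F x) (sff I J F x a b)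
      = coordSff I J F x (toCoord I x a) (toCoord I x b) := by
  rw [coordSff_apply, ofCoord_toCoord, ofCoord_toCoord]

theorem inner_eq_coordMetric_self [IsManifold J ∞ N] [J.Boundaryless]
    [RiemannianBundle (fun x : N ↦ TangentSpace J x)] (y : N) (a b : TangentSpace J y) :
    inner ℝ a b = coordMetric J y (extChartAt J y y) (toCoord J y a) (toCoord J y b) :=
  inner_eq_coordMetric (mem_extChartAt_source y) a b

theorem norm_sff_sq [IsManifold J ∞ N] [J.Boundaryless] [FiniteDimensional ℝ E']
    [RiemannianBundle (fun x : N ↦ TangentSpace J x)] (F : M → N) (x : M) (a b : TangentSpace I x) :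
    ‖sff I J F x a b‖ ^ 2 = coordMetric J (F x) (extChartAt J (F x) (F x))
      (coordSff I J F x (toCoord I x a) (toCoord I x b))
      (coordSff I J F x (toCoord I x a) (toCoord I x b)) := by
  rw [← toCoord_sff, ← inner_eq_coordMetric_self, real_inner_self_eq_norm_sq]

variable [IsManifold J ∞ N] [I.Boundaryless]

theorem components_mfderiv {F : M → N} {x₀ p : M} {y₀ : N} (hF : MDifferentiableAt I J F p)
    (hp : p ∈ (extChartAt I x₀).source) (hFp : F p ∈ (extChartAt J y₀).source)
    (a : TangentSpace I p) :
    components J y₀ (F p) (mfderiv I J F p a)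
      = fderiv ℝ (extChartAt J y₀ ∘ F ∘ (extChartAt I x₀).symm) (extChartAt I x₀ p)
        (components I x₀ p a) := by
  obtain ⟨y, hy, rfl⟩ : ∃ y ∈ (extChartAt I x₀).target, (extChartAt I x₀).symm y = p :=
    ⟨_, (extChartAt I x₀).map_source hp, (extChartAt I x₀).left_inv hp⟩
  obtain ⟨u, rfl⟩ : ∃ u, coordFrame I x₀ y u = a := ⟨_, coordFrame_components hy a⟩
  rw [(extChartAt I x₀).right_inv hy, components_coordFrame hy]
  have h1 := mfderiv_comp y hF (mdifferentiableAt_chart_symm hy)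
  have h2 := mfderiv_comp y (mdifferentiableAt_chart hFp)
    (hF.comp y (mdifferentiableAt_chart_symm hy))
  rw [h1, mfderiv_eq_fderiv] at h2
  exact (congrArg (fun L ↦ L u) h2).symm

theorem toCoord_mfderiv {F : M → N} {x : M} (hF : MDifferentiableAt I J F x)
    (a : TangentSpace I x) :
    toCoord J (F x) (mfderiv I J F x a)
      = fderiv ℝ (writtenInExtChartAt I J x F) (extChartAt I x x) (toCoord I x a) :=
  components_mfderiv hF (mem_extChartAt_source x) (mem_extChartAt_source _) a

theorem contDiffAt_writtenInCharts {F : M → N} (hF : ContMDiff I J ∞ F) {x₀ : M} {y₀ : N} {y : E}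
    (hy : y ∈ (extChartAt I x₀).target)
    (hFy : F ((extChartAt I x₀).symm y) ∈ (extChartAt J y₀).source) :
    ContDiffAt ℝ ∞ (extChartAt J y₀ ∘ F ∘ (extChartAt I x₀).symm) y := by
  have h1 : ContMDiffAt J 𝓘(ℝ, E') ∞ (extChartAt J y₀) (F ((extChartAt I x₀).symm y)) :=
    contMDiffAt_extChartAt' (by rwa [← extChartAt_source J])
  exact (h1.comp y ((hF _).comp y (contMDiffAt_chart_symm hy))).contDiffAt

section SecondFundamentalForm

variable [J.Boundaryless] [RiemannianBundle (fun x : N ↦ TangentSpace J x)]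

variable [FiniteDimensional ℝ E']

theorem isNormalPart_sff {F : M → N} (hF : ContMDiff I J ∞ F) (x : M) :
    IsNormalPart (coordMetric J (F x)) (christoffelMap J (F x)) (writtenInExtChartAt I J x F)
      (extChartAt I x x)
      (fun u v ↦ coordSff I J F x u v) where
  normal u v w := by
    have hd : MDifferentiableAt I J F x := (hF x).mdifferentiableAt (by simp)
    rw [coordSff_apply, writtenInExtChartAt_self, ← toCoord_ofCoord (I := I) x w,
      ← toCoord_mfderiv hd,
      ← inner_eq_coordMetric_self, sff_eq, real_inner_comm]
    exact Submodule.inner_right_of_mem_orthogonal (K := tangentImage I J F x)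
      ⟨ofCoord I x w, rfl⟩ (Submodule.starProjection_apply_mem _ _)
  tangent u v := by
    have hd : MDifferentiableAt I J F x := (hF x).mdifferentiableAt (by simp)
    set W := secondDeriv (christoffelMap J (F x)) (writtenInExtChartAt I J x F) (extChartAt I x x)
      u v
    have hW := Submodule.starProjection_add_starProjection_orthogonal
      (K := tangentImage I J F x) (ofCoord J (F x) W)
    obtain ⟨a, ha⟩ := Submodule.starProjection_apply_mem (𝕜 := ℝ) (tangentImage I J F x)
      (ofCoord J (F x) W)
    refine ⟨toCoord I x a, ?_⟩
    rw [coordSff_apply, ← toCoord_mfderiv hd, sff_eq, toCoord_ofCoord, toCoord_ofCoord, ← map_add]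
    have ha' : mfderiv I J F x a = (tangentImage I J F x).starProjection (ofCoord J (F x) W) := ha
    rw [ha', add_comm, hW, toCoord_ofCoord]

theorem coordSff_symm [IsContMDiffRiemannianBundle J ∞ E' (fun x : N ↦ TangentSpace J x)]
    {F : M → N} (hF : ContMDiff I J ∞ F) (x : M) (u v : E) :
    coordSff I J F x u v = coordSff I J F x v u := by
  have hj : ContDiffAt ℝ 2 (writtenInExtChartAt I J x F) (extChartAt I x x) :=
    (contDiffAt_writtenInCharts hF (mem_extChartAt_target x) (by simp)).of_le ENat.LEInfty.out
  rw [coordSff_apply, coordSff_apply, sff_eq, sff_eq, secondDeriv_symm hj]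
  rw [writtenInExtChartAt_self]
  exact (isLeviCivitaOn_coordMetric (F x)).christoffel_symm _ (mem_extChartAt_target (F x))

end SecondFundamentalForm

end MapsInCharts

/-! ### Contact CR-warped products in charts -/

section WarpedProductInCharts

variable {E : Type*} [NormedAddCommGroup E] [NormedSpace ℝ E]
  {H : Type*} [TopologicalSpace H] {J : ModelWithCorners ℝ E H}
  {N : Type*} [TopologicalSpace N] [ChartedSpace H N]
  {E₁ : Type*} [NormedAddCommGroup E₁] [NormedSpace ℝ E₁]
  {H₁ : Type*} [TopologicalSpace H₁] {I₁ : ModelWithCorners ℝ E₁ H₁}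
  {M₁ : Type*} [TopologicalSpace M₁] [ChartedSpace H₁ M₁]
  {E₂ : Type*} [NormedAddCommGroup E₂] [NormedSpace ℝ E₂]
  {H₂ : Type*} [TopologicalSpace H₂] {I₂ : ModelWithCorners ℝ E₂ H₂}
  {M₂ : Type*} [TopologicalSpace M₂] [ChartedSpace H₂ M₂]

theorem extChartAt_prod_symm_apply (x : M₁ × M₂) (z : E₁ × E₂) :
    (extChartAt (I₁.prod I₂) x).symm z
      = ((extChartAt I₁ x.1).symm z.1, (extChartAt I₂ x.2).symm z.2) := by
  rw [extChartAt_prod]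
  rfl

theorem mem_extChartAt_prod_target {x : M₁ × M₂} {z : E₁ × E₂} :
    z ∈ (extChartAt (I₁.prod I₂) x).target
      ↔ z.1 ∈ (extChartAt I₁ x.1).target ∧ z.2 ∈ (extChartAt I₂ x.2).target := by
  rw [extChartAt_prod]
  rfl

theorem extChartAt_prod_apply (x p : M₁ × M₂) :
    extChartAt (I₁.prod I₂) x p = (extChartAt I₁ x.1 p.1, extChartAt I₂ x.2 p.2) := by
  rw [extChartAt_prod]
  rfl

/-- The part of the chart around `x` that `ι` maps into the chart around `ι x`. -/
def chartDomain (I : ModelWithCorners ℝ E₁ H₁) (J : ModelWithCorners ℝ E H) (ι : M₁ → N) (x : M₁) :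
    Set E₁ :=
  (extChartAt I x).target ∩ (extChartAt I x).symm ⁻¹' (ι ⁻¹' (extChartAt J (ι x)).source)

theorem isOpen_chartDomain [I₁.Boundaryless] {ι : M₁ → N} (hι : Continuous ι) (x : M₁) :
    IsOpen (chartDomain I₁ J ι x) :=
  (continuousOn_extChartAt_symm x).isOpen_inter_preimage (isOpen_extChartAt_target x)
    ((isOpen_extChartAt_source (ι x)).preimage hι)

theorem mem_chartDomain (ι : M₁ → N) (x : M₁) :
    extChartAt I₁ x x ∈ chartDomain I₁ J ι x :=
  ⟨mem_extChartAt_target x, by simp⟩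

/-- The restrictions of a map of two variables have the partial derivatives as derivatives. -/
theorem fderiv_mk_left {j : E₁ × E₂ → E} {z : E₁ × E₂} (hj : DifferentiableAt ℝ j z) (u : E₁) :
    fderiv ℝ (fun t ↦ j (t, z.2)) z.1 u = fderiv ℝ j z (u, 0) := by
  have h := (HasFDerivAt.comp (x := z.1) (g := j) (f := fun t : E₁ ↦ (t, z.2)) hj.hasFDerivAt
    (hasFDerivAt_prodMk_left z.1 z.2)).fderiv
  rw [Function.comp_def] at h
  rw [h]
  rfl

theorem fderiv_mk_right {j : E₁ × E₂ → E} {z : E₁ × E₂} (hj : DifferentiableAt ℝ j z) (v : E₂) :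
    fderiv ℝ (fun t ↦ j (z.1, t)) z.2 v = fderiv ℝ j z (0, v) := by
  have h := (HasFDerivAt.comp (x := z.2) (g := j) (f := fun t : E₂ ↦ (z.1, t)) hj.hasFDerivAt
    (hasFDerivAt_prodMk_right z.1 z.2)).fderiv
  rw [Function.comp_def] at h
  rw [h]
  rfl

theorem writtenInExtChartAt_prod_apply (ι : M₁ × M₂ → N) (x : M₁ × M₂) (z : E₁ × E₂) :
    writtenInExtChartAt (I₁.prod I₂) J x ι z = extChartAt J (ι x)
      (ι ((extChartAt I₁ x.1).symm z.1, (extChartAt I₂ x.2).symm z.2)) := by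
  rw [writtenInExtChartAt, Function.comp_apply, Function.comp_apply, extChartAt_prod_symm_apply]

/-- The preferred chart of a product is the product of the preferred charts, so a leaf in
coordinates is a slice of `ι` in coordinates. -/
theorem writtenInExtChartAt_leaf₁ (ι : M₁ × M₂ → N) (x : M₁ × M₂) :
    writtenInExtChartAt I₁ J x.1 (fun a ↦ ι (a, x.2)) = fun t ↦
      writtenInExtChartAt (I₁.prod I₂) J x ι (t, (extChartAt (I₁.prod I₂) x x).2) := by
  funext t
  rw [writtenInExtChartAt_prod_apply, extChartAt_prod_apply, extChartAt_to_inv]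
  rfl

theorem writtenInExtChartAt_leaf₂ (ι : M₁ × M₂ → N) (x : M₁ × M₂) :
    writtenInExtChartAt I₂ J x.2 (fun b ↦ ι (x.1, b)) = fun t ↦
      writtenInExtChartAt (I₁.prod I₂) J x ι ((extChartAt (I₁.prod I₂) x x).1, t) := by
  funext t
  rw [writtenInExtChartAt_prod_apply, extChartAt_prod_apply, extChartAt_to_inv]
  rfl

theorem image_mem_of_mem_chartDomain {ι : M₁ × M₂ → N} {x : M₁ × M₂} {z : E₁ × E₂}
    (hz : z ∈ chartDomain (I₁.prod I₂) J ι x) :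
    ι ((extChartAt I₁ x.1).symm z.1, (extChartAt I₂ x.2).symm z.2)
      ∈ (extChartAt J (ι x)).source := by
  rw [← extChartAt_prod_symm_apply]
  exact hz.2

section

variable [IsManifold J ∞ N] [RiemannianBundle (fun x : N ↦ TangentSpace J x)]
  [RiemannianBundle (fun x : M₁ ↦ TangentSpace I₁ x)]
  [RiemannianBundle (fun x : M₂ ↦ TangentSpace I₂ x)]
  {S : AlmostContactMetric J N} {f : M₁ → ℝ} {ι : M₁ × M₂ → N}

theorem IsContactCRWarpedProduct.smooth_leaf₁ (hι : IsContactCRWarpedProduct I₁ I₂ S f ι) (b : M₂) :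
    ContMDiff I₁ J ∞ (fun a ↦ ι (a, b)) :=
  hι.smooth_ι.comp (contMDiff_id.prodMk contMDiff_const)

theorem IsContactCRWarpedProduct.smooth_leaf₂ (hι : IsContactCRWarpedProduct I₁ I₂ S f ι) (a : M₁) :
    ContMDiff I₂ J ∞ (fun b ↦ ι (a, b)) :=
  hι.smooth_ι.comp (contMDiff_const.prodMk contMDiff_id)

end

variable [I₁.Boundaryless] [IsManifold I₁ ∞ M₁] [I₂.Boundaryless] [IsManifold I₂ ∞ M₂]

theorem components_fst {x p : M₁ × M₂} (hp : p ∈ (extChartAt (I₁.prod I₂) x).source)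
    (a : TangentSpace (I₁.prod I₂) p) :
    components I₁ x.1 p.1 (mfderiv (I₁.prod I₂) I₁ Prod.fst p a)
      = (components (I₁.prod I₂) x p a).1 := by
  have hp' := hp
  rw [extChartAt_prod] at hp'
  rw [components_mfderiv mdifferentiableAt_fst hp hp'.1]
  have e : (extChartAt I₁ x.1 ∘ Prod.fst ∘ (extChartAt (I₁.prod I₂) x).symm)
      =ᶠ[nhds (extChartAt (I₁.prod I₂) x p)] Prod.fst := by
    filter_upwards [(isOpen_extChartAt_target x).mem_nhds
      ((extChartAt (I₁.prod I₂) x).map_source hp)] with z hz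
    simp only [Function.comp_apply, extChartAt_prod_symm_apply]
    exact (extChartAt I₁ x.1).right_inv (mem_extChartAt_prod_target.1 hz).1
  rw [e.fderiv_eq (𝕜 := ℝ), fderiv_fst]
  rfl

theorem components_snd {x p : M₁ × M₂} (hp : p ∈ (extChartAt (I₁.prod I₂) x).source)
    (a : TangentSpace (I₁.prod I₂) p) :
    components I₂ x.2 p.2 (mfderiv (I₁.prod I₂) I₂ Prod.snd p a)
      = (components (I₁.prod I₂) x p a).2 := by
  have hp' := hp
  rw [extChartAt_prod] at hp'
  rw [components_mfderiv mdifferentiableAt_snd hp hp'.2]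
  have e : (extChartAt I₂ x.2 ∘ Prod.snd ∘ (extChartAt (I₁.prod I₂) x).symm)
      =ᶠ[nhds (extChartAt (I₁.prod I₂) x p)] Prod.snd := by
    filter_upwards [(isOpen_extChartAt_target x).mem_nhds
      ((extChartAt (I₁.prod I₂) x).map_source hp)] with z hz
    simp only [Function.comp_apply, extChartAt_prod_symm_apply]
    exact (extChartAt I₂ x.2).right_inv (mem_extChartAt_prod_target.1 hz).2
  rw [e.fderiv_eq (𝕜 := ℝ), fderiv_snd]
  rfl

variable [IsManifold J ∞ N] [RiemannianBundle (fun x : N ↦ TangentSpace J x)]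
  [RiemannianBundle (fun x : M₁ ↦ TangentSpace I₁ x)]
  [RiemannianBundle (fun x : M₂ ↦ TangentSpace I₂ x)]

variable {S : AlmostContactMetric J N} {f : M₁ → ℝ} {ι : M₁ × M₂ → N}

namespace IsContactCRWarpedProduct

theorem contDiffAt_chart (hι : IsContactCRWarpedProduct I₁ I₂ S f ι) {x : M₁ × M₂} {z : E₁ × E₂}
    (hz : z ∈ chartDomain (I₁.prod I₂) J ι x) :
    ContDiffAt ℝ ∞ (writtenInExtChartAt (I₁.prod I₂) J x ι) z :=
  contDiffAt_writtenInCharts hι.smooth_ι hz.1 hz.2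

theorem components_leaf₁ (hι : IsContactCRWarpedProduct I₁ I₂ S f ι) {x : M₁ × M₂} {z : E₁ × E₂}
    (hz : z ∈ chartDomain (I₁.prod I₂) J ι x)
    (a : TangentSpace I₁ ((extChartAt I₁ x.1).symm z.1)) :
    components J (ι x) (ι ((extChartAt I₁ x.1).symm z.1, (extChartAt I₂ x.2).symm z.2))
        (mfderiv I₁ J (fun a ↦ ι (a, (extChartAt I₂ x.2).symm z.2))
          ((extChartAt I₁ x.1).symm z.1) a)
      = fderiv ℝ (writtenInExtChartAt (I₁.prod I₂) J x ι) z
        (components I₁ x.1 ((extChartAt I₁ x.1).symm z.1) a, 0) := by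
  have hz1 := (mem_extChartAt_prod_target.1 hz.1).1
  rw [components_mfderiv (x₀ := x.1) ((hι.smooth_leaf₁ _ _).mdifferentiableAt (by simp))
    ((extChartAt I₁ x.1).map_target hz1) (image_mem_of_mem_chartDomain hz),
    (extChartAt I₁ x.1).right_inv hz1,
    ← fderiv_mk_left ((hι.contDiffAt_chart hz).differentiableAt (by simp))]
  simp_rw [writtenInExtChartAt_prod_apply]
  rfl

variable [J.Boundaryless] [FiniteDimensional ℝ E₂]
  [IsContMDiffRiemannianBundle I₂ ∞ E₂ (fun x : M₂ ↦ TangentSpace I₂ x)]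

/-- A contact CR-warped product, written in the preferred charts. -/
theorem isWarpedImmersionOn (hι : IsContactCRWarpedProduct I₁ I₂ S f ι) (x : M₁ × M₂) :
    IsWarpedImmersionOn (coordMetric J (ι x)) (S.coordφ (ι x)) (S.coordξ (ι x))
      (extChartAt J (ι x)).target (coordMetric I₁ x.1) (extChartAt I₁ x.1).target
      (coordMetric I₂ x.2) (fun y ↦ Real.log (f ((extChartAt I₁ x.1).symm y)))
      (writtenInExtChartAt (I₁.prod I₂) J x ι) (chartDomain (I₁.prod I₂) J ι x) where
  isOpen := isOpen_chartDomain hι.smooth_ι.continuous x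
  smooth z hz := hι.contDiffAt_chart hz
  mapsTo z hz := by
    rw [writtenInExtChartAt_prod_apply]
    exact (extChartAt J (ι x)).map_source (image_mem_of_mem_chartDomain hz)
  fst_mem z hz := (mem_extChartAt_prod_target.1 hz.1).1
  smooth_ψ z hz :=
    (contDiffAt_comp_chart_symm (mem_extChartAt_prod_target.1 hz.1).1 (hι.smooth_f _)).log
      (hι.pos_f _).ne'
  smooth_metric₂ z hz := (contDiffOn_coordMetric x.2).contDiffAt
    ((isOpen_extChartAt_target x.2).mem_nhds (mem_extChartAt_prod_target.1 hz.1).2)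
  metric₂_pos z hz v hv := coordMetric_pos (mem_extChartAt_prod_target.1 hz.1).2 v hv
  isometric z hz u v := by
    have hp := (extChartAt (I₁.prod I₂) x).map_target hz.1
    have hd : MDifferentiableAt (I₁.prod I₂) J ι ((extChartAt (I₁.prod I₂) x).symm z) :=
      (hι.smooth_ι _).mdifferentiableAt (by simp)
    have key := hι.isometric ((extChartAt (I₁.prod I₂) x).symm z)
      (coordFrame (I₁.prod I₂) x z u) (coordFrame (I₁.prod I₂) x z v)
    have hp1 : ((extChartAt (I₁.prod I₂) x).symm z).1 = (extChartAt I₁ x.1).symm z.1 := by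
      rw [extChartAt_prod_symm_apply]
    have hp2 : ((extChartAt (I₁.prod I₂) x).symm z).2 = (extChartAt I₂ x.2).symm z.2 := by
      rw [extChartAt_prod_symm_apply]
    have hz1 := (mem_extChartAt_prod_target.1 hz.1).1
    have hz2 := (mem_extChartAt_prod_target.1 hz.1).2
    rw [inducedInner, inner_eq_coordMetric hz.2, components_mfderiv hd hp hz.2,
      components_mfderiv hd hp hz.2, components_coordFrame hz.1, components_coordFrame hz.1,
      warpedInner, inner_eq_coordMetric (x₀ := x.1)
        (by rw [hp1]; exact (extChartAt I₁ x.1).map_target hz1),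
      inner_eq_coordMetric (x₀ := x.2) (by rw [hp2]; exact (extChartAt I₂ x.2).map_target hz2),
      components_fst hp, components_fst hp, components_snd hp, components_snd hp,
      components_coordFrame hz.1, components_coordFrame hz.1, (extChartAt _ x).right_inv hz.1,
      hp1, hp2, (extChartAt I₁ x.1).right_inv hz1, (extChartAt I₂ x.2).right_inv hz2] at key
    -- The coordinate computation uses `exp ψ` as warping function, so `f` enters through `ψ = ln
    -- f`.
    have he : Real.exp (2 * Real.log (f ((extChartAt I₁ x.1).symm z.1)))
        = f ((extChartAt I₁ x.1).symm z.1) ^ 2 := by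
      rw [two_mul, Real.exp_add, Real.exp_log (hι.pos_f _), sq]
    rw [he]
    exact key
  tangent_ξ z hz := by
    obtain ⟨w, hw⟩ := (hι.invariant ((extChartAt I₂ x.2).symm z.2)
      ((extChartAt I₁ x.1).symm z.1)).1
    refine ⟨_, (hι.components_leaf₁ hz w).symm.trans ?_⟩
    rw [hw, S.components_ξ (image_mem_of_mem_chartDomain hz), writtenInExtChartAt_prod_apply]
  invariant z hz u := by
    have hz1 := (mem_extChartAt_prod_target.1 hz.1).1
    obtain ⟨v, hv⟩ := (hι.invariant ((extChartAt I₂ x.2).symm z.2)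
      ((extChartAt I₁ x.1).symm z.1)).2 (coordFrame I₁ x.1 z.1 u)
    refine ⟨components I₁ x.1 _ v, ?_⟩
    rw [← hι.components_leaf₁ hz v, ← hv, S.components_φ (image_mem_of_mem_chartDomain hz),
      hι.components_leaf₁ hz,
      components_coordFrame hz1, writtenInExtChartAt_prod_apply]

end IsContactCRWarpedProduct

end WarpedProductInCharts

/-! ### Traces over orthonormal frames -/

section Frames

variable {V : Type*} [AddCommGroup V] [Module ℝ V] {κ κ' : Type*} [Fintype κ] [Fintype κ']

/-- Every vector has its coefficients with respect to `h` as coordinates in the family `e`; for a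
metric `h` and linearly independent `e`, this says that `e` is an orthonormal basis. -/
def IsFrame (h : V → V → ℝ) (e : κ → V) : Prop :=
  ∀ x, ∑ i, h x (e i) • e i = x

variable {h : V →ₗ[ℝ] V →ₗ[ℝ] ℝ} {e : κ → V} {e' : κ' → V}

theorem IsFrame.sum_mul (hsymm : ∀ x y, h x y = h y x) (he : IsFrame (fun x y ↦ h x y) e)
    (x y : V) : ∑ i, h (e i) x * h (e i) y = h x y := by
  conv_rhs => rw [← he x]
  simp [hsymm x]

/-- The trace of a bilinear form over a family whose Gram operator is the complement of a rank one
operator. -/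
theorem IsFrame.sum_diag_sub (he : IsFrame (fun x y ↦ h x y) e) {a : κ' → V} {w : V}
    (ha : ∀ x y, ∑ i, h (a i) x * h (a i) y = h x y - h w x * h w y) (β : V →ₗ[ℝ] V →ₗ[ℝ] ℝ) :
    ∑ i, β (a i) (a i) = ∑ k, β (e k) (e k) - β w w := by
  -- Expanding `β` in the frame `e` turns its sum over `a` into the Gram operator of `a` contracted
  -- with the coefficients of `β`.
  have expand : ∀ x, β x x = ∑ k, ∑ l, h x (e k) * h x (e l) * β (e k) (e l) := by
    intro x
    conv_lhs => rw [← he x]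
    simp only [map_sum, map_smul, LinearMap.sum_apply, LinearMap.smul_apply, smul_eq_mul,
      Finset.mul_sum]
    rw [Finset.sum_comm]
    exact Finset.sum_congr rfl fun k _ ↦ Finset.sum_congr rfl fun l _ ↦ by ring
  have diag : ∀ k, β (e k) (e k) = ∑ l, h (e k) (e l) * β (e k) (e l) := by
    intro k
    conv_lhs => arg 2; rw [← he (e k)]
    simp
  rw [expand w, Finset.sum_congr rfl fun k _ ↦ diag k, ← Finset.sum_sub_distrib,
    Finset.sum_congr rfl fun i _ ↦ expand (a i), Finset.sum_comm]
  refine Finset.sum_congr rfl fun k _ ↦ ?_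
  rw [← Finset.sum_sub_distrib, Finset.sum_comm]
  refine Finset.sum_congr rfl fun l _ ↦ ?_
  rw [← Finset.sum_mul, ha]
  ring

/-- The Gram operator of a frame is the metric itself, so this is the case of no removed direction,
`w = 0`. -/
theorem IsFrame.sum_diag (hsymm : ∀ x y, h x y = h y x) (he : IsFrame (fun x y ↦ h x y) e)
    (he' : IsFrame (fun x y ↦ h x y) e') (β : V →ₗ[ℝ] V →ₗ[ℝ] ℝ) :
    ∑ i, β (e' i) (e' i) = ∑ k, β (e k) (e k) := by
  rw [he.sum_diag_sub (w := 0) (fun x y ↦ by simp [he'.sum_mul hsymm]) β]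
  simp

/-- Makes `‖σ‖²` independent of the frame, by exchanging the frame in one argument at a time. -/
theorem IsFrame.sum_sum {F : Type*} [AddCommGroup F] [Module ℝ F]
    (hsymm : ∀ x y, h x y = h y x) (he : IsFrame (fun x y ↦ h x y) e)
    (he' : IsFrame (fun x y ↦ h x y) e') (σ : V →ₗ[ℝ] V →ₗ[ℝ] F) (G : F →ₗ[ℝ] F →ₗ[ℝ] ℝ) :
    ∑ i, ∑ k, G (σ (e' i) (e' k)) (σ (e' i) (e' k))
      = ∑ i, ∑ k, G (σ (e i) (e k)) (σ (e i) (e k)) := by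
  have h1 : ∀ u, ∑ k, G (σ u (e' k)) (σ u (e' k)) = ∑ k, G (σ u (e k)) (σ u (e k)) := fun u ↦
    he.sum_diag hsymm he' (G.compl₁₂ (σ u) (σ u))
  have h2 : ∀ u, ∑ k, G (σ (e' k) u) (σ (e' k) u) = ∑ k, G (σ (e k) u) (σ (e k) u) := fun u ↦
    he.sum_diag hsymm he' (G.compl₁₂ (σ.flip u) (σ.flip u))
  rw [Finset.sum_congr rfl fun i _ ↦ h1 (e' i), Finset.sum_comm,
    Finset.sum_congr rfl fun i _ ↦ h2 (e i), Finset.sum_comm]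

/-- A bilinear map that vanishes on a frame vanishes. -/
theorem IsFrame.eq_zero {F : Type*} [AddCommGroup F] [Module ℝ F] {h : V → V → ℝ}
    (he : IsFrame h e) (σ : V →ₗ[ℝ] V →ₗ[ℝ] F) (h0 : ∀ i k, σ (e i) (e k) = 0) : σ = 0 := by
  ext u v
  rw [← he u, ← he v]
  simp [h0]

end Frames

/-! ### The mixed block and the inequality -/

section MixedTrace

variable {F : Type*} [NormedAddCommGroup F] [NormedSpace ℝ F]
  {E₁ : Type*} [NormedAddCommGroup E₁] [NormedSpace ℝ E₁]
  {E₂ : Type*} [NormedAddCommGroup E₂] [NormedSpace ℝ E₂]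
  {g : F → F →L[ℝ] F →L[ℝ] ℝ} {Γ : F → F →L[ℝ] F →L[ℝ] F} {φ : F → F →L[ℝ] F}
  {ξ : F → F} {η : F → F →L[ℝ] ℝ} {U : Set F} {g₁ : E₁ → E₁ →L[ℝ] E₁ →L[ℝ] ℝ}
  {Γ₁ : E₁ → E₁ →L[ℝ] E₁ →L[ℝ] E₁} {U₁ : Set E₁} {g₂ : E₂ → E₂ →L[ℝ] E₂ →L[ℝ] ℝ}
  {ψ : E₁ → ℝ} {j : E₁ × E₂ → F} {O : Set (E₁ × E₂)} {z : E₁ × E₂}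

/-- A continuous bilinear map as a bilinear map. -/
def toBilin {V V' W : Type*} [NormedAddCommGroup V] [NormedSpace ℝ V] [NormedAddCommGroup V']
    [NormedSpace ℝ V'] [NormedAddCommGroup W] [NormedSpace ℝ W] (B : V →L[ℝ] V' →L[ℝ] W) :
    V →ₗ[ℝ] V' →ₗ[ℝ] W :=
  LinearMap.mk₂ ℝ (fun u v ↦ B u v) (fun u u' v ↦ by simp) (fun t u v ↦ by simp)
    (fun u v v' ↦ by simp) (fun t u v ↦ by simp)

theorem eq_zero_of_sum_sum {B : F →L[ℝ] F →L[ℝ] ℝ} (hB : ∀ x, x ≠ 0 → 0 < B x x) {κ : Type*}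
    [Fintype κ] (s : κ → κ → F) (hs : ∑ i, ∑ k, B (s i k) (s i k) = 0) (i k : κ) : s i k = 0 := by
  have nonneg : ∀ x, 0 ≤ B x x := by
    intro x
    rcases eq_or_ne x 0 with rfl | hx
    · simp
    · exact (hB x hx).le
  have h1 := (Finset.sum_eq_zero_iff_of_nonneg fun i _ ↦
    Finset.sum_nonneg fun k _ ↦ nonneg (s i k)).1 hs i (Finset.mem_univ i)
  have h2 := (Finset.sum_eq_zero_iff_of_nonneg fun k _ ↦ nonneg (s i k)).1 h1 k
    (Finset.mem_univ k)
  by_contra hne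
  exact (hB _ hne).ne' h2

namespace IsWarpedImmersionOn

/-- Frames of the factors give a frame of the warped product. -/
theorem isFrame_prod (hw : IsWarpedImmersionOn g φ ξ U g₁ U₁ g₂ ψ j O) (hz : z ∈ O)
    {κ₁ κ₂ : Type*} [Fintype κ₁] [Fintype κ₂] {e₁ : κ₁ → E₁}
    (he₁ : IsFrame (fun x y ↦ g₁ z.1 x y) e₁) {e₂ : κ₂ → E₂}
    (he₂ : IsFrame (fun x y ↦ g₂ z.2 x y) e₂) :
    IsFrame (fun x y ↦ g (j z) (fderiv ℝ j z x) (fderiv ℝ j z y))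
      (Sum.elim (fun i ↦ (e₁ i, 0)) fun k ↦ (0, (Real.exp (ψ z.1))⁻¹ • e₂ k)) := by
  intro x
  have hr : Real.exp (2 * ψ z.1) = Real.exp (ψ z.1) * Real.exp (ψ z.1) := by
    rw [two_mul, Real.exp_add]
  have h0 := (Real.exp_pos (ψ z.1)).ne'
  rw [Fintype.sum_sum_type]
  simp only [hw.isometric z hz, hr, Sum.elim_inl, Sum.elim_inr, map_zero, mul_zero, add_zero,
    zero_add, Prod.smul_mk, smul_zero, map_smul, smul_eq_mul, smul_smul]
  ext
  · simp only [Prod.fst_add, Prod.fst_sum, Finset.sum_const_zero, add_zero]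
    exact he₁ x.1
  · simp only [Prod.snd_add, Prod.snd_sum, Finset.sum_const_zero, zero_add]
    refine Eq.trans (Finset.sum_congr rfl fun k _ ↦ ?_) (he₂ x.2)
    congr 1
    field_simp

variable [FiniteDimensional ℝ E₁]

/-- The squared norm of the mixed second fundamental form, summed over a frame of the invariant
leaf. -/
theorem sum_mixed_normalPart (hw : IsWarpedImmersionOn g φ ξ U g₁ U₁ g₂ ψ j O)
    (h : IsCosymplecticOn g Γ φ ξ η U) (h₁ : IsLeviCivitaOn g₁ Γ₁ U₁) (hz : z ∈ O) {c : ℝ}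
    (hc : ∀ u, g (j z) u u = 1 → g (j z) u (ξ (j z)) = 0 →
      g (j z) (curvatureOf Γ (j z) u (φ (j z) u) (φ (j z) u)) u = c)
    {σ : E₁ × E₂ →ₗ[ℝ] E₁ × E₂ →ₗ[ℝ] F} (hσ : IsNormalPart g Γ j z (fun u v ↦ σ u v))
    {κ : Type*} [Fintype κ] {e : κ → E₁} (he : IsFrame (fun x y ↦ g₁ z.1 x y) e) {v : E₂}
    (hv : v ≠ 0) :
    ∑ i, g (j z) (σ (e i, 0) (0, v)) (σ (e i, 0) (0, v))
      = (Real.exp (2 * ψ z.1) * g₂ z.2 v v) *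
        (∑ i, (fderiv ℝ (fderiv ℝ ψ) z.1 (e i) (e i) - fderiv ℝ ψ z.1 (Γ₁ z.1 (e i) (e i))
            + fderiv ℝ ψ z.1 (e i) ^ 2)
          + (∑ i, g₁ z.1 (e i) (e i) - 1) * c / 4) := by
  have hy := hw.mapsTo z hz
  have hy₁ := hw.fst_mem z hz
  obtain ⟨w, hwξ⟩ := hw.tangent_ξ z hz
  choose φ₁ hφ₁ using hw.invariant z hz
  have iso : ∀ x y, g (j z) (fderiv ℝ j z (x, 0)) (fderiv ℝ j z (y, 0)) = g₁ z.1 x y := by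
    intro x y
    rw [hw.isometric z hz]
    simp
  have η_eq : ∀ x, η (j z) (fderiv ℝ j z (x, 0)) = g₁ z.1 w x := by
    intro x
    rw [← h.metric_ξ hy, ← hwξ, iso]
  have skew : ∀ x y, g₁ z.1 (φ₁ x) y = -g₁ z.1 x (φ₁ y) := by
    intro x y
    rw [← iso, ← iso, ← hφ₁, ← hφ₁]
    exact h.metric_φ hy _ _
  have orth : ∀ x y, g₁ z.1 (φ₁ x) (φ₁ y) = g₁ z.1 x y - g₁ z.1 w x * g₁ z.1 w y := by
    intro x y
    rw [← iso, ← hφ₁, ← hφ₁, h.metric_φ_φ _ hy, iso, η_eq, η_eq]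
  have hw1 : g₁ z.1 w w = 1 := by rw [← η_eq, hwξ, h.η_ξ _ hy]
  have symm : ∀ x y, toBilin (g₁ z.1) x y = toBilin (g₁ z.1) y x := h₁.metric_symm _ hy₁
  have he' : IsFrame (fun x y ↦ toBilin (g₁ z.1) x y) e := he
  -- By skewness the sum is `g₁(φx, φy)`, the metric minus the square of `η`, and `η` is the product
  -- with `w`. Thus `φ(e i)` may replace `e i` in traces up to the term at `ξ`, and the frame need
  -- not be adapted to `φ`.
  have gram : ∀ x y, ∑ i, toBilin (g₁ z.1) (φ₁ (e i)) x * toBilin (g₁ z.1) (φ₁ (e i)) y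
      = toBilin (g₁ z.1) x y - toBilin (g₁ z.1) w x * toBilin (g₁ z.1) w y := by
    intro x y
    change ∑ i, g₁ z.1 (φ₁ (e i)) x * g₁ z.1 (φ₁ (e i)) y
      = g₁ z.1 x y - g₁ z.1 w x * g₁ z.1 w y
    rw [← orth]
    refine Eq.trans (Finset.sum_congr rfl fun i _ ↦ ?_) (he'.sum_mul symm (φ₁ x) (φ₁ y))
    rw [skew, skew, neg_mul_neg]
    rfl
  have trace := fun β ↦ he'.sum_diag_sub gram β
  have tr1 := trace ((toBilin (g (j z))).compl₁₂
    (σ.flip (0, v) ∘ₗ LinearMap.inl ℝ E₁ E₂) (σ.flip (0, v) ∘ₗ LinearMap.inl ℝ E₁ E₂))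
  have tr2 := trace (toBilin (fderiv ℝ (fderiv ℝ ψ) z.1)
    - (toBilin (Γ₁ z.1)).compr₂ (fderiv ℝ ψ z.1).toLinearMap
    + (LinearMap.mul ℝ ℝ).compl₁₂ (fderiv ℝ ψ z.1).toLinearMap (fderiv ℝ ψ z.1).toLinearMap)
  change ∑ i, g (j z) (σ (φ₁ (e i), 0) (0, v)) (σ (φ₁ (e i), 0) (0, v))
    = ∑ i, g (j z) (σ (e i, 0) (0, v)) (σ (e i, 0) (0, v))
      - g (j z) (σ (w, 0) (0, v)) (σ (w, 0) (0, v)) at tr1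
  change ∑ i, (fderiv ℝ (fderiv ℝ ψ) z.1 (φ₁ (e i)) (φ₁ (e i))
      - fderiv ℝ ψ z.1 (Γ₁ z.1 (φ₁ (e i)) (φ₁ (e i)))
      + fderiv ℝ ψ z.1 (φ₁ (e i)) * fderiv ℝ ψ z.1 (φ₁ (e i)))
    = ∑ i, (fderiv ℝ (fderiv ℝ ψ) z.1 (e i) (e i) - fderiv ℝ ψ z.1 (Γ₁ z.1 (e i) (e i))
      + fderiv ℝ ψ z.1 (e i) * fderiv ℝ ψ z.1 (e i))
      - (fderiv ℝ (fderiv ℝ ψ) z.1 w w - fderiv ℝ ψ z.1 (Γ₁ z.1 w w)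
      + fderiv ℝ ψ z.1 w * fderiv ℝ ψ z.1 w) at tr2
  obtain ⟨m1, m2⟩ := hw.mixed_normalPart_ξ h h₁ hz hσ hwξ v
  have m2 := m2 hv
  simp only [← sq] at tr2
  rw [m2, sub_zero] at tr2
  rw [m1, map_zero, sub_zero] at tr1
  have tr3 : ∑ i, g₁ z.1 w (e i) ^ 2 = 1 := by
    have := he'.sum_mul symm w w
    simp_rw [symm _ w, ← sq] at this
    rw [← hw1]
    exact this
  -- Summed over the frame, both terms on the left have the same trace, and so have both Hessian
  -- terms on the right. Halving turns `c / 2` into `c / 4`.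
  have add := Finset.sum_congr rfl fun (i : κ) (_ : i ∈ Finset.univ) ↦
    hw.mixed_normalPart_add h h₁ hz hc hσ (hφ₁ (e i)) v
  simp only [η_eq] at add
  rw [Finset.sum_add_distrib, ← Finset.mul_sum, tr1, Finset.sum_add_distrib,
    Finset.sum_add_distrib, tr2, ← Finset.mul_sum, Finset.sum_sub_distrib, tr3] at add
  linarith

/-- The squared norm of the second fundamental form of a contact CR-warped product in a
cosymplectic space form. -/
theorem sum_normalPart (hw : IsWarpedImmersionOn g φ ξ U g₁ U₁ g₂ ψ j O)
    (h : IsCosymplecticOn g Γ φ ξ η U) (h₁ : IsLeviCivitaOn g₁ Γ₁ U₁) (hz : z ∈ O) {c : ℝ}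
    (hc : ∀ u, g (j z) u u = 1 → g (j z) u (ξ (j z)) = 0 →
      g (j z) (curvatureOf Γ (j z) u (φ (j z) u) (φ (j z) u)) u = c)
    {σ : E₁ × E₂ →ₗ[ℝ] E₁ × E₂ →ₗ[ℝ] F} (hσ : IsNormalPart g Γ j z (fun u v ↦ σ u v))
    (hσs : ∀ u v, σ u v = σ v u)
    {κ κ₁ κ₂ : Type*} [Fintype κ] [Fintype κ₁] [Fintype κ₂] {e : κ → E₁ × E₂}
    (he : IsFrame (fun x y ↦ g (j z) (fderiv ℝ j z x) (fderiv ℝ j z y)) e) {e₁ : κ₁ → E₁}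
    (he₁ : IsFrame (fun x y ↦ g₁ z.1 x y) e₁) {e₂ : κ₂ → E₂}
    (he₂ : IsFrame (fun x y ↦ g₂ z.2 x y) e₂) (hn : ∀ k, g₂ z.2 (e₂ k) (e₂ k) = 1) :
    ∑ i, ∑ k, g (j z) (σ (e i) (e k)) (σ (e i) (e k))
      = 2 * (Fintype.card κ₂ *
          (∑ i, (fderiv ℝ (fderiv ℝ ψ) z.1 (e₁ i) (e₁ i) - fderiv ℝ ψ z.1 (Γ₁ z.1 (e₁ i) (e₁ i))
            + fderiv ℝ ψ z.1 (e₁ i) ^ 2) + (∑ i, g₁ z.1 (e₁ i) (e₁ i) - 1) * c / 4))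
        + ∑ i, ∑ k, g (j z) (σ (e₁ i, 0) (e₁ k, 0)) (σ (e₁ i, 0) (e₁ k, 0))
        + ∑ i, ∑ k, g (j z)
          (σ (0, (Real.exp (ψ z.1))⁻¹ • e₂ i) (0, (Real.exp (ψ z.1))⁻¹ • e₂ k))
          (σ (0, (Real.exp (ψ z.1))⁻¹ • e₂ i) (0, (Real.exp (ψ z.1))⁻¹ • e₂ k)) := by
  have hr : Real.exp (2 * ψ z.1) = Real.exp (ψ z.1) * Real.exp (ψ z.1) := by
    rw [two_mul, Real.exp_add]
  have h0 := (Real.exp_pos (ψ z.1)).ne'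
  -- Passes from the given frame to one made of frames of the factors, rescaled on the second one by
  -- `exp(-ψ)`.
  have indep := IsFrame.sum_sum (h := (toBilin (g (j z))).compl₁₂ (fderiv ℝ j z).toLinearMap
    (fderiv ℝ j z).toLinearMap) (fun x y ↦ h.metric_symm _ (hw.mapsTo z hz) _ _)
    (hw.isFrame_prod hz he₁ he₂) he σ (toBilin (g (j z)))
  refine indep.trans ?_
  have mixed : ∀ k, ∑ i, g (j z) (σ (e₁ i, 0) (0, (Real.exp (ψ z.1))⁻¹ • e₂ k))
      (σ (e₁ i, 0) (0, (Real.exp (ψ z.1))⁻¹ • e₂ k))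
      = ∑ i, (fderiv ℝ (fderiv ℝ ψ) z.1 (e₁ i) (e₁ i) - fderiv ℝ ψ z.1 (Γ₁ z.1 (e₁ i) (e₁ i))
            + fderiv ℝ ψ z.1 (e₁ i) ^ 2) + (∑ i, g₁ z.1 (e₁ i) (e₁ i) - 1) * c / 4 := by
    intro k
    have hne : (Real.exp (ψ z.1))⁻¹ • e₂ k ≠ 0 := by
      refine smul_ne_zero (inv_ne_zero h0) fun h2 ↦ ?_
      have := hn k
      simp [h2] at this
    rw [hw.sum_mixed_normalPart h h₁ hz hc hσ he₁ hne]
    have : Real.exp (2 * ψ z.1) * g₂ z.2 ((Real.exp (ψ z.1))⁻¹ • e₂ k)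
        ((Real.exp (ψ z.1))⁻¹ • e₂ k) = 1 := by
      rw [map_smul, map_smul, smul_apply, hn, hr]
      simp only [smul_eq_mul]
      field_simp
    rw [this, one_mul]
  have swap : ∀ k i, σ (0, (Real.exp (ψ z.1))⁻¹ • e₂ k) (e₁ i, 0)
    = σ (e₁ i, 0) (0, (Real.exp (ψ z.1))⁻¹ • e₂ k) := fun k i ↦ hσs _ _
  rw [Fintype.sum_sum_type]
  conv_lhs => simp only [Fintype.sum_sum_type, Sum.elim_inl, Sum.elim_inr, Finset.sum_add_distrib,
    swap]
  have m1 := Finset.sum_congr rfl fun (k : κ₂) (_ : k ∈ Finset.univ) ↦ mixed k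
  rw [Finset.sum_const, Finset.card_univ, nsmul_eq_mul] at m1
  have m2 := m1
  rw [Finset.sum_comm] at m2
  change ∑ i, ∑ k, g (j z) (σ (e₁ i, 0) (e₁ k, 0)) (σ (e₁ i, 0) (e₁ k, 0))
    + ∑ i, ∑ k, g (j z) (σ (e₁ i, 0) (0, (Real.exp (ψ z.1))⁻¹ • e₂ k))
      (σ (e₁ i, 0) (0, (Real.exp (ψ z.1))⁻¹ • e₂ k))
    + (∑ k, ∑ i, g (j z) (σ (e₁ i, 0) (0, (Real.exp (ψ z.1))⁻¹ • e₂ k))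
      (σ (e₁ i, 0) (0, (Real.exp (ψ z.1))⁻¹ • e₂ k))
    + ∑ i, ∑ k, g (j z) (σ (0, (Real.exp (ψ z.1))⁻¹ • e₂ i) (0, (Real.exp (ψ z.1))⁻¹ • e₂ k))
      (σ (0, (Real.exp (ψ z.1))⁻¹ • e₂ i) (0, (Real.exp (ψ z.1))⁻¹ • e₂ k))) = _
  rw [m1, m2]
  ring

/-- The inequality between the second fundamental form and the warping function, and the vanishing
that equality forces. -/
theorem le_sum_normalPart (hw : IsWarpedImmersionOn g φ ξ U g₁ U₁ g₂ ψ j O)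
    (h : IsCosymplecticOn g Γ φ ξ η U) (h₁ : IsLeviCivitaOn g₁ Γ₁ U₁) (hz : z ∈ O) {c : ℝ}
    (hc : ∀ u, g (j z) u u = 1 → g (j z) u (ξ (j z)) = 0 →
      g (j z) (curvatureOf Γ (j z) u (φ (j z) u) (φ (j z) u)) u = c)
    {σ : E₁ × E₂ →ₗ[ℝ] E₁ × E₂ →ₗ[ℝ] F} (hσ : IsNormalPart g Γ j z (fun u v ↦ σ u v))
    (hσs : ∀ u v, σ u v = σ v u)
    {κ κ₁ κ₂ : Type*} [Fintype κ] [Fintype κ₁] [Fintype κ₂] {e : κ → E₁ × E₂}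
    (he : IsFrame (fun x y ↦ g (j z) (fderiv ℝ j z x) (fderiv ℝ j z y)) e) {e₁ : κ₁ → E₁}
    (he₁ : IsFrame (fun x y ↦ g₁ z.1 x y) e₁) {e₂ : κ₂ → E₂}
    (he₂ : IsFrame (fun x y ↦ g₂ z.2 x y) e₂) (hn : ∀ k, g₂ z.2 (e₂ k) (e₂ k) = 1) {b : ℝ}
    (hb : b = 2 * (Fintype.card κ₂ *
      (∑ i, (fderiv ℝ (fderiv ℝ ψ) z.1 (e₁ i) (e₁ i) - fderiv ℝ ψ z.1 (Γ₁ z.1 (e₁ i) (e₁ i))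
        + fderiv ℝ ψ z.1 (e₁ i) ^ 2) + (∑ i, g₁ z.1 (e₁ i) (e₁ i) - 1) * c / 4))) :
    b ≤ ∑ i, ∑ k, g (j z) (σ (e i) (e k)) (σ (e i) (e k)) ∧
      (∑ i, ∑ k, g (j z) (σ (e i) (e k)) (σ (e i) (e k)) = b →
        (∀ u v : E₁, σ (u, 0) (v, 0) = 0) ∧ ∀ u v : E₂, σ (0, u) (0, v) = 0) := by
  have key := hw.sum_normalPart h h₁ hz hc hσ hσs he he₁ he₂ hn
  rw [← hb] at key
  have nonneg : ∀ x, 0 ≤ g (j z) x x := by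
    intro x
    rcases eq_or_ne x 0 with rfl | hx
    · simp
    · exact (h.metric_pos _ (hw.mapsTo z hz) x hx).le
  have n1 := Finset.sum_nonneg fun (i : κ₁) (_ : i ∈ Finset.univ) ↦
    Finset.sum_nonneg fun (k : κ₁) (_ : k ∈ Finset.univ) ↦ nonneg (σ (e₁ i, 0) (e₁ k, 0))
  have n2 := Finset.sum_nonneg fun (i : κ₂) (_ : i ∈ Finset.univ) ↦
    Finset.sum_nonneg fun (k : κ₂) (_ : k ∈ Finset.univ) ↦
      nonneg (σ (0, (Real.exp (ψ z.1))⁻¹ • e₂ i) (0, (Real.exp (ψ z.1))⁻¹ • e₂ k))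
  refine ⟨by linarith, fun heq ↦ ?_⟩
  -- The mixed block is the bound itself, so equality leaves two nonnegative blocks with sum zero.
  have z1 := eq_zero_of_sum_sum (h.metric_pos _ (hw.mapsTo z hz)) _ (le_antisymm (by linarith) n1)
  have z2 := eq_zero_of_sum_sum (h.metric_pos _ (hw.mapsTo z hz)) _ (le_antisymm (by linarith) n2)
  constructor
  · intro u v
    have := he₁.eq_zero (σ.compl₁₂ (LinearMap.inl ℝ E₁ E₂) (LinearMap.inl ℝ E₁ E₂)) z1
    exact congrArg (fun L ↦ L u v) this
  · intro u v
    have := he₂.eq_zero (σ.compl₁₂ (LinearMap.inr ℝ E₁ E₂) (LinearMap.inr ℝ E₁ E₂)) fun i k ↦ by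
      have h2 := z2 i k
      have es : ∀ x : E₂, ((0 : E₁), (Real.exp (ψ z.1))⁻¹ • x)
          = (Real.exp (ψ z.1))⁻¹ • ((0 : E₁), x) := fun x ↦ by simp
      rw [es, es, map_smul, map_smul, LinearMap.smul_apply, smul_smul] at h2
      exact (smul_eq_zero.1 h2).resolve_left
        (mul_ne_zero (inv_ne_zero (Real.exp_pos _).ne') (inv_ne_zero (Real.exp_pos _).ne'))
    exact congrArg (fun L ↦ L u v) this

end IsWarpedImmersionOn

end MixedTrace

/-! ### Second fundamental forms of the leaves -/

section Leaves

variable {F : Type*} [NormedAddCommGroup F] [NormedSpace ℝ F]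
  {E₁ : Type*} [NormedAddCommGroup E₁] [NormedSpace ℝ E₁]
  {E₂ : Type*} [NormedAddCommGroup E₂] [NormedSpace ℝ E₂]
  {j : E₁ × E₂ → F} {z : E₁ × E₂}

theorem secondDeriv_mk_left (Γ : F → F →L[ℝ] F →L[ℝ] F) (hj : ContDiffAt ℝ 2 j z) (u v : E₁) :
    secondDeriv Γ (fun t ↦ j (t, z.2)) z.1 u v = secondDeriv Γ j z (u, 0) (v, 0) := by
  have hd : ∀ᶠ y in nhds z, DifferentiableAt ℝ j y :=
    (hj.eventually (by simp)).mono fun y hy ↦ hy.differentiableAt (by simp)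
  have hc : Filter.Tendsto (fun t : E₁ ↦ (t, z.2)) (nhds z.1) (nhds z) :=
    (by fun_prop : Continuous fun t : E₁ ↦ (t, z.2)).tendsto' _ _ rfl
  have hl : ContDiffAt ℝ 2 (fun t ↦ j (t, z.2)) z.1 :=
    ContDiffAt.comp (g := j) z.1 hj (by fun_prop)
  have d2 : DifferentiableAt ℝ (fun y ↦ fderiv ℝ j y (v, 0)) z :=
    ((hj.fderiv_right (m := 1) (by norm_num)).differentiableAt (by simp)).clm_apply
      (differentiableAt_const _)
  have e : (fun t ↦ fderiv ℝ (fun t ↦ j (t, z.2)) t v)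
      =ᶠ[nhds z.1] fun t ↦ fderiv ℝ j (t, z.2) (v, 0) := by
    filter_upwards [hc.eventually hd] with t ht
    exact fderiv_mk_left (z := (t, z.2)) ht v
  rw [secondDeriv, secondDeriv, ← fderiv_fderiv_apply hl, ← fderiv_fderiv_apply hj,
    e.fderiv_eq (𝕜 := ℝ), fderiv_mk_left d2, fderiv_mk_left hd.self_of_nhds,
    fderiv_mk_left hd.self_of_nhds]

theorem secondDeriv_mk_right (Γ : F → F →L[ℝ] F →L[ℝ] F) (hj : ContDiffAt ℝ 2 j z) (u v : E₂) :
    secondDeriv Γ (fun t ↦ j (z.1, t)) z.2 u v = secondDeriv Γ j z (0, u) (0, v) := by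
  have hd : ∀ᶠ y in nhds z, DifferentiableAt ℝ j y :=
    (hj.eventually (by simp)).mono fun y hy ↦ hy.differentiableAt (by simp)
  have hc : Filter.Tendsto (fun t : E₂ ↦ (z.1, t)) (nhds z.2) (nhds z) :=
    (by fun_prop : Continuous fun t : E₂ ↦ (z.1, t)).tendsto' _ _ rfl
  have hl : ContDiffAt ℝ 2 (fun t ↦ j (z.1, t)) z.2 :=
    ContDiffAt.comp (g := j) z.2 hj (by fun_prop)
  have d2 : DifferentiableAt ℝ (fun y ↦ fderiv ℝ j y (0, v)) z :=
    ((hj.fderiv_right (m := 1) (by norm_num)).differentiableAt (by simp)).clm_apply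
      (differentiableAt_const _)
  have e : (fun t ↦ fderiv ℝ (fun t ↦ j (z.1, t)) t v)
      =ᶠ[nhds z.2] fun t ↦ fderiv ℝ j (z.1, t) (0, v) := by
    filter_upwards [hc.eventually hd] with t ht
    exact fderiv_mk_right (z := (z.1, t)) ht v
  rw [secondDeriv, secondDeriv, ← fderiv_fderiv_apply hl, ← fderiv_fderiv_apply hj,
    e.fderiv_eq (𝕜 := ℝ), fderiv_mk_right d2, fderiv_mk_right hd.self_of_nhds,
    fderiv_mk_right hd.self_of_nhds]

/-- The normal part of the second derivative is determined by any orthogonal decomposition. -/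
theorem IsLeviCivitaOn.normalPart_eq {E : Type*} [NormedAddCommGroup E] [NormedSpace ℝ E]
    {g : F → F →L[ℝ] F →L[ℝ] ℝ} {Γ : F → F →L[ℝ] F →L[ℝ] F} {U : Set F}
    (h : IsLeviCivitaOn g Γ U) {j : E → F} {z : E} (hz : j z ∈ U) {σ : E → E → F}
    (hσ : IsNormalPart g Γ j z σ) {u v t : E} {s : F}
    (hs : ∀ w, g (j z) s (fderiv ℝ j z w) = 0)
    (hst : secondDeriv Γ j z u v = s + fderiv ℝ j z t) : σ u v = s := by
  have k := h.secondDeriv_eq hz hσ (u := u) (v := v) (s := t) fun w ↦ by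
    rw [hst, map_add, add_apply, hs, zero_add]
  rw [hst] at k
  exact (add_right_cancel k).symm

variable {g : F → F →L[ℝ] F →L[ℝ] ℝ} {Γ : F → F →L[ℝ] F →L[ℝ] F} {φ : F → F →L[ℝ] F}
  {ξ : F → F} {U : Set F} {g₁ : E₁ → E₁ →L[ℝ] E₁ →L[ℝ] ℝ}
  {Γ₁ : E₁ → E₁ →L[ℝ] E₁ →L[ℝ] E₁} {U₁ : Set E₁} {g₂ : E₂ → E₂ →L[ℝ] E₂ →L[ℝ] ℝ}
  {ψ : E₁ → ℝ} {O : Set (E₁ × E₂)} {σ : E₁ × E₂ → E₁ × E₂ → F}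

namespace IsWarpedImmersionOn

/-- The second fundamental form of the leaves of the first factor. -/
theorem normalPart_leaf₁ (hw : IsWarpedImmersionOn g φ ξ U g₁ U₁ g₂ ψ j O)
    (h : IsLeviCivitaOn g Γ U) (h₁ : IsLeviCivitaOn g₁ Γ₁ U₁) (hz : z ∈ O)
    (hσ : IsNormalPart g Γ j z σ) {τ : E₁ → E₁ → F}
    (hτ : IsNormalPart g Γ (fun t ↦ j (t, z.2)) z.1 τ) (u v : E₁)
    (h0 : σ (u, 0) (v, 0) = 0) : τ u v = 0 := by
  have hj := hw.contDiffAt_two hz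
  refine h.normalPart_eq (j := fun t ↦ j (t, z.2)) (z := z.1) (hw.mapsTo z hz) hτ
    (t := Γ₁ z.1 u v) (fun w ↦ by simp) ?_
  rw [secondDeriv_mk_left Γ hj, hw.secondDeriv₁₁_eq h h₁ hz hσ, h0,
    fderiv_mk_left (hj.differentiableAt (by simp))]

/-- The second fundamental form of the leaves of the second factor. -/
theorem normalPart_leaf₂ [FiniteDimensional ℝ E₁]
    (hw : IsWarpedImmersionOn g φ ξ U g₁ U₁ g₂ ψ j O)
    (h : IsLeviCivitaOn g Γ U) (h₁ : IsLeviCivitaOn g₁ Γ₁ U₁) (hz : z ∈ O)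
    (hσ : IsNormalPart g Γ j z σ) {τ : E₂ → E₂ → F}
    (hτ : IsNormalPart g Γ (fun t ↦ j (z.1, t)) z.2 τ) (h0 : ∀ u v, σ (0, u) (0, v) = 0) :
    ∃ n : F, ∀ u v, τ u v = g (j z) (fderiv ℝ (fun t ↦ j (z.1, t)) z.2 u)
      (fderiv ℝ (fun t ↦ j (z.1, t)) z.2 v) • n := by
  have hj := hw.contDiffAt_two hz
  have dj := hj.differentiableAt (by simp)
  have hy := hw.fst_mem z hz
  -- The gradient of `ψ` for `g₁`. The mean curvature of the leaf will be minus its image under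
  -- `dj`.
  set m := (g₁ z.1).inverse (fderiv ℝ ψ z.1) with hm
  have hmu : ∀ u, g₁ z.1 m u = fderiv ℝ ψ z.1 u := fun u ↦ by
    rw [hm, apply_inverse_of_pos (h₁.metric_pos _ hy)]
  refine ⟨-fderiv ℝ j z (m, 0), fun u v ↦ ?_⟩
  obtain ⟨t, ht⟩ := hσ.tangent (0, u) (0, v)
  rw [h0, zero_add] at ht
  -- With `σ = 0` on the second factor the second derivative is tangent to `M`; its component along
  -- the first factor is `-g(u, v)` times the gradient of `ψ`, which is normal to the leaf.
  have ht1 : t.1 = -(Real.exp (2 * ψ z.1) * g₂ z.2 u v) • m := by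
    refine sub_eq_zero.1 (by_contra fun hne ↦ ?_)
    have pos := h₁.metric_pos _ hy _ hne
    have k : ∀ a, g₁ z.1 (t.1 - -(Real.exp (2 * ψ z.1) * g₂ z.2 u v) • m) a = 0 := by
      intro a
      have k1 := hw.metric_secondDeriv₂₂ h h₁ hz u v a
      rw [ht, hw.isometric z hz] at k1
      simp only [map_zero, mul_zero, add_zero] at k1
      rw [map_sub, map_smul, sub_apply, smul_apply, hmu, k1, smul_eq_mul]
      ring
    rw [k] at pos
    exact lt_irrefl _ pos
  refine h.normalPart_eq (j := fun t ↦ j (z.1, t)) (z := z.2) (hw.mapsTo z hz) hτ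
    (t := t.2) (fun w ↦ ?_) ?_
  · rw [fderiv_mk_right dj w, map_smul, map_neg, smul_apply, neg_apply]
    rw [show j (z.1, z.2) = j z from rfl, hw.isometric z hz (m, 0)]
    simp
  · rw [secondDeriv_mk_right Γ hj, ht, fderiv_mk_right dj, fderiv_mk_right dj, fderiv_mk_right dj,
      hw.isometric z hz]
    simp only [map_zero, zero_add]
    rw [smul_neg, ← neg_smul, ← map_smul, ← map_add, Prod.smul_mk, smul_zero, Prod.mk_add_mk,
      add_zero, zero_add, ← ht1]

end IsWarpedImmersionOn

end Leaves

/-! ### Orthonormal bases and gradients in charts -/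

section FramesInCharts

variable {E : Type*} [NormedAddCommGroup E] [NormedSpace ℝ E]
  {H : Type*} [TopologicalSpace H] {I : ModelWithCorners ℝ E H} [I.Boundaryless]
  {M : Type*} [TopologicalSpace M] [ChartedSpace H M] [IsManifold I ∞ M]

section

variable [RiemannianBundle (fun x : M ↦ TangentSpace I x)] {κ : Type*} [Fintype κ]

theorem isFrame_toCoord {x : M} (b : OrthonormalBasis κ ℝ (TangentSpace I x)) :
    IsFrame (fun u v ↦ coordMetric I x (extChartAt I x x) u v) (fun i ↦ toCoord I x (b i)) := by
  intro u
  have h := congrArg (toCoord I x) (b.sum_repr' (ofCoord I x u))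
  rw [map_sum, toCoord_ofCoord] at h
  refine Eq.trans (Finset.sum_congr rfl fun i _ ↦ ?_) h
  rw [map_smul, real_inner_comm, inner_eq_coordMetric_self, toCoord_ofCoord]

theorem coordMetric_toCoord_self {x : M} (b : OrthonormalBasis κ ℝ (TangentSpace I x)) (i : κ) :
    coordMetric I x (extChartAt I x x) (toCoord I x (b i)) (toCoord I x (b i)) = 1 := by
  rw [← inner_eq_coordMetric_self, real_inner_self_eq_norm_sq, b.norm_eq_one, one_pow]

end

theorem mvfderiv_eq_toCoord {ψ : M → ℝ} {x : M} (hψ : ContMDiffAt I 𝓘(ℝ, ℝ) ∞ ψ x)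
    (a : TangentSpace I x) :
    mvfderiv I ψ x a = fderiv ℝ (fun y ↦ ψ ((extChartAt I x).symm y)) (extChartAt I x x)
      (toCoord I x a) := by
  have h := toCoord_mfderiv (I := I) (J := 𝓘(ℝ, ℝ)) (hψ.mdifferentiableAt (by simp)) a
  rw [toCoord_eq_refl (I := 𝓘(ℝ, ℝ))] at h
  exact h

theorem norm_grad_sq [FiniteDimensional ℝ E] [RiemannianBundle (fun x : M ↦ TangentSpace I x)]
    {κ : Type*} [Fintype κ] {ψ : M → ℝ} {x : M} (hψ : ContMDiffAt I 𝓘(ℝ, ℝ) ∞ ψ x)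
    (b : OrthonormalBasis κ ℝ (TangentSpace I x)) :
    ‖grad I ψ x‖ ^ 2 = ∑ i, fderiv ℝ (fun y ↦ ψ ((extChartAt I x).symm y)) (extChartAt I x x)
      (toCoord I x (b i)) ^ 2 := by
  rw [← b.sum_sq_norm_inner_left]
  refine Finset.sum_congr rfl fun i _ ↦ ?_
  rw [← mvfderiv_eq_toCoord hψ, grad, InnerProductSpace.toDual_symm_apply, Real.norm_eq_abs,
    sq_abs]

end FramesInCharts

/-! ### Frames for the induced metric -/

section InducedFrames

variable {E : Type*} [NormedAddCommGroup E] [NormedSpace ℝ E]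
  {H : Type*} [TopologicalSpace H] {I : ModelWithCorners ℝ E H}
  {M : Type*} [TopologicalSpace M] [ChartedSpace H M]
  {E' : Type*} [NormedAddCommGroup E'] [NormedSpace ℝ E']
  {H' : Type*} [TopologicalSpace H'] {J : ModelWithCorners ℝ E' H'}
  {N : Type*} [TopologicalSpace N] [ChartedSpace H' N]
  [RiemannianBundle (fun x : N ↦ TangentSpace J x)] {F : M → N} {x : M}

section

variable [FiniteDimensional ℝ E']

theorem mfderiv_inducedFrame (i : Fin (Module.finrank ℝ (tangentImage I J F x))) :
    mfderiv I J F x (inducedFrame I J F x i) = stdOrthonormalBasis ℝ (tangentImage I J F x) i :=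
  (stdOrthonormalBasis ℝ (tangentImage I J F x) i).2.choose_spec

theorem inducedInner_inducedFrame (i : Fin (Module.finrank ℝ (tangentImage I J F x))) :
    inducedInner I J F x (inducedFrame I J F x i) (inducedFrame I J F x i) = 1 := by
  rw [inducedInner, mfderiv_inducedFrame, ← Submodule.coe_inner, real_inner_self_eq_norm_sq,
    OrthonormalBasis.norm_eq_one, one_pow]

/-- A point at which the second fundamental form is a multiple of the metric is umbilical. -/
theorem sff_eq_meanCurvature [FiniteDimensional ℝ E] (hinj : Function.Injective (mfderiv I J F x))
    {n : TangentSpace J (F x)}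
    (hn : ∀ u v, sff I J F x u v = inducedInner I J F x u v • n) (u v : TangentSpace I x) :
    sff I J F x u v = inducedInner I J F x u v • meanCurvature I J F x := by
  have dim : Module.finrank ℝ (tangentImage I J F x) = Module.finrank ℝ (TangentSpace I x) :=
    LinearMap.finrank_range_of_inj hinj
  -- In dimension zero the mean curvature carries the factor `0⁻¹ = 0`, but then both sides vanish
  -- with `u`.
  rcases Nat.eq_zero_or_pos (Module.finrank ℝ (TangentSpace I x)) with h0 | hpos
  · have hu : u = 0 := by
      have := Module.finrank_zero_iff.1 h0
      exact Subsingleton.elim u 0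
    rw [hn, hu]
    simp [inducedInner]
  · have hm : meanCurvature I J F x = n := by
      rw [meanCurvature]
      simp only [hn, inducedInner_inducedFrame, one_smul]
      rw [Finset.sum_const, Finset.card_univ, Fintype.card_fin, dim, ← Nat.cast_smul_eq_nsmul ℝ,
        smul_smul, inv_mul_cancel₀ (Nat.cast_ne_zero.2 hpos.ne'), one_smul]
    rw [hm, hn]

end

variable [I.Boundaryless] [IsManifold I ∞ M] [J.Boundaryless] [IsManifold J ∞ N]

theorem inducedInner_eq_coordMetric (hF : MDifferentiableAt I J F x) (a b : TangentSpace I x) :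
    inducedInner I J F x a b = coordMetric J (F x)
      (writtenInExtChartAt I J x F (extChartAt I x x))
      (fderiv ℝ (writtenInExtChartAt I J x F) (extChartAt I x x) (toCoord I x a))
      (fderiv ℝ (writtenInExtChartAt I J x F) (extChartAt I x x) (toCoord I x b)) := by
  rw [inducedInner, inner_eq_coordMetric_self, writtenInExtChartAt_self, toCoord_mfderiv hF,
    toCoord_mfderiv hF]

theorem isFrame_inducedFrame [FiniteDimensional ℝ E'] (hF : MDifferentiableAt I J F x)
    (hinj : Function.Injective (mfderiv I J F x)) :
    IsFrame (fun u v ↦ coordMetric J (F x) (writtenInExtChartAt I J x F (extChartAt I x x))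
      (fderiv ℝ (writtenInExtChartAt I J x F) (extChartAt I x x) u)
      (fderiv ℝ (writtenInExtChartAt I J x F) (extChartAt I x x) v))
      (fun i ↦ toCoord I x (inducedFrame I J F x i)) := by
  intro u
  have h := (stdOrthonormalBasis ℝ (tangentImage I J F x)).sum_repr'
    ⟨mfderiv I J F x (ofCoord I x u), ofCoord I x u, rfl⟩
  have h' := congrArg Subtype.val h
  simp only [Submodule.coe_sum, Submodule.coe_smul, Submodule.coe_inner,
    ← mfderiv_inducedFrame] at h'
  simp only [← map_smul, ← map_sum] at h'
  have h2 := congrArg (toCoord I x) (hinj h')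
  rw [toCoord_ofCoord, map_sum] at h2
  refine Eq.trans (Finset.sum_congr rfl fun i _ ↦ ?_) h2
  have hk := inducedInner_eq_coordMetric hF (ofCoord I x u) (inducedFrame I J F x i)
  rw [toCoord_ofCoord] at hk
  rw [map_smul, real_inner_comm]
  exact congrArg (· • toCoord I x (inducedFrame I J F x i)) hk.symm

end InducedFrames

/-! ### From coordinates back to the manifolds -/

section ContactCRWarpedProducts

variable {E : Type*} [NormedAddCommGroup E] [NormedSpace ℝ E]
  {H : Type*} [TopologicalSpace H] {J : ModelWithCorners ℝ E H} [J.Boundaryless]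
  {N : Type*} [TopologicalSpace N] [ChartedSpace H N] [IsManifold J ∞ N]
  [RiemannianBundle (fun x : N ↦ TangentSpace J x)]
  {E₁ : Type*} [NormedAddCommGroup E₁] [NormedSpace ℝ E₁] [FiniteDimensional ℝ E₁]
  {H₁ : Type*} [TopologicalSpace H₁] {I₁ : ModelWithCorners ℝ E₁ H₁} [I₁.Boundaryless]
  {M₁ : Type*} [TopologicalSpace M₁] [ChartedSpace H₁ M₁] [IsManifold I₁ ∞ M₁]
  [RiemannianBundle (fun x : M₁ ↦ TangentSpace I₁ x)]
  [IsContMDiffRiemannianBundle I₁ ∞ E₁ (fun x : M₁ ↦ TangentSpace I₁ x)]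
  {E₂ : Type*} [NormedAddCommGroup E₂] [NormedSpace ℝ E₂] [FiniteDimensional ℝ E₂]
  {H₂ : Type*} [TopologicalSpace H₂] {I₂ : ModelWithCorners ℝ E₂ H₂} [I₂.Boundaryless]
  {M₂ : Type*} [TopologicalSpace M₂] [ChartedSpace H₂ M₂] [IsManifold I₂ ∞ M₂]
  [RiemannianBundle (fun x : M₂ ↦ TangentSpace I₂ x)]
  [IsContMDiffRiemannianBundle I₂ ∞ E₂ (fun x : M₂ ↦ TangentSpace I₂ x)]
  {S : AlmostContactMetric J N} {f : M₁ → ℝ} {ι : M₁ × M₂ → N}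

namespace IsContactCRWarpedProduct

/-- The induced metric is a sum of two nonnegative terms, each positive unless its component of `u`
is zero. -/
theorem fderiv_eq_zero (hι : IsContactCRWarpedProduct I₁ I₂ S f ι) (x : M₁ × M₂) {u : E₁ × E₂}
    (hu : fderiv ℝ (writtenInExtChartAt (I₁.prod I₂) J x ι) (extChartAt (I₁.prod I₂) x x) u = 0) :
    u = 0 := by
  have hz := mem_chartDomain (I₁ := I₁.prod I₂) (J := J) ι x
  have hw := hι.isWarpedImmersionOn x
  have k := hw.isometric _ hz u u
  rw [hu, map_zero] at k
  have pos₁ := (isLeviCivitaOn_coordMetric (I := I₁) x.1).metric_pos _ (hw.fst_mem _ hz) u.1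
  have pos₂ := hw.metric₂_pos _ hz u.2
  have hexp := Real.exp_pos
    (2 * Real.log (f ((extChartAt I₁ x.1).symm (extChartAt (I₁.prod I₂) x x).1)))
  have n₁ : 0 ≤ coordMetric I₁ x.1 (extChartAt (I₁.prod I₂) x x).1 u.1 u.1 := by
    rcases eq_or_ne u.1 0 with h | h
    · simp [h]
    · exact (pos₁ h).le
  have n₂ : 0 ≤ coordMetric I₂ x.2 (extChartAt (I₁.prod I₂) x x).2 u.2 u.2 := by
    rcases eq_or_ne u.2 0 with h | h
    · simp [h]
    · exact (pos₂ h).le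
  have n₃ := mul_nonneg hexp.le n₂
  ext1
  · by_contra h
    linarith [pos₁ h]
  · by_contra h
    linarith [mul_pos hexp (pos₂ h)]

theorem injective_mfderiv (hι : IsContactCRWarpedProduct I₁ I₂ S f ι) (x : M₁ × M₂) :
    Function.Injective (mfderiv (I₁.prod I₂) J ι x) := by
  refine (injective_iff_map_eq_zero _).2 fun a ha ↦ ?_
  have h := toCoord_mfderiv ((hι.smooth_ι x).mdifferentiableAt (by simp)) a
  rw [ha, map_zero] at h
  rw [← ofCoord_toCoord x a, hι.fderiv_eq_zero x h.symm, map_zero]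

theorem injective_mfderiv_leaf₂ (hι : IsContactCRWarpedProduct I₁ I₂ S f ι) (x : M₁ × M₂) :
    Function.Injective (mfderiv I₂ J (fun b ↦ ι (x.1, b)) x.2) := by
  refine (injective_iff_map_eq_zero _).2 fun a ha ↦ ?_
  have h := toCoord_mfderiv ((hι.smooth_leaf₂ x.1 x.2).mdifferentiableAt (by simp)) a
  have hz := mem_chartDomain (I₁ := I₁.prod I₂) (J := J) ι x
  have hz2 : extChartAt I₂ x.2 x.2 = (extChartAt (I₁.prod I₂) x x).2 := by
    rw [extChartAt_prod_apply]
  rw [ha, map_zero, writtenInExtChartAt_leaf₂ (I₁ := I₁) (I₂ := I₂) ι x, hz2,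
    fderiv_mk_right ((hι.contDiffAt_chart hz).differentiableAt (by simp))] at h
  have h' := congrArg Prod.snd (hι.fderiv_eq_zero x h.symm)
  rw [← ofCoord_toCoord x.2 a]
  exact (congrArg (ofCoord I₂ x.2) h').trans (map_zero _)

end IsContactCRWarpedProduct

variable [FiniteDimensional ℝ E]
  [IsContMDiffRiemannianBundle J ∞ E (fun x : N ↦ TangentSpace J x)]

theorem AlmostContactMetric.IsCosymplecticSpaceForm.curvatureOf {S : AlmostContactMetric J N}
    {c : ℝ} (hS : S.IsCosymplecticSpaceForm c) (y : N) (u : E)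
    (hu : coordMetric J y (extChartAt J y y) u u = 1)
    (huξ : coordMetric J y (extChartAt J y y) u (S.coordξ y (extChartAt J y y)) = 0) :
    coordMetric J y (extChartAt J y y) (curvatureOf (christoffelMap J y) (extChartAt J y y) u
      (S.coordφ y (extChartAt J y y) u) (S.coordφ y (extChartAt J y y) u)) u = c := by
  have hφ : toCoord J y (S.φ y (ofCoord J y u)) = S.coordφ y (extChartAt J y y) u :=
    (S.components_φ (mem_extChartAt_source y) (ofCoord J y u)).trans
      (congrArg _ (toCoord_ofCoord y u))
  have hξ : toCoord J y (S.ξ y) = S.coordξ y (extChartAt J y y) :=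
    S.components_ξ (mem_extChartAt_source y)
  have h := hS.2 y (ofCoord J y u) (by rw [inner_eq_coordMetric_self, toCoord_ofCoord, hu])
    (by rw [inner_eq_coordMetric_self, toCoord_ofCoord, hξ, huξ])
  rwa [inner_eq_coordMetric_self, curvature, toCoord_ofCoord, toCoord_ofCoord, hφ,
    coordCurvature_eq y (mem_extChartAt_target y)] at h

namespace IsContactCRWarpedProduct

/-- The inequality for the second fundamental form of a contact CR-warped product in a cosymplectic
space form; in the case of equality the second fundamental form vanishes on both factors. -/
theorem le_sffNormSq (hι : IsContactCRWarpedProduct I₁ I₂ S f ι) {c : ℝ}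
    (hS : S.IsCosymplecticSpaceForm c) (x : M₁ × M₂) {b : ℝ}
    (hb : b = 2 * (Module.finrank ℝ E₂ : ℝ) *
      (‖grad I₁ (fun a ↦ Real.log (f a)) x.1‖ ^ 2 - laplacian I₁ (fun a ↦ Real.log (f a)) x.1
        + ((Module.finrank ℝ E₁ : ℝ) - 1) * c / 4)) :
    b ≤ sffNormSq (I₁.prod I₂) J ι x ∧ (sffNormSq (I₁.prod I₂) J ι x = b →
      (∀ u v : E₁, coordSff (I₁.prod I₂) J ι x (u, 0) (v, 0) = 0) ∧
      ∀ u v : E₂, coordSff (I₁.prod I₂) J ι x (0, u) (0, v) = 0) := by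
  have hz := mem_chartDomain (I₁ := I₁.prod I₂) (J := J) ι x
  have hw := hι.isWarpedImmersionOn x
  have hz1 : (extChartAt (I₁.prod I₂) x x).1 = extChartAt I₁ x.1 x.1 := by
    rw [extChartAt_prod_apply]
  have hz2 : (extChartAt (I₁.prod I₂) x x).2 = extChartAt I₂ x.2 x.2 := by
    rw [extChartAt_prod_apply]
  have hψ : ContMDiffAt I₁ 𝓘(ℝ, ℝ) ∞ (fun a ↦ Real.log (f a)) x.1 :=
    ContMDiffAt.comp x.1 ((Real.contDiffAt_log.2 (hι.pos_f _).ne').contMDiffAt) (hι.smooth_f x.1)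
  let b₁ := stdOrthonormalBasis ℝ (TangentSpace I₁ x.1)
  let b₂ := stdOrthonormalBasis ℝ (TangentSpace I₂ x.2)
  have he₁ := isFrame_toCoord b₁
  have he₂ := isFrame_toCoord b₂
  have hn := coordMetric_toCoord_self b₂
  rw [← hz1] at he₁
  rw [← hz2] at he₂ hn
  have key := hw.le_sum_normalPart (S.isCosymplecticOn hS.1 (ι x))
    (isLeviCivitaOn_coordMetric x.1) hz (c := c)
    (by rw [writtenInExtChartAt_self]; exact hS.curvatureOf (ι x))
    (isNormalPart_sff hι.smooth_ι x) (coordSff_symm hι.smooth_ι x)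
    (isFrame_inducedFrame ((hι.smooth_ι x).mdifferentiableAt (by simp)) (hι.injective_mfderiv x))
    he₁ he₂ hn (b := b) ?_
  · have e : sffNormSq (I₁.prod I₂) J ι x = _ := Finset.sum_congr rfl fun i _ ↦
      Finset.sum_congr rfl fun k _ ↦ norm_sff_sq ι x _ _
    rw [e]
    rw [writtenInExtChartAt_self] at key
    exact key
  · rw [hb, norm_grad_sq hψ b₁, laplacian, hz1]
    have h1 : ∀ i, coordMetric I₁ x.1 (extChartAt I₁ x.1 x.1) (toCoord I₁ x.1 (b₁ i))
        (toCoord I₁ x.1 (b₁ i)) = 1 := coordMetric_toCoord_self b₁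
    simp only [h1]
    rw [Finset.sum_const, Finset.card_univ, Fintype.card_fin, Fintype.card_fin, nsmul_one,
      Finset.sum_add_distrib, Finset.sum_neg_distrib]
    change _ = 2 * ((Module.finrank ℝ E₂ : ℝ) * (∑ i, hessian I₁ (fun a ↦ Real.log (f a)) x.1
      (b₁ i) (b₁ i) + _ + ((Module.finrank ℝ E₁ : ℝ) - 1) * c / 4))
    ring

theorem isTotallyGeodesic_leaf (hι : IsContactCRWarpedProduct I₁ I₂ S f ι)
    (hS : S.IsCosymplectic) (b : M₂)
    (h0 : ∀ (a : M₁) (u v : E₁), coordSff (I₁.prod I₂) J ι (a, b) (u, 0) (v, 0) = 0) :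
    IsTotallyGeodesic I₁ J (fun a ↦ ι (a, b)) := by
  intro a u v
  have hz := mem_chartDomain (I₁ := I₁.prod I₂) (J := J) ι (a, b)
  have hz1 : extChartAt I₁ a a = (extChartAt (I₁.prod I₂) (a, b) (a, b)).1 := by
    rw [extChartAt_prod_apply]
  have hτ := isNormalPart_sff (hι.smooth_leaf₁ b) a
  rw [writtenInExtChartAt_leaf₁ (I₁ := I₁) (I₂ := I₂) ι (a, b), hz1] at hτ
  have k := (hι.isWarpedImmersionOn (a, b)).normalPart_leaf₁
    (S.isCosymplecticOn hS (ι (a, b))).toIsLeviCivitaOn (isLeviCivitaOn_coordMetric a) hz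
    (isNormalPart_sff hι.smooth_ι (a, b)) hτ (toCoord I₁ a u) (toCoord I₁ a v) (h0 a _ _)
  have k' : toCoord J (ι (a, b)) (sff I₁ J (fun a ↦ ι (a, b)) a u v) = 0 :=
    (toCoord_sff (fun a ↦ ι (a, b)) a u v).trans k
  rw [← ofCoord_toCoord _ (sff I₁ J (fun a ↦ ι (a, b)) a u v), k', map_zero]

theorem isTotallyUmbilical_leaf (hι : IsContactCRWarpedProduct I₁ I₂ S f ι)
    (hS : S.IsCosymplectic) (a : M₁)
    (h0 : ∀ (b : M₂) (u v : E₂), coordSff (I₁.prod I₂) J ι (a, b) (0, u) (0, v) = 0) :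
    IsTotallyUmbilical I₂ J (fun b ↦ ι (a, b)) := by
  intro b
  have hz := mem_chartDomain (I₁ := I₁.prod I₂) (J := J) ι (a, b)
  have hz2 : extChartAt I₂ b b = (extChartAt (I₁.prod I₂) (a, b) (a, b)).2 := by
    rw [extChartAt_prod_apply]
  have hτ := isNormalPart_sff (hι.smooth_leaf₂ a) b
  rw [writtenInExtChartAt_leaf₂ (I₁ := I₁) (I₂ := I₂) ι (a, b), hz2] at hτ
  obtain ⟨n, hn⟩ := (hι.isWarpedImmersionOn (a, b)).normalPart_leaf₂
    (S.isCosymplecticOn hS (ι (a, b))).toIsLeviCivitaOn (isLeviCivitaOn_coordMetric a) hz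
    (isNormalPart_sff hι.smooth_ι (a, b)) hτ (h0 b)
  refine sff_eq_meanCurvature (hι.injective_mfderiv_leaf₂ (a, b)) (n := ofCoord J (ι (a, b)) n)
    fun u v ↦ ?_
  have hd : MDifferentiableAt I₂ J (fun b ↦ ι (a, b)) b :=
    (hι.smooth_leaf₂ a b).mdifferentiableAt (by simp)
  rw [inducedInner_eq_coordMetric hd, ← map_smul]
  have k := hn (toCoord I₂ b u) (toCoord I₂ b v)
  rw [← hz2, ← writtenInExtChartAt_leaf₂ (I₁ := I₁) (I₂ := I₂) ι (a, b)] at k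
  rw [← ofCoord_toCoord _ (sff I₂ J (fun b ↦ ι (a, b)) b u v)]
  refine congrArg (ofCoord J (ι (a, b)))
    (((toCoord_sff (fun b ↦ ι (a, b)) b u v).trans k).trans ?_)
  rw [writtenInExtChartAt_self, writtenInExtChartAt_self]

end IsContactCRWarpedProduct

end ContactCRWarpedProducts

end WarpedCR

end

/-! ### The theorem -/

theorem theorem1p1 (m p q : ℕ)
    {N : Type*} [TopologicalSpace N] [ChartedSpace (EuclideanSpace ℝ (Fin (2 * m + 1))) N]
    [IsManifold (𝓡 (2 * m + 1)) ∞ N]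
    [RiemannianBundle (fun x : N ↦ TangentSpace (𝓡 (2 * m + 1)) x)]
    [IsContMDiffRiemannianBundle (𝓡 (2 * m + 1)) ∞ (EuclideanSpace ℝ (Fin (2 * m + 1)))
      (fun x : N ↦ TangentSpace (𝓡 (2 * m + 1)) x)]
    {MT : Type*} [TopologicalSpace MT] [ChartedSpace (EuclideanSpace ℝ (Fin (2 * p + 1))) MT]
    [IsManifold (𝓡 (2 * p + 1)) ∞ MT]
    [RiemannianBundle (fun x : MT ↦ TangentSpace (𝓡 (2 * p + 1)) x)]
    [IsContMDiffRiemannianBundle (𝓡 (2 * p + 1)) ∞ (EuclideanSpace ℝ (Fin (2 * p + 1)))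
      (fun x : MT ↦ TangentSpace (𝓡 (2 * p + 1)) x)]
    {MP : Type*} [TopologicalSpace MP] [ChartedSpace (EuclideanSpace ℝ (Fin q)) MP]
    [IsManifold (𝓡 q) ∞ MP]
    [RiemannianBundle (fun x : MP ↦ TangentSpace (𝓡 q) x)]
    [IsContMDiffRiemannianBundle (𝓡 q) ∞ (EuclideanSpace ℝ (Fin q))
      (fun x : MP ↦ TangentSpace (𝓡 q) x)]
    (S : WarpedCR.AlmostContactMetric (𝓡 (2 * m + 1)) N) (c : ℝ)
    (hS : S.IsCosymplecticSpaceForm c)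
    (f : MT → ℝ) (ι : MT × MP → N)
    (hι : WarpedCR.IsContactCRWarpedProduct (𝓡 (2 * p + 1)) (𝓡 q) S f ι) :
    (∀ x : MT × MP,
      WarpedCR.sffNormSq ((𝓡 (2 * p + 1)).prod (𝓡 q)) (𝓡 (2 * m + 1)) ι x ≥
        2 * (q : ℝ) *
          (‖WarpedCR.grad (𝓡 (2 * p + 1)) (fun a ↦ Real.log (f a)) x.1‖ ^ 2
            - WarpedCR.laplacian (𝓡 (2 * p + 1)) (fun a ↦ Real.log (f a)) x.1
            + (p : ℝ) * c / 2)) ∧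
    ((∀ x : MT × MP,
      WarpedCR.sffNormSq ((𝓡 (2 * p + 1)).prod (𝓡 q)) (𝓡 (2 * m + 1)) ι x =
        2 * (q : ℝ) *
          (‖WarpedCR.grad (𝓡 (2 * p + 1)) (fun a ↦ Real.log (f a)) x.1‖ ^ 2
            - WarpedCR.laplacian (𝓡 (2 * p + 1)) (fun a ↦ Real.log (f a)) x.1
            + (p : ℝ) * c / 2)) →
      (∀ b : MP, WarpedCR.IsTotallyGeodesic (𝓡 (2 * p + 1)) (𝓡 (2 * m + 1))
        (fun a : MT ↦ ι (a, b))) ∧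
      (∀ a : MT, WarpedCR.IsTotallyUmbilical (𝓡 q) (𝓡 (2 * m + 1))
        (fun b : MP ↦ ι (a, b)))) := by
  have dim : ∀ n : ℕ, Module.finrank ℝ (EuclideanSpace ℝ (Fin n)) = n := fun n ↦ by simp
  have key := fun x : MT × MP ↦ hι.le_sffNormSq hS x (b := 2 * (q : ℝ) *
    (‖WarpedCR.grad (𝓡 (2 * p + 1)) (fun a ↦ Real.log (f a)) x.1‖ ^ 2
      - WarpedCR.laplacian (𝓡 (2 * p + 1)) (fun a ↦ Real.log (f a)) x.1 + (p : ℝ) * c / 2)) (by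
      -- With `dim M_T = 2p + 1`, the constant `(dim M_T - 1) c / 4` is `pc / 2`.
      rw [dim, dim]
      push_cast
      ring)
  refine ⟨fun x ↦ (key x).1, fun heq ↦ ⟨fun b ↦ ?_, fun a ↦ ?_⟩⟩
  · exact hι.isTotallyGeodesic_leaf hS.1 b fun a ↦ ((key (a, b)).2 (heq (a, b))).1
  · exact hι.isTotallyUmbilical_leaf hS.1 a fun b ↦ ((key (a, b)).2 (heq (a, b))).2
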